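/- **Setting.** Fix $k\ge 1$, a finite nonempty alphabet $\Sigma$, reals $0<\varepsilon<1$, $0<\varepsilon_{\rm adv}<1$, $\delta>0$, $M$, and integers $r\ge 1$, $T_{\max}\ge 1$. Put $c=\varepsilon/T_{\max}$, $q=\varepsilon$, $B=\lceil|\Sigma|^{2k}/\varepsilon\rceil$, $\rho=\varepsilon/(2k)$. Let $\mathcal F\subseteq\{f:\Sigma^k\to\{0,1\}\}$ and let $\mathcal A_{\rm loc}$ be any map from isomorphism classes of instances of $\mathrm{CSP}(\mathcal F)$ with a distinguished constraint to $[0,1]$. An instance $I=(V,(C_1,\dots,C_m))$ has $n$ variables; $C_i^t$ is the $t$-th variable of $C_i$, and $C_{(i,l)}$, $l\in[B]$, are copies of $C_i$ with the same predicate. Degrees count incidences $(i,t)$ with $C_i^t=v$ (so $\deg_I(v)$ is the number of constraints containing $v$ if each constraint has $k$ distinct variables). Assume $N:=n^c$ is an integer. Both algorithms use a $10T_{\max}$-wise independent hash function $H:V\to[N]$ with uniform values, drawn from the same given law. **Aggregation** (deterministic). The input is an instance $J$ whose variables are pairs $(v,j)$ (copies of $v\in V$) and whose constraints are copies $C_{(i,l)}$,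 a degree map $\mathsf{degs}'$ on its variables, a set $\mathbf C$ of constraint copies, and the marking of each $v\in V$ as low- or high-degree. Delete from $J$ all constraints adjacent to a variable with $\mathsf{degs}'>B/\rho$ and decrease $\mathsf{degs}'$ accordingly, giving $J_{\rm bdd},\mathsf{degs}'_{\rm bdd}$. Let $N(C,s)$ be the set of variables of $J_{\rm bdd}$ reached from those of $C$ by $s$ times adding all variables that share a constraint with a variable already reached. Each $C\in\mathbf C$ that is present in $J_{\rm bdd}$ and satisfies $\deg_{J_{\rm bdd}}(w)=\mathsf{degs}'_{\rm bdd}(w)$ for all $w\in N(C,r-1)$ contributes $\mathcal A_{\rm loc}(J_{\rm bdd}[N(C,r)],C)\cdot N^{T(C)}$, where $T(C)$ is the number of copies of high-degree variables in $N(C,r)$ plus the number of distinct low-degree variables with a copy in $N(C,r)$; every other $C\in\mathbf C$ contributes $0$. $\mathsf{Out}$ is the sum of the contributions divided by $|\mathbf C|$ (and $0$ if $\mathbf C=\emptyset$). **Offline estimator.** An adversary (possibly randomized, independent of all later choices) picks integers $\tilde d(v)\in(1\pm\varepsilon_{\rm adv})\deg_I(v)$. If $\tilde d(v)\le n^{q+c}/B$,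 mark $v$ low-degree and reset $\tilde d(v):=\deg_I(v)$; otherwise mark $v$ high-degree. The reduced instance $I'$ has variables $(v,j)$, $j\in[\tilde d(v)]$, and constraints $C_{(i,l)}$, the $t$-th variable of $C_{(i,l)}$ being $(v,j)$ with $v=C_i^t$ and $j\in[\tilde d(v)]$ uniform, all choices independent. Let $S'$ consist of all copies of the low-degree $v$ with $H(v)=1$, and of each copy of each high-degree variable independently with probability $n^{-c}$. Let $\mathbf C_{\rm off}$ be a uniform sample without replacement of $\lfloor n^{1-c}\rfloor$ constraint copies (all of them if there are fewer). Aggregate $I'[S']$, $\mathsf{degs}'_{\rm off}:=\deg_{I'}|_{S'}$, $\mathbf C_{\rm off}$ to get $\mathsf{Out}_{\rm off}$. **Streaming estimator.** One pass over $C_1,\dots,C_m$. When $C_i$ arrives, put each $C_i^t$ with $H(C_i^t)=1$ into $S$, and for each $t$ with $C_i^t\in S$ add $1$ to $\mathsf{degs}[C_i^t]$. Then for each $l\in[B]$: update by $C_{(i,l)}$ a reservoir sample $\mathbf C_{\rm on}$ of capacity $\lfloor n^{1-c}\rfloor$; for each $t$, put $(C_{(i,l)},t)$ into $G$ with probability $2n^{-c}$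 and into $\tilde G$ with probability $n^{-c}$, independently; put $C_{(i,l)}$ into $F$ if $C_i^t\in S$ or $(C_{(i,l)},t)\in G$ for some $t$. Write $\deg_G(v),\deg_{\tilde G}(v)$ for the numbers of pairs in $G$, $\tilde G$ with $C_i^t=v$. After the pass, $v$ is high-degree iff $\deg_{\tilde G}(v)>n^q$. Each low-degree $v\in S$ gets copies $(v,j)$, $j\in[\mathsf{degs}[v]]$, and every position $(C_{(i,l)},t)$ with $C_{(i,l)}\in F$, $C_i^t=v$ is assigned a uniform one of them. For each high-degree $v$ with $\deg_G(v)>0$, let $\tilde d(v)=\lceil\deg_{\tilde G}(v)n^c/B\rceil$, draw $J_v\sim\mathrm{Bin}(\tilde d(v),n^{-c})$ and create $(v,1),\dots,(v,J_v)$; terminate if $J_v/(\tilde d(v)\cdot2n^{-c})>1$; otherwise each $(C_{(i,l)},t)\in G$ with $C_i^t=v$ is, with this probability, assigned a uniform one of these copies. All choices are independent. $\mathsf{degs}'_{\rm on}$ counts the positions assigned to each copy. The sampled instance consists of the created copies and of those constraints in $F$ all of whose positions are assigned. The run also terminates if the number of stored items (elements of $S,F,G,\tilde G$, the reservoir, and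 created copies) exceeds $K n^{1-c/3}$. If it does not terminate, aggregate this instance, $\mathsf{degs}'_{\rm on}$ and $\mathbf C_{\rm on}$ to get $\mathsf{Out}_{\rm on}$. **Lemma.** There are $K$ and $n_0$, depending only on $k,|\Sigma|,\varepsilon,\varepsilon_{\rm adv},\delta,M,r,T_{\max}$, such that for all $\mathcal F$ and $\mathcal A_{\rm loc}$, every $n\ge n_0$ with $n^c$ an integer, every instance $I$ of $\mathrm{CSP}(\mathcal F)$ with $n$ variables and $m\le Mn$ constraints, and every hash law as above, there are an adversary as above and a coupling of the runs of the two estimators on $I$ (a joint law whose marginals are the law of the streaming estimator and the law of the offline estimator with that adversary) such that with probability greater than $1-3\delta$ all of the following hold: the streaming run is not terminated; $\mathbf C_{\rm on}=\mathbf C_{\rm off}$; the same variables are high-degree in both runs; there is an isomorphism from the streaming sampled instance to $I'[S']$ that maps each $C_{(i,l)}$ to $C_{(i,l)}$, maps copies of $v$ to copies of $v$, is the identity on copies of low-degree variables, and carries $\mathsf{degs}'_{\rm on}$ to $\mathsf{degs}'_{\rm off}$; and $\mathsf{Out}_{\rm on}=\mathsf{Out}_{\rm off}$. -/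

import Mathlib

noncomputable section

namespace TwoTier

open Finset
open scoped ENNReal

/-! ### Elementary random choices -/

theorem tsum_prod_eq_prod_tsum {ι : Type} [Fintype ι] {α : Type} (f : ι → α → ℝ≥0∞) :
    ∑' x : ι → α, ∏ i, f i (x i) = ∏ i, ∑' a, f i a := by
  revert f
  refine Fintype.induction_empty_option
    (P := fun (κ : Type) [Fintype κ] => ∀ f : κ → α → ℝ≥0∞,
      ∑' x : κ → α, ∏ i, f i (x i) = ∏ i, ∑' a, f i a) ?_ ?_ ?_ ι
  · intro κ κ' _ e h f
    let _ : Fintype κ := Fintype.ofEquiv κ' e.symm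
    have h1 := h (fun i => f (e i))
    rw [Fintype.prod_equiv e (fun i => ∑' a, f (e i) a) (fun i => ∑' a, f i a)
      (fun _ => rfl)] at h1
    rw [← h1, ← (Equiv.arrowCongr e (Equiv.refl α)).tsum_eq]
    refine tsum_congr fun x => ?_
    rw [← Fintype.prod_equiv e (fun i => f (e i) (x i)) _ (fun i => by simp)]
  · intro f
    simp
  · intro κ _ h f
    rw [← (Equiv.piOptionEquivProd (β := fun _ : Option κ => α)).symm.tsum_eq,
      ENNReal.tsum_prod', Fintype.prod_option, ← h, ← ENNReal.tsum_mul_right]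
    refine tsum_congr fun a => ?_
    rw [← ENNReal.tsum_mul_left]
    refine tsum_congr fun x => ?_
    rw [Fintype.prod_option]
    rfl

/-- Independent draws, one from each of finitely many laws (the product law). -/
def indep {ι : Type} [Fintype ι] {α : Type} (f : ι → PMF α) : PMF (ι → α) :=
  ⟨fun x => ∏ i, f i (x i), by
    rw [ENNReal.summable.hasSum_iff, tsum_prod_eq_prod_tsum]
    simp [PMF.tsum_coe]⟩

/-- A coin that shows `true` with probability `p` (truncated to `[0,1]`). -/
def coin (p : ℝ) : PMF Bool :=
  PMF.ofFintype (fun b => cond b (min (ENNReal.ofReal p) 1) (1 - min (ENNReal.ofReal p) 1))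
    (by simp)

/-- A uniformly random element of `{0, …, d - 1}`, the index set written `[d]` in mathematics
(for `d = 0` there is nothing to choose, and the value `0` is returned). -/
def uniformBelow (d : ℕ) : PMF ℕ :=
  if h : (range d).Nonempty then PMF.uniformOfFinset (range d) h else PMF.pure 0

/-- A random subset of `s` that contains each element independently with probability `p`. -/
def randomSubset {α : Type} [DecidableEq α] (s : Finset α) (p : ℝ) : PMF (Finset α) :=
  (indep fun _ : s => coin p).map fun b => (s.attach.filter fun a => b a = true).image Subtype.val

/-- A uniformly random set of `min r |α|` elements of `α` (sampling `r` elements without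
replacement, or taking everything if there are fewer than `r` elements). -/
def uniformSample (α : Type) [Fintype α] [DecidableEq α] (r : ℕ) : PMF (Finset α) :=
  PMF.uniformOfFinset (powersetCard (min r (Fintype.card α)) (univ : Finset α))
    (powersetCard_nonempty.2 (min_le_right _ _))

/-! ### Instances of `CSP(𝓕)` -/

variable {k : ℕ} {A : Type*} {𝓕 : Set ((Fin k → A) → Bool)} {n m : ℕ}

/-- An instance of `CSP(𝓕)` with variables `Fin n` and constraints `C_i`, `i : Fin m`, over
the alphabet `A`; `scope i t` is the `t`-th variable of `C_i`, and `pred i` its predicate.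
The order of the constraints is the order of the stream. -/
structure CSPInstance (𝓕 : Set ((Fin k → A) → Bool)) (n m : ℕ) where
  scope : Fin m → Fin k → Fin n
  pred : Fin m → 𝓕

/-- The degree of a variable: the number of constraints adjacent to it, where a constraint that
uses the variable in several positions counts with that multiplicity. -/
def CSPInstance.deg (I : CSPInstance 𝓕 n m) (v : Fin n) : ℕ :=
  #{p : Fin m × Fin k | I.scope p.1 p.2 = v}

/-- If every constraint has `k` distinct variables, the degree is the number of constraints
that contain the variable. -/
theorem CSPInstance.deg_eq_card (I : CSPInstance 𝓕 n m)
    (hI : ∀ i, Function.Injective (I.scope i)) (v : Fin n) :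
    I.deg v = #{i : Fin m | ∃ t, I.scope i t = v} := by
  refine card_bij' (fun p _ => p.1)
    (fun i hi => (i, ((mem_filter.1 hi).2).choose)) ?_ ?_ ?_ ?_
  · intro p hp
    exact mem_filter.2 ⟨mem_univ _, p.2, (mem_filter.1 hp).2⟩
  · intro i hi
    exact mem_filter.2 ⟨mem_univ _, ((mem_filter.1 hi).2).choose_spec⟩
  · intro p hp
    have h : ∃ t, I.scope p.1 t = v := ⟨p.2, (mem_filter.1 hp).2⟩
    exact Prod.ext rfl (hI p.1 (h.choose_spec.trans (mem_filter.1 hp).2.symm))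
  · intro i hi
    rfl

/-! ### Neighbourhoods up to isomorphism -/

/-- An instance of `CSP(𝓕)` with a distinguished constraint. -/
structure RootedInst (𝓕 : Set ((Fin k → A) → Bool)) where
  Var : Type
  Con : Type
  scope : Con → Fin k → Var
  pred : Con → 𝓕
  root : Con

/-- Isomorphism of instances with a distinguished constraint. -/
def RootedInst.Iso (M N : RootedInst 𝓕) : Prop :=
  ∃ (f : M.Var ≃ N.Var) (g : M.Con ≃ N.Con),
    (∀ e t, N.scope (g e) t = f (M.scope e t)) ∧ (∀ e, N.pred (g e) = M.pred e) ∧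
      g M.root = N.root

instance rootedSetoid (𝓕 : Set ((Fin k → A) → Bool)) : Setoid (RootedInst 𝓕) where
  r := RootedInst.Iso
  iseqv :=
    { refl := fun _ => ⟨Equiv.refl _, Equiv.refl _, fun _ _ => rfl, fun _ => rfl, rfl⟩
      symm := by
        rintro M N ⟨f, g, h1, h2, h3⟩
        refine ⟨f.symm, g.symm, fun e t => ?_, fun e => ?_, ?_⟩
        · rw [Equiv.eq_symm_apply, ← h1, Equiv.apply_symm_apply]
        · rw [← h2, Equiv.apply_symm_apply]
        · rw [← h3, Equiv.symm_apply_apply]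
      trans := by
        rintro M N L ⟨f, g, h1, h2, h3⟩ ⟨f', g', h1', h2', h3'⟩
        refine ⟨f.trans f', g.trans g', fun e t => ?_, fun e => ?_, ?_⟩
        · simp [h1, h1']
        · simp [h2, h2']
        · simp [h3, h3'] }

/-- Isomorphism classes of constraint neighbourhoods: the inputs of a local algorithm. -/
abbrev NbhdClass (𝓕 : Set ((Fin k → A) → Bool)) := Quotient (rootedSetoid 𝓕)

section Partial

/-! In this section `σ e` is the tuple of variables of the constraint with label `e` if that
constraint is present, and `none` if it is not. -/

variable {X Y : Type}

/-- Degree (with multiplicity) of the variable `x` in the instance `σ`. -/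
def degIn (σ : Y → Option (Fin k → X)) (x : X) : ℕ :=
  Set.ncard {p : Y × Fin k | ∃ s, σ p.1 = some s ∧ s p.2 = x}

/-- The variables in the `r`-neighbourhood of the constraint `e`: its own variables for
`r = 0`, and then all variables that share a constraint with a variable reached before. -/
def ball (σ : Y → Option (Fin k → X)) (e : Y) : ℕ → Set X
  | 0 => {x | ∃ s t, σ e = some s ∧ s t = x}
  | r + 1 => ball σ e r ∪
      {x | ∃ e' s t t', σ e' = some s ∧ s t ∈ ball σ e r ∧ s t' = x}

theorem mem_ball (σ : Y → Option (Fin k → X)) {e : Y} {s : Fin k → X} (h : σ e = some s)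
    (r : ℕ) (t : Fin k) : s t ∈ ball σ e r := by
  induction r with
  | zero => exact ⟨s, t, h, rfl⟩
  | succ r ih => exact Or.inl ih

/-- The `r`-neighbourhood of the constraint `e`: the instance induced on `ball σ e r`, that is,
all constraints with all their variables in that set, with `e` distinguished. -/
def nbhd (σ : Y → Option (Fin k → X)) (pred : Y → 𝓕) (r : ℕ) (e : Y)
    (he : ∃ s, σ e = some s) : RootedInst 𝓕 where
  Var := ball σ e r
  Con := {e' : Y // ∃ s, σ e' = some s ∧ ∀ t, s t ∈ ball σ e r}
  scope e' t := ⟨e'.2.choose t, e'.2.choose_spec.2 t⟩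
  pred e' := pred e'.1
  root := ⟨e, he.choose, he.choose_spec, mem_ball σ he.choose_spec r⟩

end Partial

/-! ### Parameters -/

/-- Numerical parameters shared by the two estimators. -/
structure Params where
  /-- number `B` of copies of each constraint -/
  B : ℕ
  /-- range `n^c` of the hash function; `1 / N` is the sampling rate `n^{-c}` -/
  N : ℕ
  /-- degree threshold `n^q` -/
  thr : ℝ
  /-- the degree bound `B / ρ` -/
  degBound : ℝ
  /-- the number `n^{1-c}` of sampled constraint copies -/
  size : ℕ
  /-- the radius `r` of the local algorithm -/
  radius : ℕ
  /-- the space bound of the streaming algorithm, in stored items -/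
  cap : ℝ

/-- The parameters `B = |Σ|^{2k}/ε`, `ρ = ε/(2k)`, `q = ε`, `c = ε / T` and `N = n^c`, with
space bound `K n^{1-c/3}` (integer quantities are rounded where necessary). -/
def mkParams (a k n : ℕ) (ε : ℝ) (T r N : ℕ) (K : ℝ) : Params where
  B := ⌈(a : ℝ) ^ (2 * k) / ε⌉₊
  N := N
  thr := (n : ℝ) ^ ε
  degBound := (⌈(a : ℝ) ^ (2 * k) / ε⌉₊ : ℝ) / (ε / (2 * k))
  size := ⌊(n : ℝ) ^ (1 - ε / T)⌋₊
  radius := r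
  cap := K * (n : ℝ) ^ (1 - ε / T / 3)

/-- Labels `(i, l)` of the constraint copies `C_(i,l)`. The copy `C_(i,l)` carries the predicate
and the (original) variables of `C_i`. -/
abbrev Copy (m : ℕ) (P : Params) := Fin m × Fin P.B

/-! ### The sampled reduced instance and the aggregation step -/

/-- What is handed to the aggregation step: a subsampled reduced instance, whose variables are
copies `(v, j)` of original variables, and whose constraints are constraint copies; a map of
degrees; a set of sampled constraint copies; and the tier of each original variable. -/
structure Sample (k n m : ℕ) (P : Params) where
  /-- the variables of the instance -/
  vars : Finset (Fin n × ℕ)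
  /-- the variables of the copy `e`, or `none` if `e` does not belong to the instance -/
  scope : Copy m P → Option (Fin k → Fin n × ℕ)
  /-- the degree map, to be read on `vars` -/
  degs : Fin n × ℕ → ℕ
  /-- the original variables marked as high-degree -/
  high : Finset (Fin n)
  /-- the set of sampled constraint copies -/
  sampled : Finset (Copy m P)

variable {P : Params}

/-- The constraints that remain after removing every constraint adjacent to a variable whose
recorded degree exceeds the degree bound. -/
def Sample.bddScope (s : Sample k n m P) (e : Copy m P) : Option (Fin k → Fin n × ℕ) :=
  open Classical in
  (s.scope e).filter fun x => decide (∀ t, (s.degs (x t) : ℝ) ≤ P.degBound)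

/-- The recorded degrees, decreased for all variables adjacent to removed constraints. -/
def Sample.bddDegs (s : Sample k n m P) (w : Fin n × ℕ) : ℕ :=
  s.degs w - Set.ncard {p : Copy m P × Fin k |
    ∃ x, s.scope p.1 = some x ∧ s.bddScope p.1 = none ∧ x p.2 = w}

/-- The number of dependencies of the copy `e`: high-degree variable copies in its
neighbourhood, plus distinct parents of low-degree variable copies in its neighbourhood. -/
def Sample.deps (s : Sample k n m P) (e : Copy m P) : ℕ :=
  Set.ncard {w | w ∈ ball s.bddScope e P.radius ∧ w.1 ∈ s.high} +
    Set.ncard {v | v ∉ s.high ∧ ∃ j, (v, j) ∈ ball s.bddScope e P.radius}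

/-- The contribution of the sampled copy `e`. A copy that is missing or has been removed (a dummy
constraint that always fails) contributes `0`. -/
def contribution (I : CSPInstance 𝓕 n m) (loc : NbhdClass 𝓕 → Set.Icc (0 : ℝ) 1)
    (s : Sample k n m P) (e : Copy m P) : ℝ :=
  open Classical in
  if he : ∃ x, s.bddScope e = some x then
    if ∀ w ∈ ball s.bddScope e (P.radius - 1), degIn s.bddScope w = s.bddDegs w then
      (loc ⟦nbhd s.bddScope (fun e' => I.pred e'.1) P.radius e he⟧ : ℝ) * (P.N : ℝ) ^ s.deps e
    else 0
  else 0

/-- The aggregation step (the same in both estimators). -/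
def aggregate (I : CSPInstance 𝓕 n m) (loc : NbhdClass 𝓕 → Set.Icc (0 : ℝ) 1)
    (s : Sample k n m P) : ℝ :=
  (∑ e ∈ s.sampled, contribution I loc s e) / #s.sampled

/-- The copies `(v, j)`, `j ∈ [d v]`, of the variables `v ∈ U`. -/
def copies (U : Finset (Fin n)) (d : Fin n → ℕ) : Finset (Fin n × ℕ) :=
  U.biUnion fun v => (range (d v)).image fun j => (v, j)

/-! ### The offline estimator -/

/-- The offline estimator, run with a hash law and an adversary that picks the values `d̃` by a
random process: the internal state before aggregation, and the output `Out`. -/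
def offlineEstimator (I : CSPInstance 𝓕 n m) (P : Params)
    (loc : NbhdClass 𝓕 → Set.Icc (0 : ℝ) 1) (hash : PMF (Fin n → Fin P.N))
    (adv : PMF (Fin n → ℕ)) : PMF (Sample k n m P × ℝ) :=
  open Classical in do
  let d₀ ← adv
  -- `v` is low-degree if `d̃(v) ≤ n^{q+c}/B`, and then `d̃(v)` is reset to `deg v`
  let high : Finset (Fin n) := {v | ¬ ((d₀ v : ℝ) ≤ P.thr * P.N / P.B)}
  let d : Fin n → ℕ := fun v => if v ∈ high then d₀ v else I.deg v
  -- the reduction: the `t`-th variable of the copy `e` is `reduced e t`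
  let x ← indep fun p : Copy m P × Fin k => uniformBelow (d (I.scope p.1.1 p.2))
  let reduced : Copy m P → Fin k → Fin n × ℕ := fun e t => (I.scope e.1 t, x (e, t))
  -- the sampled variable copies
  let H ← hash
  let lowKept := copies {v | v ∉ high ∧ (H v : ℕ) = 0} d
  let highKept ← randomSubset (copies high d) (1 / P.N)
  let kept := lowKept ∪ highKept
  let C ← uniformSample (Copy m P) P.size
  let s : Sample k n m P :=
    { vars := kept
      scope := fun e => if ∀ t, reduced e t ∈ kept then some (reduced e) else none
      degs := fun w => #{p : Copy m P × Fin k | reduced p.1 p.2 = w}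
      high := high
      sampled := C }
  pure (s, aggregate I loc s)

/-! ### The streaming estimator -/

/-- The memory of the streaming algorithm during the pass (apart from the hash function). -/
structure Sketch (k n m : ℕ) (P : Params) where
  S : Finset (Fin n)
  degs : Fin n → ℕ
  F : Finset (Copy m P)
  G : Finset (Copy m P × Fin k)
  Gt : Finset (Copy m P × Fin k)
  /-- the contents of the reservoir -/
  res : List (Copy m P)
  /-- the counter of the reservoir -/
  count : ℕ

/-- Reservoir update: fill the reservoir up to `size` items; afterwards replace, with probability
`size / count`, the item at a random position. -/
def updateReservoir {α : Type} (size : ℕ) (e : α) (R : List α) (count : ℕ) :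
    PMF (List α × ℕ) :=
  if count ≤ size then pure (R ++ [e], count + 1)
  else do
    let b ← coin ((size : ℝ) / count)
    if b then do
      let i ← uniformBelow size
      pure (R.set i e, count + 1)
    else pure (R, count + 1)

/-- Processing the copy `C_(i,l)` of the current constraint. -/
def copyStep (I : CSPInstance 𝓕 n m) (i : Fin m) (s : Sketch k n m P) (l : Fin P.B) :
    PMF (Sketch k n m P) := do
  let R ← updateReservoir P.size ((i, l) : Copy m P) s.res s.count
  let g ← indep fun _ : Fin k => coin (2 / P.N)
  let gt ← indep fun _ : Fin k => coin (1 / P.N)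
  let G := s.G ∪ ({t | g t = true} : Finset (Fin k)).image fun t => ((i, l), t)
  pure
    { S := s.S
      degs := s.degs
      F := if ∃ t, I.scope i t ∈ s.S ∨ ((i, l), t) ∈ G then insert (i, l) s.F else s.F
      G := G
      Gt := s.Gt ∪ ({t | gt t = true} : Finset (Fin k)).image fun t => ((i, l), t)
      res := R.1
      count := R.2 }

/-- Processing the constraint `C_i` of the stream: first `S` and the degree counters (each
occurrence of a variable of `S` in `C_i` is counted once), then the `B` copies of `C_i`. -/
def constraintStep (I : CSPInstance 𝓕 n m) (H : Fin n → Fin P.N) (s : Sketch k n m P)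
    (i : Fin m) : PMF (Sketch k n m P) :=
  let S := s.S ∪ ({t | (H (I.scope i t) : ℕ) = 0} : Finset (Fin k)).image (I.scope i)
  let s' : Sketch k n m P :=
    { s with
      S := S
      degs := fun v => if v ∈ S then s.degs v + #{t | I.scope i t = v} else s.degs v }
  (List.finRange P.B).foldlM (copyStep I i) s'

/-- The sketch after one pass over the stream `C_1, …, C_m`. -/
def sketch (I : CSPInstance 𝓕 n m) (H : Fin n → Fin P.N) : PMF (Sketch k n m P) :=
  (List.finRange m).foldlM (constraintStep I H)
    { S := ∅, degs := fun _ => 0, F := ∅, G := ∅, Gt := ∅, res := [], count := 1 }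

/-- The number of pairs in `G` that refer to the variable `v`. -/
def degG (I : CSPInstance 𝓕 n m) (G : Finset (Copy m P × Fin k)) (v : Fin n) : ℕ :=
  #{p ∈ G | I.scope p.1.1 p.2 = v}

/-- The streaming reduction. It consults `I` only at constraints that have a stored copy. It
returns `none` if a resampling probability exceeds `1`. -/
def streamingReduction (I : CSPInstance 𝓕 n m) (s : Sketch k n m P) :
    PMF (Option (Sample k n m P)) :=
  open Classical in do
  let high : Finset (Fin n) := {v | P.thr < degG I s.Gt v}
  let d : Fin n → ℕ := fun v => ⌈(degG I s.Gt v : ℝ) * P.N / P.B⌉₊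
  -- the high-degree variables that are referred to in `G`
  let highG : Finset (Fin n) := {v | v ∈ high ∧ 0 < degG I s.G v}
  -- the number `J v` of simulated copies of the high-degree variable `v`
  let J ← indep fun v : Fin n =>
    if v ∈ highG then (randomSubset (range (d v)) (1 / P.N)).map card else pure 0
  if ∃ v ∈ highG, 1 < (J v : ℝ) / (d v * (2 / P.N)) then pure none
  else do
    -- the copy of its variable that position `t` of the constraint copy `e` receives, if any
    let a ← indep fun p : Copy m P × Fin k =>
      let v := I.scope p.1.1 p.2
      if v ∈ high then
        if p ∈ s.G then do
          let b ← coin ((J v : ℝ) / (d v * (2 / P.N)))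
          if b then (uniformBelow (J v)).map some else pure none
        else pure none
      else if v ∈ s.S ∧ p.1 ∈ s.F then (uniformBelow (s.degs v)).map some
      else pure none
    pure <| some
      { vars := copies {v | v ∈ s.S ∧ v ∉ high} s.degs ∪ copies highG J
        scope := fun e =>
          if e ∈ s.F ∧ ∀ t, (a (e, t)).isSome then
            some fun t => (I.scope e.1 t, (a (e, t)).getD 0)
          else none
        degs := fun w => #{p : Copy m P × Fin k | I.scope p.1.1 p.2 = w.1 ∧ a p = some w.2}
        high := high
        sampled := s.res.toFinset }

/-- The number of items in memory. None of the stored sets shrinks before it is counted, so that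
this is the maximum over the whole run; `degs` and the degree map are indexed by `S` and by the
variable copies. -/
def space (s : Sketch k n m P) (s' : Sample k n m P) : ℕ :=
  #s.S + #s.F + #s.G + #s.Gt + s.res.length + #s'.vars

/-- The streaming estimator, run with a hash law: the internal state before aggregation and the
output `Out`, or `none` if the run is terminated because a resampling probability exceeds `1` or
the space bound is exceeded. -/
def streamingEstimator (I : CSPInstance 𝓕 n m) (P : Params)
    (loc : NbhdClass 𝓕 → Set.Icc (0 : ℝ) 1) (hash : PMF (Fin n → Fin P.N)) :
    PMF (Option (Sample k n m P × ℝ)) :=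
  open Classical in do
  let H ← hash
  let s ← sketch I H
  let o ← streamingReduction I s
  match o with
  | none => pure none
  | some s' =>
    if P.cap < space s s' then pure none else pure (some (s', aggregate I loc s'))

/-! ### Hash laws, adversaries, couplings, agreement -/

/-- A random function into `Fin N` is `t`-wise independent (with uniform values). -/
def KWiseIndep {N : ℕ} (hash : PMF (Fin n → Fin N)) (t : ℕ) : Prop :=
  ∀ (U : Finset (Fin n)), #U ≤ t → ∀ g : Fin n → Fin N,
    hash.toOuterMeasure {H | ∀ v ∈ U, H v = g v} = ((N : ℝ≥0∞)⁻¹) ^ #U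

/-- A (randomised) adversary that respects the range `(1 ± η) deg v`. -/
def ValidAdversary (I : CSPInstance 𝓕 n m) (η : ℝ) (adv : PMF (Fin n → ℕ)) : Prop :=
  ∀ d ∈ adv.support, ∀ v, (1 - η) * I.deg v ≤ d v ∧ (d v : ℝ) ≤ (1 + η) * I.deg v

/-- `μ` is a coupling of the laws `p` and `q`. -/
def IsCoupling {α β : Type} (μ : PMF (α × β)) (p : PMF α) (q : PMF β) : Prop :=
  μ.map Prod.fst = p ∧ μ.map Prod.snd = q

/-- The sampled constraint sets and the tiers coincide, and there is an isomorphism of the sampled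
reduced instances under which the degree maps coincide: a bijection of the variable copies that
preserves parents and fixes the copies of low-degree variables, such that the same constraint
copies are present in both and have corresponding variables. (A constraint copy has the
same predicate in both.) -/
def Agree (s s' : Sample k n m P) : Prop :=
  s.sampled = s'.sampled ∧ s.high = s'.high ∧
    ∃ φ : s.vars ≃ s'.vars,
      (∀ w, (φ w).1.1 = w.1.1) ∧
      (∀ w, w.1.1 ∉ s.high → (φ w).1 = w.1) ∧
      (∀ w, s'.degs (φ w).1 = s.degs w.1) ∧
      (∀ e, Option.Rel (fun x y => ∀ t, ∃ h : x t ∈ s.vars, (φ ⟨x t, h⟩).1 = y t)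
        (s.scope e) (s'.scope e))

end TwoTier

end

noncomputable section

namespace TwoTier

open Finset
open scoped ENNReal

/-! ### Product laws -/

/-! The two estimators can be driven by the same random choices. The tiers and degree estimates of
the streaming run depend on `G̃` alone, so the adversary draws `G̃` itself. It answers with the
streaming estimate for variables that `G̃` declares high, and with a value at or below the threshold
for the others (`advDeg`). The latter value only has to force the low mark, because the offline
estimator then resets it to the true degree. When `G̃` is misleading the adversary reports true
degrees, so it respects its range on every outcome (`validAdversary_advDeg`). Outside that event the
two runs have the same tiers and the same degree values (`offTier_advDeg`).

To share randomness, both laws are first brought into a common form (`streamingEstimator_eq`,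
`offlineEstimator_eq`): draw `G̃` (or the adversary's simulation of it), the hash function `H`, the
constraint sample `C`, a family `K` of random subsets `K v` of `[d̃(v)]` for the high-degree
variables, and then the positions. For the streaming run this rests on three facts. The pass stores
precisely the incidences of the variables with hash value zero (`sketch_eq`). The reservoir, as a
set, is a uniform sample without replacement (`reservoirLaw_bind_eq`). A binomial count `J v` is the
size of a random subset of `[d̃(v)]` (`copyCount_law`).

The heart is the last draw. Offline, a position of a high-degree `v` picks a uniform `x` in
`[d̃(v)]` and survives if `x ∈ K v`. The streaming run keeps the position in `G` with probability
`2/N`, accepts it with probability `J/(d̃·2/N)`, and picks one of `J` copies. The product of the two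
probabilities is `J/d̃`, so the outcome is distributed as the rank of `x` inside `K v`
(`assignLaw_eq`). Hence the streaming assignment and the image of the offline one have the same law
(`pairLaw_map_snd`), and the two draws can be coupled along this common value. On the coupled
outcome, sending rank to element is the required isomorphism (`agree_of_match`), and aggregation
cannot distinguish isomorphic samples (`Agree.aggregate_eq`).

What can fail is: `G̃` misjudges a degree or is too large; some `K v` exceeds twice its mean, so
that an acceptance probability exceeds one; `G` misses a high-degree variable or is too large; the
variables of hash value zero carry too many incidences. The last event is controlled by Markov's
inequality, the others by Chernoff bounds (`randomSubset_upper_tail`, `randomSubset_lower_tail`)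
with union bounds. `exists_coupling_estimators` adds up the errors, and the main theorem makes them
at most `2δ`. -/

theorem pmf_do_bind {α β : Type} (p : PMF α) (f : α → PMF β) : (p >>= f) = p.bind f := rfl

theorem pmf_do_pure {α : Type} (a : α) : (Pure.pure a : PMF α) = PMF.pure a := rfl

section Indep

variable {ι : Type} [Fintype ι] {α β : Type}

theorem indep_apply (f : ι → PMF α) (x : ι → α) : indep f x = ∏ i, f i (x i) := rfl

/-- Exchanging a finite product with infinite sums; this lets a two-stage experiment performed at
every index be split into two global stages. -/
theorem indep_bind (f : ι → PMF α) (g : ι → α → PMF β) :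
    (indep fun i => (f i).bind (g i)) = (indep f).bind fun x => indep fun i => g i (x i) := by
  ext y
  simp only [indep_apply, PMF.bind_apply, ← Finset.prod_mul_distrib]
  rw [tsum_prod_eq_prod_tsum (fun i a => f i a * g i a (y i))]

theorem indep_pure (x : ι → α) : (indep fun i => PMF.pure (x i)) = PMF.pure x := by
  ext y
  simp only [indep_apply, PMF.pure_apply]
  by_cases h : y = x
  · subst h; simp
  · rw [if_neg h]
    obtain ⟨i, hi⟩ := Function.ne_iff.1 h
    exact Finset.prod_eq_zero (mem_univ i) (if_neg hi)

theorem indep_map (f : ι → PMF α) (g : ι → α → β) :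
    (indep fun i => (f i).map (g i)) = (indep f).map fun x i => g i (x i) := by
  have := indep_bind f fun i a => PMF.pure (g i a)
  simp only [indep_pure] at this
  exact this

theorem mem_support_indep {f : ι → PMF α} {x : ι → α} :
    x ∈ (indep f).support ↔ ∀ i, x i ∈ (f i).support := by
  simp [PMF.mem_support_iff, indep_apply, Finset.prod_eq_zero_iff]

/-- Expectations of products factor under independence. It serves both for moment generating
functions and for marginals. -/
theorem tsum_indep_mul_prod (f : ι → PMF α) (g : ι → α → ℝ≥0∞) :
    ∑' x, indep f x * ∏ i, g i (x i) = ∏ i, ∑' a, f i a * g i a := by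
  rw [← tsum_prod_eq_prod_tsum]
  simp only [indep_apply, Finset.prod_mul_distrib]

end Indep

/-! ### Coins and uniform draws -/

theorem coin_true (p : ℝ) : coin p true = min (ENNReal.ofReal p) 1 := rfl

theorem coin_false (p : ℝ) : coin p false = 1 - min (ENNReal.ofReal p) 1 := rfl

theorem coin_true_of_le_one {p : ℝ} (h : p ≤ 1) : coin p true = ENNReal.ofReal p := by
  rw [coin_true, min_eq_left]
  simpa using h

theorem coin_ext {p q : PMF Bool} (h : p true = q true) : p = q := by
  have hp := p.tsum_coe
  have hq := q.tsum_coe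
  rw [tsum_bool] at hp hq
  have : p false = q false := by
    have hp' : p false = 1 - p true := ENNReal.eq_sub_of_add_eq (p.apply_ne_top _) hp
    have hq' : q false = 1 - q true := ENNReal.eq_sub_of_add_eq (q.apply_ne_top _) hq
    rw [hp', hq', h]
  ext b; cases b <;> assumption

theorem coin_bind_apply {α : Type} (p : ℝ) (f : Bool → PMF α) (a : α) :
    (coin p).bind f a = coin p true * f true a + coin p false * f false a := by
  rw [PMF.bind_apply, tsum_bool, add_comm]

theorem uniformBelow_apply {d : ℕ} (hd : 0 < d) (x : ℕ) :
    uniformBelow d x = if x < d then (d : ℝ≥0∞)⁻¹ else 0 := by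
  have h : (range d).Nonempty := by simpa using hd.ne'
  rw [uniformBelow, dif_pos h, PMF.uniformOfFinset_apply]
  simp

theorem lt_of_mem_support_uniformBelow {d x : ℕ} (hd : 0 < d)
    (hx : x ∈ (uniformBelow d).support) : x < d := by
  rw [PMF.mem_support_iff, uniformBelow_apply hd] at hx
  by_contra h
  simp [h] at hx

/-! ### Markov's inequality -/

theorem toOuterMeasure_le_tsum {α : Type} (p : PMF α) (E : Set α) (g : α → ℝ≥0∞)
    (h : ∀ x ∈ E, 1 ≤ g x) : p.toOuterMeasure E ≤ ∑' x, p x * g x := by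
  rw [PMF.toOuterMeasure_apply]
  refine ENNReal.tsum_le_tsum fun x => ?_
  by_cases hx : x ∈ E
  · rw [Set.indicator_of_mem hx]
    exact le_mul_of_one_le_right' (h x hx)
  · simp [Set.indicator_of_notMem hx]

theorem toOuterMeasure_le_one {α : Type} (p : PMF α) (E : Set α) : p.toOuterMeasure E ≤ 1 := by
  refine (toOuterMeasure_le_tsum p E (fun _ => 1) fun _ _ => le_rfl).trans ?_
  simp [PMF.tsum_coe]

theorem toOuterMeasure_compl {α : Type} (p : PMF α) (E : Set α) :
    p.toOuterMeasure E = 1 - p.toOuterMeasure Eᶜ := by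
  have h : p.toOuterMeasure E + p.toOuterMeasure Eᶜ = 1 := by
    rw [PMF.toOuterMeasure_apply, PMF.toOuterMeasure_apply, ← ENNReal.tsum_add, ← p.tsum_coe]
    exact tsum_congr fun x => Set.indicator_self_add_compl_apply E p x
  exact ENNReal.eq_sub_of_add_eq
    (ne_top_of_le_ne_top ENNReal.one_ne_top (toOuterMeasure_le_one _ _)) h

/-- Markov's inequality for a weighted count of events. -/
theorem markov_weighted_count {α ι : Type} (p : PMF α) (s : Finset ι) (w : ι → ℝ≥0∞)
    (E : ι → Set α) (a : ℝ≥0∞) (ha : a ≠ 0) (ha' : a ≠ ∞) :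
    p.toOuterMeasure {x | a < ∑ i ∈ s, (E i).indicator (fun _ => w i) x} ≤
      (∑ i ∈ s, w i * p.toOuterMeasure (E i)) / a := by
  classical
  refine (toOuterMeasure_le_tsum p _
    (fun x => (∑ i ∈ s, (E i).indicator (fun _ => w i) x) / a) fun x hx => ?_).trans (le_of_eq ?_)
  · rw [ENNReal.le_div_iff_mul_le (Or.inl ha) (Or.inl ha'), one_mul]
    exact le_of_lt hx
  · simp only [div_eq_mul_inv, ← mul_assoc]
    rw [ENNReal.tsum_mul_right]
    congr 1
    simp only [Finset.mul_sum]
    rw [Summable.tsum_finsetSum fun _ _ => ENNReal.summable]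
    refine Finset.sum_congr rfl fun i _ => ?_
    rw [PMF.toOuterMeasure_apply, ← ENNReal.tsum_mul_left]
    refine tsum_congr fun x => ?_
    by_cases h : x ∈ E i <;> simp [h, mul_comm]

/-! ### Couplings that satisfy a relation up to a small error -/

/-- There is a coupling of `p` and `q` under which `R` fails with probability at most `e`. -/
def Coup {α β : Type} (p : PMF α) (q : PMF β) (R : α → β → Prop) (e : ℝ≥0∞) : Prop :=
  ∃ μ : PMF (α × β), IsCoupling μ p q ∧ μ.toOuterMeasure {z | ¬ R z.1 z.2} ≤ e

section Coup

variable {Ω α β γ : Type}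

theorem Coup.mono {p : PMF α} {q : PMF β} {R : α → β → Prop} {e e' : ℝ≥0∞}
    (h : Coup p q R e) (he : e ≤ e') : Coup p q R e' := by
  obtain ⟨μ, h1, h2⟩ := h
  exact ⟨μ, h1, h2.trans he⟩

/-- The independent coupling always exists; it is used on outcomes that have been written off as
bad. -/
theorem coup_one (p : PMF α) (q : PMF β) (R : α → β → Prop) : Coup p q R 1 := by
  refine ⟨p.bind fun a => q.map fun b => (a, b), ⟨?_, ?_⟩, toOuterMeasure_le_one _ _⟩
  · simp only [PMF.map_bind, PMF.map_comp, Function.comp_def]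
    rw [show (fun a : α => q.map fun _ : β => a) = PMF.pure from
      funext fun a => PMF.map_const q a]
    exact PMF.bind_pure p
  · simp only [PMF.map_bind, PMF.map_comp, Function.comp_def]
    rw [PMF.bind_const]
    exact PMF.map_id q

/-- A first draw can be shared by both sides: outside the bad outcomes the conditional couplings are
used, and on the bad ones any coupling will do, at the cost of their probability. -/
theorem Coup.bind (μ₀ : PMF Ω) {p : Ω → PMF α} {q : Ω → PMF β} {R : α → β → Prop}
    (bad : Set Ω) {e : ℝ≥0∞} (h : ∀ ω ∉ bad, Coup (p ω) (q ω) R e) :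
    Coup (μ₀.bind p) (μ₀.bind q) R (μ₀.toOuterMeasure bad + e) := by
  classical
  have h' : ∀ ω, Coup (p ω) (q ω) R (bad.indicator 1 ω + e) := by
    intro ω
    by_cases hω : ω ∈ bad
    · exact (coup_one _ _ _).mono (by simp [hω])
    · exact (h ω hω).mono (by simp)
  choose μ h1 h2 using h'
  refine ⟨μ₀.bind μ, ⟨?_, ?_⟩, ?_⟩
  · rw [PMF.map_bind]; exact congrArg _ (funext fun ω => (h1 ω).1)
  · rw [PMF.map_bind]; exact congrArg _ (funext fun ω => (h1 ω).2)
  · rw [PMF.toOuterMeasure_bind_apply]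
    refine (ENNReal.tsum_le_tsum fun ω => mul_le_mul_right (h2 ω) _).trans ?_
    simp only [mul_add]
    rw [ENNReal.tsum_add, ENNReal.tsum_mul_right, PMF.tsum_coe, one_mul,
      PMF.toOuterMeasure_apply]
    refine add_le_add (le_of_eq (tsum_congr fun ω => ?_)) le_rfl
    by_cases hω : ω ∈ bad <;> simp [hω]

theorem Coup.of_map {α' β' : Type} {p : PMF α} {q : PMF β} {f : α → α'} {g : β → β'}
    {R : α' → β' → Prop} {e : ℝ≥0∞} (h : Coup p q (fun a b => R (f a) (g b)) e) :
    Coup (p.map f) (q.map g) R e := by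
  obtain ⟨μ, ⟨h1, h2⟩, h3⟩ := h
  refine ⟨μ.map (Prod.map f g), ⟨?_, ?_⟩, ?_⟩
  · rw [PMF.map_comp, ← h1, PMF.map_comp]; rfl
  · rw [PMF.map_comp, ← h2, PMF.map_comp]; rfl
  · rwa [PMF.toOuterMeasure_map_apply]

theorem tsum_map_mul (p : PMF α) (f : α → γ) (g : γ → ℝ≥0∞) :
    ∑' c, p.map f c * g c = ∑' a, p a * g (f a) := by
  classical
  simp only [PMF.map_apply, ← ENNReal.tsum_mul_right]
  rw [ENNReal.tsum_comm]
  refine tsum_congr fun a => ?_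
  rw [tsum_eq_single (f a)]
  · simp
  · intro c hc; simp [hc]

/-- Two laws with a common image can be coupled along that image. -/
theorem exists_coupling_of_map_eq (p : PMF α) (q : PMF β) (f : α → γ) (g : β → γ)
    (h : p.map f = q.map g) : ∃ μ : PMF (α × β), IsCoupling μ p q ∧
      ∀ z ∈ μ.support, f z.1 = g z.2 := by
  classical
  set ν := p.map f with hν
  have hq : ∀ c, ∑' b, (if c = g b then q b else 0) = ν c := fun c => by
    rw [h, PMF.map_apply]
  have hp : ∀ c, ∑' a, (if c = f a then p a else 0) = ν c := fun c => by
    rw [hν, PMF.map_apply]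
  have hle : ∀ a, p a ≤ ν (f a) := fun a => by
    rw [← hp]
    exact le_trans (by simp) (ENNReal.le_tsum a)
  have hleq : ∀ b, q b ≤ ν (g b) := fun b => by
    rw [← hq]
    exact le_trans (by simp) (ENNReal.le_tsum b)
  -- The two sides are made conditionally independent given the common value `f a = g b`, whose law
  -- is `ν`.
  let F : α × β → ℝ≥0∞ := fun z => if f z.1 = g z.2 then p z.1 * q z.2 / ν (f z.1) else 0
  have h1 : ∀ a, ∑' b, F (a, b) = p a := fun a => by
    have : ∀ b, F (a, b) = p a / ν (f a) * (if f a = g b then q b else 0) := fun b => by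
      simp only [F]; split_ifs <;> simp [div_eq_mul_inv, mul_right_comm]
    simp only [this]
    rw [ENNReal.tsum_mul_left, hq]
    by_cases h0 : ν (f a) = 0
    · have : p a = 0 := le_antisymm (h0 ▸ hle a) zero_le
      simp [this]
    · exact ENNReal.div_mul_cancel h0 (PMF.apply_ne_top _ _)
  have h2 : ∀ b, ∑' a, F (a, b) = q b := fun b => by
    have : ∀ a, F (a, b) = q b / ν (g b) * (if g b = f a then p a else 0) := fun a => by
      simp only [F, eq_comm (a := f a)]
      split_ifs with h
      · rw [← h]; simp [div_eq_mul_inv, mul_comm, mul_assoc]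
      · simp
    simp only [this]
    rw [ENNReal.tsum_mul_left, hp]
    by_cases h0 : ν (g b) = 0
    · have : q b = 0 := le_antisymm (h0 ▸ hleq b) zero_le
      simp [this]
    · exact ENNReal.div_mul_cancel h0 (PMF.apply_ne_top _ _)
  have hF : HasSum F 1 := by
    rw [ENNReal.summable.hasSum_iff, ENNReal.tsum_prod']
    simp [h1, PMF.tsum_coe]
  obtain ⟨μ, hμ⟩ : ∃ μ : PMF (α × β), ∀ z, μ z = F z := ⟨⟨F, hF⟩, fun _ => rfl⟩
  refine ⟨μ, ⟨?_, ?_⟩, ?_⟩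
  · ext a
    simp only [PMF.map_apply, hμ]
    rw [ENNReal.tsum_prod', tsum_eq_single a]
    · simp [h1]
    · intro a' ha'; simp [ha'.symm]
  · ext b
    simp only [PMF.map_apply, hμ]
    rw [ENNReal.tsum_prod', ENNReal.tsum_comm, tsum_eq_single b]
    · simp [h2]
    · intro b' hb'; simp [hb'.symm]
  · intro z hz
    by_contra hne
    rw [PMF.mem_support_iff, hμ] at hz
    exact hz (if_neg hne)

/-- Couple along a common image and charge only the bad outcomes of the first side. The outputs `F`
and `G` may depend on more than the common image; here the streaming side also carries the set of
stored pairs. -/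
theorem Coup.glue {α' β' : Type} (p : PMF α) (q : PMF β) (f : α → γ) (g : β → γ)
    (h : p.map f = q.map g) (F : α → α') (G : β → β') (bad : Set α) {R : α' → β' → Prop}
    (hR : ∀ a ∈ p.support, ∀ b ∈ q.support, a ∉ bad → f a = g b → R (F a) (G b)) :
    Coup (p.map F) (q.map G) R (p.toOuterMeasure bad) := by
  obtain ⟨μ, hc, hμ⟩ := exists_coupling_of_map_eq p q f g h
  refine Coup.of_map ⟨μ, hc, ?_⟩
  rw [← hc.1, PMF.toOuterMeasure_map_apply]
  refine PMF.toOuterMeasure_mono _ ?_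
  rintro z ⟨hz, hs⟩
  by_contra hb
  refine hz (hR _ ?_ _ ?_ hb (hμ z hs))
  · rw [← hc.1, PMF.support_map]; exact ⟨z, hs, rfl⟩
  · rw [← hc.2, PMF.support_map]; exact ⟨z, hs, rfl⟩

end Coup

/-! ### Random subsets -/

section RandomSubset

variable {ι α : Type} [Fintype ι] [DecidableEq α]

/-- By injectivity a subset of the image determines every coin, so a single term of the sum
survives. -/
theorem map_indep_coin_image_apply {f : ι → α} (hf : Function.Injective f) (p : ℝ)
    (A : Finset α) :
    ((indep fun _ : ι => coin p).map fun b => ({i | b i = true} : Finset ι).image f) A =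
      if A ⊆ univ.image f then ∏ a ∈ univ.image f, coin p (decide (a ∈ A)) else 0 := by
  classical
  rw [PMF.map_apply]
  split_ifs with h
  · have hA : A = ({i | decide (f i ∈ A) = true} : Finset ι).image f := by
      ext a
      simp only [mem_image, mem_filter, mem_univ, true_and, decide_eq_true_eq]
      constructor
      · intro ha
        obtain ⟨i, -, rfl⟩ := mem_image.1 (h ha)
        exact ⟨i, ha, rfl⟩
      · rintro ⟨i, hi, rfl⟩; exact hi
    rw [tsum_eq_single fun i => decide (f i ∈ A), if_pos hA, indep_apply,
      Finset.prod_image fun i _ j _ hij => hf hij]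
    intro b hb
    refine if_neg fun hAb => hb (funext fun i => ?_)
    have : f i ∈ A ↔ b i = true := by
      rw [hAb]; simp [hf.eq_iff]
    cases hbi : b i <;> simp [this, hbi]
  · refine ENNReal.tsum_eq_zero.2 fun b => if_neg fun hAb => h ?_
    rw [hAb]
    exact image_subset_image (filter_subset _ _)

theorem randomSubset_apply (s : Finset α) (p : ℝ) (A : Finset α) :
    randomSubset s p A = if A ⊆ s then ∏ a ∈ s, coin p (decide (a ∈ A)) else 0 := by
  have h := map_indep_coin_image_apply (Subtype.val_injective (p := (· ∈ s))) p A
  have hs : (univ : Finset s).image Subtype.val = s := by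
    rw [univ_eq_attach, attach_image_val]
  rw [hs] at h
  exact h

theorem randomSubset_image {f : ι → α} (hf : Function.Injective f) (p : ℝ) :
    (indep fun _ : ι => coin p).map (fun b => ({i | b i = true} : Finset ι).image f) =
      randomSubset (univ.image f) p := by
  ext A
  rw [map_indep_coin_image_apply hf, randomSubset_apply]

theorem randomSubset_univ [Fintype α] (p : ℝ) :
    randomSubset (univ : Finset α) p =
      (indep fun _ : α => coin p).map fun b => ({i | b i = true} : Finset α) := by
  have := randomSubset_image (f := (id : α → α)) Function.injective_id p
  simpa using this.symm

theorem randomSubset_empty (p : ℝ) : randomSubset (∅ : Finset α) p = PMF.pure ∅ := by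
  ext A
  rw [randomSubset_apply, PMF.pure_apply]
  simp [subset_empty]

/-- Each part of the union is recovered by intersecting with the corresponding block, so only one
pair of subsets contributes. This is what allows random sets to be grown along the stream. -/
theorem randomSubset_union {s s' : Finset α} (h : Disjoint s s') (p : ℝ) :
    ((randomSubset s p).bind fun A => (randomSubset s' p).map fun B => A ∪ B) =
      randomSubset (s ∪ s') p := by
  ext C
  rw [PMF.bind_apply, randomSubset_apply]
  have key : ∀ A B, A ⊆ s → B ⊆ s' → C = A ∪ B → A = C ∩ s ∧ B = C ∩ s' := by
    rintro A B hA hB rfl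
    constructor
    · rw [union_inter_distrib_right, inter_eq_left.2 hA,
        disjoint_iff_inter_eq_empty.1 (h.symm.mono_left hB), union_empty]
    · rw [union_inter_distrib_right, inter_eq_left.2 hB,
        disjoint_iff_inter_eq_empty.1 (h.mono_left hA), empty_union]
  split_ifs with hC
  · rw [tsum_eq_single (C ∩ s), PMF.map_apply, tsum_eq_single (C ∩ s')]
    · rw [if_pos (by rw [← inter_union_distrib_left, inter_eq_left.2 hC]), randomSubset_apply,
        randomSubset_apply, if_pos inter_subset_right, if_pos inter_subset_right,
        prod_union h]
      congr 1 <;> refine prod_congr rfl fun a ha => ?_ <;> simp [ha]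
    · intro B hB
      split_ifs with hCB
      · rw [randomSubset_apply, if_neg]
        intro hB'
        exact hB (key _ _ inter_subset_right hB' hCB).2
      · rfl
    · intro A hA
      rw [randomSubset_apply]
      split_ifs with hA'
      · rw [PMF.map_apply, ENNReal.tsum_eq_zero.2, mul_zero]
        intro B
        split_ifs with hCB
        · rw [randomSubset_apply, if_neg]
          intro hB'
          exact hA (key _ _ hA' hB' hCB).1
        · rfl
      · rw [zero_mul]
  · refine ENNReal.tsum_eq_zero.2 fun A => ?_
    rw [randomSubset_apply]
    split_ifs with hA
    · rw [PMF.map_apply, ENNReal.tsum_eq_zero.2, mul_zero]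
      intro B
      split_ifs with hCB
      · rw [randomSubset_apply, if_neg]
        intro hB
        exact hC (hCB ▸ union_subset_union hA hB)
      · rfl
    · rw [zero_mul]

/-- The set of pairs `(v, j)` with `v ∈ U` and `j ∈ K v`. -/
def glue {n : ℕ} (U : Finset (Fin n)) (K : Fin n → Finset ℕ) : Finset (Fin n × ℕ) :=
  U.biUnion fun v => (K v).image fun j => (v, j)

theorem mem_glue {n : ℕ} {U : Finset (Fin n)} {K : Fin n → Finset ℕ} {w : Fin n × ℕ} :
    w ∈ glue U K ↔ w.1 ∈ U ∧ w.2 ∈ K w.1 := by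
  obtain ⟨v, j⟩ := w
  simp only [glue, mem_biUnion, mem_image, Prod.mk.injEq]
  constructor
  · rintro ⟨a, ha, b, hb, rfl, rfl⟩; exact ⟨ha, hb⟩
  · rintro ⟨h1, h2⟩; exact ⟨v, h1, j, h2, rfl, rfl⟩

theorem mem_copies {n : ℕ} {U : Finset (Fin n)} {d : Fin n → ℕ} {w : Fin n × ℕ} :
    w ∈ copies U d ↔ w.1 ∈ U ∧ w.2 < d w.1 := by
  rw [← mem_range (m := w.2)]
  exact mem_glue (K := fun v => range (d v))

/-- Independent random subsets `K v` of `[d v]`, for the variables `v ∈ U`. -/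
def sliceLaw {n : ℕ} (U : Finset (Fin n)) (d : Fin n → ℕ) (p : ℝ) : PMF (Fin n → Finset ℕ) :=
  indep fun v => if v ∈ U then randomSubset (range (d v)) p else PMF.pure ∅

/-- Identifies the offline sampling of high-degree copies with independent sampling for each
variable, the form that can be compared with the streaming counts `J v`. -/
theorem sliceLaw_map_glue {n : ℕ} (U : Finset (Fin n)) (d : Fin n → ℕ) (p : ℝ) :
    (sliceLaw U d p).map (glue U) = randomSubset (copies U d) p := by
  classical
  ext A
  rw [PMF.map_apply, randomSubset_apply]
  split_ifs with h
  -- The fibres of `A` form the only family in the support of the law that glues to `A`.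
  · let K₀ : Fin n → Finset ℕ := fun v => if v ∈ U then {j ∈ range (d v) | (v, j) ∈ A} else ∅
    have hA : A = glue U K₀ := by
      ext ⟨v, j⟩
      rw [mem_glue]
      constructor
      · intro hv
        have := mem_copies.1 (h hv)
        refine ⟨this.1, ?_⟩
        simp only [K₀, if_pos this.1, mem_filter, mem_range]
        exact ⟨this.2, hv⟩
      · rintro ⟨h1, h2⟩
        simp only [K₀, if_pos h1, mem_filter] at h2
        exact h2.2
    rw [tsum_eq_single K₀, if_pos hA, sliceLaw, indep_apply, copies, prod_biUnion]
    · rw [← Finset.prod_subset (subset_univ U)]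
      · refine prod_congr rfl fun v hv => ?_
        rw [if_pos hv, randomSubset_apply, prod_image fun i _ j _ hij => congrArg Prod.snd hij]
        simp only [K₀, if_pos hv]
        rw [if_pos (filter_subset _ _)]
        refine prod_congr rfl fun j hj => ?_
        congr 1
        simp only [mem_filter, hj, true_and]
      · intro v _ hv
        simp [K₀, hv]
    · intro v _ v' _ hvv'
      rw [Function.onFun, disjoint_left]
      intro w hw hw'
      obtain ⟨_, _, rfl⟩ := mem_image.1 hw
      obtain ⟨_, _, h⟩ := mem_image.1 hw'
      exact hvv' (congrArg Prod.fst h).symm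
    · intro K hK
      split_ifs with hAK
      · obtain ⟨v, hv⟩ := Function.ne_iff.1 hK
        rw [sliceLaw, indep_apply]
        refine prod_eq_zero (mem_univ v) ?_
        by_cases hvU : v ∈ U
        · rw [if_pos hvU, randomSubset_apply, if_neg]
          intro hsub
          refine hv ?_
          simp only [K₀, if_pos hvU]
          ext j
          rw [mem_filter, hAK, mem_glue]
          exact ⟨fun hj => ⟨hsub hj, hvU, hj⟩, fun hj => hj.2.2⟩
        · rw [if_neg hvU, PMF.pure_apply, if_neg]
          simpa only [K₀, if_neg hvU] using hv
      · rfl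
  · refine ENNReal.tsum_eq_zero.2 fun K => ?_
    split_ifs with hAK
    · obtain ⟨w, hw, hw'⟩ := not_subset.1 h
      rw [hAK, mem_glue] at hw
      rw [sliceLaw, indep_apply]
      refine prod_eq_zero (mem_univ w.1) ?_
      rw [if_pos hw.1, randomSubset_apply, if_neg]
      intro hsub
      exact hw' (mem_copies.2 ⟨hw.1, mem_range.1 (hsub hw.2)⟩)
    · rfl

/-! ### Concentration of the size of a random subset -/

/-- The generating function of the size is a product of factors `1 + p(t - 1) ≤ exp(p(t - 1))`, one
for each relevant element. -/
theorem tsum_randomSubset_mul_pow_card_le (s : Finset α) (q : α → Prop) [DecidablePred q]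
    {p t : ℝ} (hp : 0 ≤ p) (hp1 : p ≤ 1) (ht : 0 ≤ t) :
    ∑' A, randomSubset s p A * ENNReal.ofReal (t ^ #{a ∈ A | q a}) ≤
      ENNReal.ofReal (Real.exp (p * #{a ∈ s | q a} * (t - 1))) := by
  classical
  rw [randomSubset, tsum_map_mul]
  have hfac : ∀ b : s → Bool, ENNReal.ofReal
      (t ^ #{a ∈ (s.attach.filter fun a => b a = true).image Subtype.val | q a}) =
      ∏ a : s, (if b a = true ∧ q a then ENNReal.ofReal t else 1) := by
    intro b
    rw [filter_image, card_image_of_injective _ Subtype.val_injective, filter_filter,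
      ENNReal.ofReal_pow ht, ← univ_eq_attach, ← prod_filter, prod_const]
  simp only [hfac]
  rw [tsum_indep_mul_prod (fun _ : s => coin p)
    (fun a b => if b = true ∧ q a then ENNReal.ofReal t else 1)]
  have h1 : ∀ a : s, ∑' b, coin p b * (if b = true ∧ q a then ENNReal.ofReal t else 1) ≤
      if q a then ENNReal.ofReal (Real.exp (p * (t - 1))) else 1 := by
    intro a
    rw [tsum_bool]
    by_cases hq : q a
    · simp only [Bool.false_eq_true, false_and, if_false, true_and, hq, if_true, mul_one]
      rw [coin_false, ← coin_true, coin_true_of_le_one hp1,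
        show (1 : ℝ≥0∞) = ENNReal.ofReal 1 by simp, ← ENNReal.ofReal_sub _ hp,
        ← ENNReal.ofReal_mul hp, ← ENNReal.ofReal_add (by linarith) (by positivity)]
      refine ENNReal.ofReal_le_ofReal ?_
      have := Real.add_one_le_exp (p * (t - 1))
      linarith
    · have := (coin p).tsum_coe
      rw [tsum_bool] at this
      simp [hq, this]
  refine (Finset.prod_le_prod' fun a _ => h1 a).trans (le_of_eq ?_)
  rw [← prod_filter, prod_const, ← ENNReal.ofReal_pow (Real.exp_nonneg _), ← Real.exp_nat_mul]
  have : #{a : s | q a} = #{a ∈ s | q a} := by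
    rw [← card_image_of_injective _ (Subtype.val_injective (p := (· ∈ s)))]
    congr 1
    ext a
    simp [and_comm]
  rw [this]
  congr 2
  ring

/-- The exponential Markov inequality. Phrasing the event through `log t` covers upper tails (`t >
1`) and lower tails (`t < 1`) at once. -/
theorem randomSubset_tail_le (s : Finset α) (q : α → Prop) [DecidablePred q]
    {p t c : ℝ} (hp : 0 ≤ p) (hp1 : p ≤ 1) (ht : 0 < t) (E : Set (Finset α))
    (hE : ∀ A ∈ E, c ≤ #{a ∈ A | q a} * Real.log t) :
    (randomSubset s p).toOuterMeasure E ≤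
      ENNReal.ofReal (Real.exp (p * #{a ∈ s | q a} * (t - 1) - c)) := by
  refine (toOuterMeasure_le_tsum _ E
    (fun A => ENNReal.ofReal (t ^ #{a ∈ A | q a}) * ENNReal.ofReal (Real.exp (-c)))
    fun A hA => ?_).trans ?_
  · rw [← ENNReal.ofReal_mul (by positivity), ← ENNReal.ofReal_one]
    refine ENNReal.ofReal_le_ofReal ?_
    rw [← Real.rpow_natCast, Real.rpow_def_of_pos ht, ← Real.exp_add, Real.one_le_exp_iff]
    have := hE A hA
    linarith
  · simp only [← mul_assoc]
    rw [ENNReal.tsum_mul_right, sub_eq_add_neg, Real.exp_add, ENNReal.ofReal_mul (by positivity)]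
    gcongr
    exact tsum_randomSubset_mul_pow_card_le s q hp hp1 ht.le

theorem randomSubset_upper_tail (s : Finset α) (q : α → Prop) [DecidablePred q]
    {p y a : ℝ} (hp : 0 ≤ p) (hp1 : p ≤ 1) (hy : 0 < y) (hy1 : y ≤ 1) (ha : 0 ≤ a)
    (hm : p * #{a ∈ s | q a} ≤ a) :
    (randomSubset s p).toOuterMeasure {A | (1 + y) * a < #{a ∈ A | q a}} ≤
      ENNReal.ofReal (Real.exp (-(y ^ 2 / 6 * a))) := by
  have hlog : y / 2 / (1 + y / 2) ≤ Real.log (1 + y / 2) := by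
    refine le_trans (le_of_eq ?_) (Real.one_sub_inv_le_log_of_pos (by positivity))
    field_simp; ring
  have hlog0 : 0 ≤ Real.log (1 + y / 2) := Real.log_nonneg (by linarith)
  -- With `t = 1 + y/2` the elementary bound `log t ≥ 1 - 1/t` already suffices: the exponent
  -- becomes `-a y² / (4 (1 + y/2))`, and `y ≤ 1` gives the constant `1/6`.
  refine (randomSubset_tail_le s q (t := 1 + y / 2)
    (c := (1 + y) * a * (y / 2 / (1 + y / 2))) hp hp1 (by positivity) _ fun A hA => ?_).trans ?_
  · have hA' : (1 + y) * a ≤ #{a ∈ A | q a} := le_of_lt hA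
    exact mul_le_mul hA' hlog (by positivity) (by positivity)
  · refine ENNReal.ofReal_le_ofReal (Real.exp_le_exp.2 ?_)
    have h1 : p * #{a ∈ s | q a} * (1 + y / 2 - 1) ≤ a * (y / 2) := by
      rw [add_sub_cancel_left]
      exact mul_le_mul_of_nonneg_right hm (by positivity)
    have h2 : y ^ 2 / 6 * a ≤ (1 + y) * a * (y / 2 / (1 + y / 2)) - a * (y / 2) := by
      rw [← sub_nonneg]
      have : (1 + y) * a * (y / 2 / (1 + y / 2)) - a * (y / 2) - y ^ 2 / 6 * a =
          a * y ^ 2 * (1 - y) / (12 * (1 + y / 2)) := by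
        field_simp; ring
      rw [this]
      have : 0 ≤ 1 - y := by linarith
      positivity
    linarith

theorem randomSubset_lower_tail (s : Finset α) (q : α → Prop) [DecidablePred q]
    {p y a : ℝ} (hp : 0 ≤ p) (hp1 : p ≤ 1) (hy : 0 < y) (hy1 : y ≤ 1)
    (hm : a ≤ p * #{a ∈ s | q a}) :
    (randomSubset s p).toOuterMeasure {A | #{a ∈ A | q a} < (1 - y) * (p * #{a ∈ s | q a})} ≤
      ENNReal.ofReal (Real.exp (-(y ^ 2 / 6 * a))) := by
  set μ := p * #{a ∈ s | q a} with hμ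
  have hμ0 : 0 ≤ μ := by positivity
  have hpos : 0 < 1 - y / 2 := by linarith
  have h2y : 2 - y ≠ 0 := by linarith
  have hlog : -(y / 2 / (1 - y / 2)) ≤ Real.log (1 - y / 2) := by
    refine le_trans (le_of_eq ?_) (Real.one_sub_inv_le_log_of_pos hpos)
    field_simp; ring
  have hlog0 : Real.log (1 - y / 2) ≤ 0 := Real.log_nonpos hpos.le (by linarith)
  have hy' : 0 ≤ 1 - y := by linarith
  refine (randomSubset_tail_le s q (t := 1 - y / 2)
    (c := (1 - y) * μ * -(y / 2 / (1 - y / 2))) hp hp1 hpos _ fun A hA => ?_).trans ?_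
  · have hA' : (#{a ∈ A | q a} : ℝ) ≤ (1 - y) * μ := le_of_lt hA
    calc (1 - y) * μ * -(y / 2 / (1 - y / 2)) ≤ (1 - y) * μ * Real.log (1 - y / 2) :=
          mul_le_mul_of_nonneg_left hlog (by positivity)
      _ ≤ _ := mul_le_mul_of_nonpos_right hA' hlog0
  · refine ENNReal.ofReal_le_ofReal (Real.exp_le_exp.2 ?_)
    rw [← hμ]
    have h1 : y ^ 2 / 6 * a ≤ y ^ 2 / 6 * μ := mul_le_mul_of_nonneg_left hm (by positivity)
    have h2 : y ^ 2 / 6 * μ ≤ μ * (y / 2) - (1 - y) * μ * (y / 2 / (1 - y / 2)) := by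
      rw [← sub_nonneg]
      have : μ * (y / 2) - (1 - y) * μ * (y / 2 / (1 - y / 2)) - y ^ 2 / 6 * μ =
          μ * y ^ 2 * (1 + y) / (12 * (1 - y / 2)) := by
        field_simp; ring
      rw [this]
      positivity
    linarith

end RandomSubset

/-! ### Reservoir sampling -/

theorem bind_congr_support {α β : Type} (p : PMF α) {f g : α → PMF β}
    (h : ∀ a ∈ p.support, f a = g a) : p.bind f = p.bind g := by
  ext b
  rw [PMF.bind_apply, PMF.bind_apply]
  refine tsum_congr fun a => ?_
  by_cases ha : p a = 0
  · simp [ha]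
  · rw [h a ha]

section Reservoir

variable {α : Type}

/-- The reservoir of capacity `size`, with its counter, after the items of the list `L`. -/
def reservoirLaw (size : ℕ) (L : List α) : PMF (List α × ℕ) :=
  L.foldlM (fun R e => updateReservoir size e R.1 R.2) ([], 1)

theorem reservoirLaw_nil (size : ℕ) : reservoirLaw size ([] : List α) = PMF.pure ([], 1) := rfl

theorem reservoirLaw_append (size : ℕ) (L : List α) (e : α) :
    reservoirLaw size (L ++ [e]) =
      (reservoirLaw size L).bind fun R => updateReservoir size e R.1 R.2 := by
  rw [reservoirLaw, List.foldlM_append]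
  simp only [List.foldlM_cons, List.foldlM_nil, bind_pure]
  rfl

theorem reservoirLaw_of_length_le (size : ℕ) (L : List α) (h : L.length ≤ size) :
    reservoirLaw size L = PMF.pure (L, L.length + 1) := by
  induction L using List.reverseRecOn with
  | nil => rfl
  | append_singleton L e ih =>
    rw [List.length_append, List.length_singleton] at h
    rw [reservoirLaw_append, ih (by omega), PMF.pure_bind, updateReservoir, if_pos h]
    simp [pmf_do_pure]

theorem updateReservoir_of_lt {size : ℕ} {e : α} {R : List α} {count : ℕ} (h : size < count) :
    updateReservoir size e R count = (coin ((size : ℝ) / count)).bind fun b =>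
      if b then (uniformBelow size).map fun i => (R.set i e, count + 1)
      else PMF.pure (R, count + 1) := by
  rw [updateReservoir, if_neg (by omega)]
  rfl

/-- The new item is distinct from all earlier ones, so overwriting one entry keeps the list free of
repetitions. This makes the content a set of known size. -/
theorem reservoirLaw_support (size : ℕ) (L : List α) (hL : L.Nodup) :
    ∀ R ∈ (reservoirLaw size L).support, R.1.Nodup ∧ R.1 ⊆ L ∧
      R.1.length = min size L.length ∧ R.2 = L.length + 1 := by
  induction L using List.reverseRecOn with
  | nil =>
    intro R hR
    rw [reservoirLaw_nil, PMF.mem_support_pure_iff] at hR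
    subst hR
    simp
  | append_singleton L e ih =>
    rcases Nat.lt_or_ge L.length size with hs | hs
    · intro R hR
      rw [reservoirLaw_of_length_le _ _ (by simpa using hs), PMF.mem_support_pure_iff] at hR
      subst hR
      refine ⟨hL, fun _ h => h, ?_, rfl⟩
      rw [min_eq_right]
      simpa using hs
    · intro R hR
      have hL' := List.nodup_append.1 hL
      rw [reservoirLaw_append, PMF.mem_support_bind_iff] at hR
      obtain ⟨R', hR', hR⟩ := hR
      obtain ⟨h1, h2, h3, h4⟩ := ih hL'.1 R' hR'
      have he : e ∉ R'.1 := fun he => hL'.2.2 e (h2 he) e (by simp) rfl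
      rw [updateReservoir_of_lt (by omega), PMF.mem_support_bind_iff] at hR
      obtain ⟨b, -, hR⟩ := hR
      have hlen : (L ++ [e]).length = L.length + 1 := by simp
      cases b
      · simp only [Bool.false_eq_true, if_false, PMF.mem_support_pure_iff] at hR
        subst hR
        refine ⟨h1, fun x hx => List.mem_append_left _ (h2 hx), ?_, by simp [h4]⟩
        rw [hlen]; simp only; omega
      · simp only [if_true, PMF.support_map] at hR
        obtain ⟨i, -, rfl⟩ := hR
        refine ⟨?_, ?_, ?_, by simp [h4]⟩
        · change (R'.1.set i e).Nodup
          rw [List.set_eq_take_append_cons_drop]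
          split_ifs with hi
          · refine List.nodup_middle.2 (List.nodup_cons.2 ⟨?_, ?_⟩)
            · rw [List.mem_append]
              rintro (h | h)
              · exact he (List.mem_of_mem_take h)
              · exact he (List.mem_of_mem_drop h)
            · rw [← List.eraseIdx_eq_take_drop_succ]
              exact h1.sublist (List.eraseIdx_sublist _ _)
          · exact h1
        · intro x hx
          rcases List.mem_or_eq_of_mem_set hx with h | h
          · exact List.mem_append_left _ (h2 h)
          · simp [h]
        · rw [hlen, List.length_set]; omega

variable [DecidableEq α]

theorem toFinset_set_of_nodup {R : List α} (hR : R.Nodup) {i : ℕ} (hi : i < R.length) (e : α) :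
    (R.set i e).toFinset = insert e (R.toFinset.erase R[i]) := by
  have h : (R.eraseIdx i).toFinset = R.toFinset.erase R[i] := by
    rw [← hR.erase_getElem i hi]
    ext x
    simp [hR.mem_erase_iff]
  rw [← h, List.set_eq_take_append_cons_drop, if_pos hi, List.eraseIdx_eq_take_drop_succ]
  ext x
  simp only [List.mem_toFinset, List.mem_append, List.mem_cons, mem_insert]
  tauto

theorem sum_range_length_getElem {M : Type} [AddCommMonoid M] {R : List α} (hR : R.Nodup)
    (f : α → M) (g : ℕ → M) (hg : ∀ (i : ℕ) (hi : i < R.length), g i = f R[i]) :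
    ∑ i ∈ range R.length, g i = ∑ x ∈ R.toFinset, f x := by
  rw [List.sum_toFinset f hR, ← Fin.sum_univ_fun_getElem, Finset.sum_range]
  exact Finset.sum_congr rfl fun i _ => hg i i.2

/-- The probability that one replacement step leads from the reservoir content `X` to `Y`. -/
def stepWeight (s j : ℕ) (e : α) (X Y : Finset α) : ℝ≥0∞ :=
  if e ∈ Y then (if Y.erase e ⊆ X then ENNReal.ofReal ((j + 1 : ℝ)⁻¹) else 0)
  else (if X = Y then ENNReal.ofReal (1 - s / (j + 1 : ℝ)) else 0)

/-- A target containing `e` arises from exactly one evicted item, the element of the reservoir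
missing from the target. -/
theorem uniformBelow_map_set_apply {s : ℕ} (hs : 0 < s) {e : α} {R : List α} (hR : R.Nodup)
    (hlen : R.length = s) (he : e ∉ R) {Y : Finset α} (hY : #Y = s) :
    ((uniformBelow s).map fun i => (R.set i e).toFinset) Y =
      if e ∈ Y ∧ Y.erase e ⊆ R.toFinset then (s : ℝ≥0∞)⁻¹ else 0 := by
  set X := R.toFinset with hX
  have heX : e ∉ X := by simpa [hX] using he
  have hXc : #X = s := by rw [hX, List.toFinset_card_of_nodup hR, hlen]
  have hsum : ((uniformBelow s).map fun i => (R.set i e).toFinset) Y =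
      ∑ x ∈ X, if Y = insert e (X.erase x) then (s : ℝ≥0∞)⁻¹ else 0 := by
    rw [PMF.map_apply, tsum_eq_sum (s := range s), ← hlen]
    · refine sum_range_length_getElem hR _ _ fun i hi => ?_
      rw [toFinset_set_of_nodup hR hi, uniformBelow_apply (by omega), if_pos hi, hX]
      split_ifs <;> rfl
    · intro i hi
      have hi' : ¬ i < s := by simpa using hi
      simp [uniformBelow_apply hs, hi']
  rw [hsum]
  split_ifs with h
  · obtain ⟨heY, hsub⟩ := h
    have hc : #(X \ Y.erase e) = 1 := by
      rw [card_sdiff_of_subset hsub, card_erase_of_mem heY]; omega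
    obtain ⟨x₀, hx₀⟩ := card_eq_one.1 hc
    have hx₀' : x₀ ∈ X \ Y.erase e := by rw [hx₀]; simp
    rw [mem_sdiff] at hx₀'
    rw [Finset.sum_eq_single x₀, if_pos]
    · rw [← sdiff_singleton_eq_erase, ← hx₀, Finset.sdiff_sdiff_eq_self hsub, insert_erase heY]
    · intro x hx hne
      refine if_neg fun hYx => ?_
      have hx' : x ∈ Y.erase e := by
        by_contra hx'
        have : x ∈ X \ Y.erase e := mem_sdiff.2 ⟨hx, hx'⟩
        rw [hx₀, mem_singleton] at this
        exact hne this
      rw [hYx, erase_insert (fun h => heX (mem_of_mem_erase h))] at hx'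
      simp at hx'
    · intro h; exact absurd hx₀'.1 h
  · refine Finset.sum_eq_zero fun x _ => if_neg fun hYx => h ?_
    rw [hYx, erase_insert (fun h => heX (mem_of_mem_erase h))]
    exact ⟨mem_insert_self _ _, erase_subset _ _⟩

theorem updateReservoir_map_apply {s j : ℕ} (hs : s ≤ j) {e : α} {R : List α} (hR : R.Nodup)
    (hlen : R.length = s) (he : e ∉ R) {Y : Finset α} (hY : #Y = s) :
    ((updateReservoir s e R (j + 1)).map fun R => R.1.toFinset) Y =
      stepWeight s j e R.toFinset Y := by
  have hle : (s : ℝ) / (j + 1 : ℕ) ≤ 1 := by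
    rw [div_le_one (by positivity)]; exact_mod_cast Nat.le_succ_of_le hs
  rw [updateReservoir_of_lt (by omega), PMF.map_bind, coin_bind_apply, coin_false,
    ← coin_true, coin_true_of_le_one hle]
  simp only [if_true, Bool.false_eq_true, if_false, PMF.map_comp, PMF.pure_map, PMF.pure_apply,
    Function.comp_def]
  have hkeep : 1 - ENNReal.ofReal ((s : ℝ) / (j + 1 : ℕ)) =
      ENNReal.ofReal (1 - s / (j + 1 : ℝ)) := by
    rw [ENNReal.ofReal_sub _ (by positivity), ENNReal.ofReal_one]; push_cast; rfl
  rw [hkeep]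
  -- Capacity zero is separate: the coin never shows `true`, and the index draw would only return
  -- its default value.
  rcases Nat.eq_zero_or_pos s with rfl | hs0
  · have hY0 : Y = ∅ := card_eq_zero.1 hY
    have hR0 : R = [] := List.length_eq_zero_iff.1 hlen
    simp [stepWeight, hY0, hR0]
  rw [uniformBelow_map_set_apply hs0 hR hlen he hY]
  unfold stepWeight
  by_cases heY : e ∈ Y
  · have hne : Y ≠ R.toFinset := by
      rintro rfl
      exact he (by simpa using heY)
    rw [if_neg hne, mul_zero, add_zero, if_pos heY]
    by_cases hsub : Y.erase e ⊆ R.toFinset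
    · rw [if_pos ⟨heY, hsub⟩, if_pos hsub, ← ENNReal.ofReal_natCast s,
        ← ENNReal.ofReal_inv_of_pos (by positivity), ← ENNReal.ofReal_mul (by positivity)]
      congr 1
      push_cast
      field_simp
    · rw [if_neg fun h => hsub h.2, if_neg hsub, mul_zero]
  · rw [if_neg fun h => heY h.1, mul_zero, zero_add, if_neg heY]
    simp only [eq_comm (a := Y), mul_ite, mul_one, mul_zero]

theorem choose_inv_step (s j : ℕ) (hs : s ≤ j) :
    ((j.choose s : ℝ)⁻¹) * (1 - s / (j + 1 : ℝ)) = (((j + 1).choose s : ℕ) : ℝ)⁻¹ := by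
  have h := Nat.choose_mul_succ_eq j s
  have h1 : ((j.choose s : ℕ) : ℝ) * (j + 1) = ((j + 1).choose s : ℕ) * (j + 1 - s) := by
    have : ((j + 1 - s : ℕ) : ℝ) = j + 1 - s := by
      rw [Nat.cast_sub (by omega)]; push_cast; ring
    rw [← this]
    exact_mod_cast h
  have h2 : (0 : ℝ) < j.choose s := by exact_mod_cast Nat.choose_pos hs
  have h3 : (0 : ℝ) < ((j + 1).choose s : ℕ) := by exact_mod_cast Nat.choose_pos (by omega)
  field_simp
  linarith

/-- Uniformity is preserved by one step. A set containing the new item has `j + 1 - s` predecessors,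
each of weight `1/(j+1)`; any other set has only itself, with weight `1 - s/(j+1)`. Both totals turn
`1 / C(j,s)` into `1 / C(j+1,s)`. -/
theorem sum_powersetCard_stepWeight {s j : ℕ} (hs : s ≤ j) {e : α} {U : Finset α} (hU : #U = j)
    {Y : Finset α} (hY : Y ∈ powersetCard s (insert e U)) :
    ∑ X ∈ powersetCard s U, ((j.choose s : ℕ) : ℝ≥0∞)⁻¹ * stepWeight s j e X Y =
      (((j + 1).choose s : ℕ) : ℝ≥0∞)⁻¹ := by
  obtain ⟨hYU, hYc⟩ := mem_powersetCard.1 hY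
  have hpos : 0 < j.choose s := Nat.choose_pos hs
  have hpos' : 0 < (j + 1).choose s := Nat.choose_pos (by omega)
  have hs' : (s : ℝ) ≤ j := by exact_mod_cast hs
  have hfrac : (s : ℝ) / (j + 1) ≤ 1 := by rw [div_le_one (by positivity)]; linarith
  rw [← ENNReal.ofReal_natCast, ← ENNReal.ofReal_natCast,
    ← ENNReal.ofReal_inv_of_pos (by exact_mod_cast hpos),
    ← ENNReal.ofReal_inv_of_pos (by exact_mod_cast hpos'), ← choose_inv_step s j hs,
    ENNReal.ofReal_mul (by positivity), ← Finset.mul_sum]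
  congr 1
  unfold stepWeight
  by_cases heY : e ∈ Y
  · simp only [if_pos heY]
    have hsub : Y.erase e ⊆ U := fun x hx => by
      have := hYU (mem_of_mem_erase hx)
      exact (mem_insert.1 this).resolve_left (ne_of_mem_erase hx)
    have hs0 : 0 < s := by rw [← hYc]; exact card_pos.2 ⟨e, heY⟩
    -- The predecessors are `Y.erase e` together with one further element of `U`; the `s - 1`
    -- elements of `Y.erase e` are excluded.
    have hcount : #{X ∈ powersetCard s U | Y.erase e ⊆ X} = j + 1 - s := by
      have : (powersetCard s U).filter (fun X => Y.erase e ⊆ X) =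
          (U \ Y.erase e).image fun x => insert x (Y.erase e) := by
        ext X
        simp only [mem_filter, mem_powersetCard, mem_image, mem_sdiff]
        constructor
        · rintro ⟨⟨hXU, hXc⟩, hYX⟩
          have hc : #(X \ Y.erase e) = 1 := by
            rw [card_sdiff_of_subset hYX, card_erase_of_mem heY]; omega
          obtain ⟨x, hx⟩ := card_eq_one.1 hc
          have hx' : x ∈ X \ Y.erase e := by rw [hx]; simp
          rw [mem_sdiff] at hx'
          refine ⟨x, ⟨hXU hx'.1, hx'.2⟩, ?_⟩
          rw [insert_eq, ← hx, sdiff_union_of_subset hYX]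
        · rintro ⟨x, ⟨hx, hx'⟩, rfl⟩
          refine ⟨⟨insert_subset hx hsub, ?_⟩, subset_insert _ _⟩
          rw [card_insert_of_notMem hx', card_erase_of_mem heY]; omega
      rw [this, card_image_of_injOn, card_sdiff_of_subset hsub, card_erase_of_mem heY]
      · omega
      · intro x hx y hy hxy
        have hx' := (mem_sdiff.1 (mem_coe.1 hx)).2
        have : x ∈ insert y (Y.erase e) := by
          have hxy' : insert x (Y.erase e) = insert y (Y.erase e) := hxy
          rw [← hxy']; exact mem_insert_self _ _
        exact (mem_insert.1 this).resolve_right hx'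
    rw [← Finset.sum_filter, Finset.sum_const, hcount, nsmul_eq_mul, ← ENNReal.ofReal_natCast,
      ← ENNReal.ofReal_mul (by positivity), Nat.cast_sub (by omega)]
    congr 1
    push_cast
    field_simp
  · simp only [if_neg heY]
    have hYU' : Y ⊆ U := fun x hx =>
      (mem_insert.1 (hYU hx)).resolve_left fun h => heY (h ▸ hx)
    rw [Finset.sum_ite_eq', if_pos (mem_powersetCard.2 ⟨hYU', hYc⟩)]

theorem reservoirLaw_map_toFinset (size : ℕ) (L : List α) (hL : L.Nodup) (Y : Finset α)
    (hY : Y ∈ powersetCard (min size L.length) L.toFinset) :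
    ((reservoirLaw size L).map fun R => R.1.toFinset) Y =
      ((L.length.choose (min size L.length) : ℕ) : ℝ≥0∞)⁻¹ := by
  rcases Nat.le_total L.length size with hs | hs
  · rw [min_eq_right hs] at hY ⊢
    rw [reservoirLaw_of_length_le _ _ hs, PMF.pure_map, PMF.pure_apply]
    rw [← List.toFinset_card_of_nodup hL, powersetCard_self, mem_singleton] at hY
    simp [hY]
  · induction L using List.reverseRecOn generalizing Y with
    | nil =>
      have : size = 0 := by simpa using hs
      subst this
      rw [List.length_nil, min_self, powersetCard_zero, mem_singleton] at hY
      subst hY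
      rw [reservoirLaw_nil, PMF.pure_map, PMF.pure_apply]
      simp
    | append_singleton L e ih =>
      have hlen : (L ++ [e]).length = L.length + 1 := by simp
      rcases Nat.lt_or_ge L.length size with hs' | hs'
      · have hs'' : size = L.length + 1 := by omega
        rw [hlen] at hY ⊢
        rw [hs'', min_self] at hY ⊢
        rw [reservoirLaw_of_length_le _ _ (by omega), PMF.pure_map, PMF.pure_apply]
        rw [← hlen, ← List.toFinset_card_of_nodup hL, powersetCard_self, mem_singleton] at hY
        simp [hY]
      · have hL' := List.nodup_append.1 hL
        have he : e ∉ L := fun he => hL'.2.2 e he e (by simp) rfl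
        rw [hlen, min_eq_left (by omega)] at hY ⊢
        have hins : (L ++ [e]).toFinset = insert e L.toFinset := by
          ext x; simp
        rw [hins] at hY
        have hcard : #L.toFinset = L.length := List.toFinset_card_of_nodup hL'.1
        have step : ((reservoirLaw size (L ++ [e])).map fun R => R.1.toFinset) Y =
            ∑' R, reservoirLaw size L R * stepWeight size L.length e R.1.toFinset Y := by
          rw [reservoirLaw_append, PMF.map_bind, PMF.bind_apply]
          refine tsum_congr fun R => ?_
          by_cases hR : reservoirLaw size L R = 0
          · simp [hR]
          · obtain ⟨h1, h2, h3, h4⟩ := reservoirLaw_support size L hL'.1 R hR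
            rw [h4, updateReservoir_map_apply hs' h1 (by omega) (fun h => he (h2 h))
              (mem_powersetCard.1 hY).2]
        rw [step, ← tsum_map_mul (reservoirLaw size L) (fun R => R.1.toFinset)
          (fun X => stepWeight size L.length e X Y), tsum_eq_sum
          (s := powersetCard size L.toFinset)]
        · rw [← sum_powersetCard_stepWeight hs' hcard hY]
          refine Finset.sum_congr rfl fun X hX => ?_
          have hmin : min size L.length = size := min_eq_left hs'
          rw [ih hL'.1 X (by rwa [hmin]) hs', hmin]
        · intro X hX
          have : ((reservoirLaw size L).map fun R => R.1.toFinset) X = 0 := by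
            rw [PMF.apply_eq_zero_iff, PMF.mem_support_map_iff]
            rintro ⟨R, hR, rfl⟩
            obtain ⟨h1, h2, h3, -⟩ := reservoirLaw_support size L hL'.1 R hR
            refine hX (mem_powersetCard.2 ⟨fun x hx => ?_, ?_⟩)
            · simpa using h2 (by simpa using hx)
            · rw [List.toFinset_card_of_nodup h1, h3, min_eq_left hs']
          rw [this, zero_mul]

/-- The continuation sees the reservoir only through its set and its length; the length, which
enters the space bound, equals the size of the set because the list has no repetitions. -/
theorem reservoirLaw_bind_eq [Fintype α] (size : ℕ) (L : List α) (hL : L.Nodup)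
    (hL' : L.toFinset = univ) {β : Type} (f : Finset α → ℕ → PMF β) :
    ((reservoirLaw size L).bind fun R => f R.1.toFinset R.1.length) =
      (uniformSample α size).bind fun C => f C #C := by
  have hcard : L.length = Fintype.card α := by
    rw [← List.toFinset_card_of_nodup hL, hL', card_univ]
  have hmap : (reservoirLaw size L).map (fun R => R.1.toFinset) = uniformSample α size := by
    ext Y
    by_cases hY : Y ∈ powersetCard (min size (Fintype.card α)) univ
    · rw [reservoirLaw_map_toFinset size L hL Y (by rwa [hcard, hL']), uniformSample,
        PMF.uniformOfFinset_apply_of_mem _ hY, card_powersetCard, hcard, card_univ]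
    · rw [uniformSample, PMF.uniformOfFinset_apply_of_notMem _ hY, PMF.apply_eq_zero_iff,
        PMF.mem_support_map_iff]
      rintro ⟨R, hR, rfl⟩
      obtain ⟨h1, -, h3, -⟩ := reservoirLaw_support size L hL R hR
      refine hY (mem_powersetCard.2 ⟨subset_univ _, ?_⟩)
      rw [List.toFinset_card_of_nodup h1, h3, hcard]
  rw [← hmap, PMF.bind_map]
  refine bind_congr_support _ fun R hR => ?_
  rw [Function.comp_apply, List.toFinset_card_of_nodup (reservoirLaw_support size L hL R hR).1]

end Reservoir

/-! ### The law of the sketch -/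

section Sketch

variable {k : ℕ} {A : Type*} {𝓕 : Set ((Fin k → A) → Bool)} {n m : ℕ} {P : Params}

/-- The sketch with given counters and given sets `G`, `G̃` after the copies in `L`. -/
def sketchOf (I : CSPInstance 𝓕 n m) (H : Fin n → Fin P.N) (S : Finset (Fin n))
    (degs : Fin n → ℕ) (L : List (Copy m P)) (Gt G : Finset (Copy m P × Fin k))
    (R : List (Copy m P) × ℕ) : Sketch k n m P where
  S := S
  degs := degs
  F := {e ∈ L.toFinset | ∃ t, (H (I.scope e.1 t) : ℕ) = 0 ∨ (e, t) ∈ G}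
  G := G
  Gt := Gt
  res := R.1
  count := R.2

/-- The law of the sketch after the copies in `L`. -/
def sketchLaw (I : CSPInstance 𝓕 n m) (H : Fin n → Fin P.N) (S : Finset (Fin n))
    (degs : Fin n → ℕ) (L : List (Copy m P)) : PMF (Sketch k n m P) :=
  (randomSubset (L.toFinset ×ˢ univ) (1 / P.N)).bind fun Gt =>
    (randomSubset (L.toFinset ×ˢ univ) (2 / P.N)).bind fun G =>
      (reservoirLaw P.size L).bind fun R => PMF.pure (sketchOf I H S degs L Gt G R)

theorem randomSubset_append_product (L : List (Copy m P)) {e : Copy m P} (he : e ∉ L) (p : ℝ) :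
    randomSubset ((L ++ [e]).toFinset ×ˢ (univ : Finset (Fin k))) p =
      (randomSubset (L.toFinset ×ˢ univ) p).bind fun A =>
        (indep fun _ : Fin k => coin p).bind fun b =>
          PMF.pure (A ∪ ({t | b t = true} : Finset (Fin k)).image fun t => (e, t)) := by
  have hset : (L ++ [e]).toFinset ×ˢ (univ : Finset (Fin k)) =
      (L.toFinset ×ˢ univ) ∪ univ.image fun t => (e, t) := by
    ext ⟨a, t⟩
    simp only [mem_product, List.mem_toFinset, List.mem_append, List.mem_singleton, mem_univ,
      and_true, mem_union, mem_image, Prod.mk.injEq, true_and, exists_and_left, exists_eq]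
    rw [eq_comm (a := e)]
  have hdisj : Disjoint (L.toFinset ×ˢ (univ : Finset (Fin k))) (univ.image fun t => (e, t)) := by
    rw [disjoint_right]
    intro x hx
    obtain ⟨t, -, rfl⟩ := mem_image.1 hx
    simpa using he
  rw [hset, ← randomSubset_union hdisj, ← randomSubset_image (Prod.mk_right_injective e)]
  refine congrArg _ (funext fun A => ?_)
  rw [PMF.map_comp]
  rfl

theorem bind_reorder {α β γ γ' α' β' δ : Type} (pT : PMF α) (pG : PMF β) (pR : PMF γ)
    (κ : γ → PMF γ') (g : PMF β') (gt : PMF α') (f : α → α' → β → β' → γ' → PMF δ) :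
    (pT.bind fun T => pG.bind fun G => pR.bind fun R => (κ R).bind fun R' => g.bind fun x =>
      gt.bind fun y => f T y G x R') =
    pT.bind fun T => gt.bind fun y => pG.bind fun G => g.bind fun x =>
      (pR.bind κ).bind fun R' => f T y G x R' := by
  refine congrArg _ (funext fun T => ?_)
  rw [PMF.bind_comm gt pG]
  refine congrArg _ (funext fun G => ?_)
  rw [← PMF.bind_bind]
  rw [PMF.bind_comm gt g, PMF.bind_comm (pR.bind κ) g]
  refine congrArg _ (funext fun x => ?_)
  rw [PMF.bind_comm]

/-- The fresh coins for `(i, l)` extend both random sets independently of the past. The test against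
`S` is a test of the hash value by `hS`, so membership in `F` depends only on `H` and `G`. -/
theorem sketchLaw_bind_copyStep (I : CSPInstance 𝓕 n m) (H : Fin n → Fin P.N)
    (S : Finset (Fin n)) (degs : Fin n → ℕ) (L : List (Copy m P)) (i : Fin m) (l : Fin P.B)
    (hl : (i, l) ∉ L) (hS : ∀ t, I.scope i t ∈ S ↔ (H (I.scope i t) : ℕ) = 0) :
    ((sketchLaw I H S degs L).bind fun s => copyStep I i s l) =
      sketchLaw I H S degs (L ++ [(i, l)]) := by
  unfold sketchLaw
  rw [randomSubset_append_product L hl, randomSubset_append_product L hl, reservoirLaw_append]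
  simp only [PMF.bind_bind, PMF.pure_bind]
  simp only [copyStep, pmf_do_bind, pmf_do_pure, sketchOf]
  have h := bind_reorder (randomSubset (L.toFinset ×ˢ (univ : Finset (Fin k))) (1 / (P.N : ℝ)))
    (randomSubset (L.toFinset ×ˢ (univ : Finset (Fin k))) (2 / (P.N : ℝ))) (reservoirLaw P.size L)
    (fun R => updateReservoir P.size (i, l) R.1 R.2) (indep fun _ : Fin k => coin (2 / P.N))
    (indep fun _ : Fin k => coin (1 / P.N)) (fun Gt gt G g R => PMF.pure (sketchOf I H S degs
      (L ++ [(i, l)]) (Gt ∪ ({t | gt t = true} : Finset (Fin k)).image fun t => ((i, l), t))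
      (G ∪ ({t | g t = true} : Finset (Fin k)).image fun t => ((i, l), t)) R))
  simp only [PMF.bind_bind] at h
  refine Eq.trans ?_ h
  refine congrArg _ (funext fun Gt => congrArg _ (funext fun G => congrArg _ (funext fun R =>
    congrArg _ (funext fun R' => congrArg _ (funext fun g => congrArg _ (funext fun gt => ?_))))))
  congr 1
  simp only [sketchOf]
  congr 1
  ext e
  simp only [hS]
  by_cases he : e = (i, l)
  · subst he
    split_ifs with h1 <;> simp_all
  · have h2 : ∀ t, (e, t) ∉ ({t | g t = true} : Finset (Fin k)).image fun t => ((i, l), t) := by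
      intro t ht
      obtain ⟨t', -, h⟩ := mem_image.1 ht
      exact he (congrArg Prod.fst h).symm
    split_ifs with h1 <;>
      simp only [mem_insert, mem_filter, List.mem_toFinset, List.mem_append, List.mem_singleton,
        he, false_or, or_false, mem_union, h2]

theorem sketchLaw_bind_foldlM_copyStep (I : CSPInstance 𝓕 n m) (H : Fin n → Fin P.N)
    (S : Finset (Fin n)) (degs : Fin n → ℕ) (i : Fin m)
    (hS : ∀ t, I.scope i t ∈ S ↔ (H (I.scope i t) : ℕ) = 0) (ls : List (Fin P.B))
    (L : List (Copy m P)) (hL : (L ++ ls.map fun l => (i, l)).Nodup) :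
    ((sketchLaw I H S degs L).bind fun s => ls.foldlM (copyStep I i) s) =
      sketchLaw I H S degs (L ++ ls.map fun l => (i, l)) := by
  induction ls generalizing L with
  | nil =>
    simp only [List.foldlM_nil, List.map_nil, List.append_nil]
    exact PMF.bind_pure _
  | cons l ls ih =>
    have hsplit : L ++ (l :: ls).map (fun l => (i, l)) =
        (L ++ [(i, l)]) ++ ls.map fun l => (i, l) := by simp
    rw [hsplit] at hL ⊢
    have hl : (i, l) ∉ L := by
      have h1 := (List.nodup_append.1 hL).1
      intro h
      exact (List.nodup_append.1 h1).2.2 _ h (i, l) (by simp) rfl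
    rw [← ih _ hL, ← sketchLaw_bind_copyStep I H S degs L i l hl hS, PMF.bind_bind]
    rfl

/-- The variables that the stream `L` puts into `S`. -/
def storedVars (I : CSPInstance 𝓕 n m) (H : Fin n → Fin P.N) (L : List (Fin m)) :
    Finset (Fin n) :=
  {v | (H v : ℕ) = 0 ∧ ∃ i, i ∈ L ∧ ∃ t, I.scope i t = v}

/-- The degree counters after the stream `L`. -/
def storedDegs (I : CSPInstance 𝓕 n m) (H : Fin n → Fin P.N) (L : List (Fin m)) (v : Fin n) :
    ℕ :=
  if (H v : ℕ) = 0 then #{p : Fin m × Fin k | p.1 ∈ L ∧ I.scope p.1 p.2 = v} else 0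

/-- The labels of the copies of the constraints in `L`, in the order of the stream. -/
def copyList (P : Params) (L : List (Fin m)) : List (Copy m P) :=
  L.flatMap fun i => (List.finRange P.B).map fun l => (i, l)

theorem mem_copyList {L : List (Fin m)} {e : Copy m P} : e ∈ copyList P L ↔ e.1 ∈ L := by
  obtain ⟨i, l⟩ := e
  simp [copyList]

theorem nodup_copyList {L : List (Fin m)} (hL : L.Nodup) : (copyList P L).Nodup := by
  rw [copyList, List.nodup_flatMap]
  refine ⟨fun i _ => (List.nodup_finRange _).map (Prod.mk_right_injective i), ?_⟩
  refine hL.imp_of_mem fun {i j} _ _ hij => ?_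
  rw [Function.onFun, List.disjoint_left]
  intro e he he'
  obtain ⟨_, _, rfl⟩ := List.mem_map.1 he
  obtain ⟨_, _, h⟩ := List.mem_map.1 he'
  exact hij (congrArg Prod.fst h).symm

theorem sketchLaw_bind_constraintStep (I : CSPInstance 𝓕 n m) (H : Fin n → Fin P.N)
    (L : List (Fin m)) (i : Fin m) (hL : (L ++ [i]).Nodup) :
    ((sketchLaw I H (storedVars I H L) (storedDegs I H L) (copyList P L)).bind fun s =>
        constraintStep I H s i) =
      sketchLaw I H (storedVars I H (L ++ [i])) (storedDegs I H (L ++ [i]))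
        (copyList P (L ++ [i])) := by
  classical
  have hi : i ∉ L := fun h => (List.nodup_append.1 hL).2.2 _ h i (by simp) rfl
  have hS : storedVars I H L ∪ ({t | (H (I.scope i t) : ℕ) = 0} : Finset (Fin k)).image
      (I.scope i) = storedVars I H (L ++ [i]) := by
    ext v
    simp only [storedVars, mem_union, mem_filter, mem_univ, true_and, mem_image, List.mem_append,
      List.mem_singleton]
    constructor
    · rintro (⟨h1, j, hj, t, ht⟩ | ⟨t, ht, rfl⟩)
      · exact ⟨h1, j, Or.inl hj, t, ht⟩
      · exact ⟨ht, i, Or.inr rfl, t, rfl⟩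
    · rintro ⟨h1, j, hj | rfl, t, rfl⟩
      · exact Or.inl ⟨h1, j, hj, t, rfl⟩
      · exact Or.inr ⟨t, h1, rfl⟩
  have hd : (fun v => if v ∈ storedVars I H (L ++ [i]) then storedDegs I H L v +
      #{t | I.scope i t = v} else storedDegs I H L v) = storedDegs I H (L ++ [i]) := by
    funext v
    have hsplit : #{p : Fin m × Fin k | p.1 ∈ L ++ [i] ∧ I.scope p.1 p.2 = v} =
        #{p : Fin m × Fin k | p.1 ∈ L ∧ I.scope p.1 p.2 = v} + #{t | I.scope i t = v} := by
      rw [← card_map (Function.Embedding.sectR i (Fin k)) (s := {t | I.scope i t = v}),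
        ← card_union_of_disjoint]
      · congr 1
        ext ⟨j, t⟩
        simp only [mem_filter, mem_univ, true_and, List.mem_append, List.mem_singleton, mem_union,
          mem_map, Function.Embedding.sectR_apply, Prod.mk.injEq]
        constructor
        · rintro ⟨h | rfl, h'⟩
          · exact Or.inl ⟨h, h'⟩
          · exact Or.inr ⟨t, h', rfl, rfl⟩
        · rintro (⟨h, h'⟩ | ⟨t', h', rfl, rfl⟩)
          · exact ⟨Or.inl h, h'⟩
          · exact ⟨Or.inr rfl, h'⟩
      · rw [disjoint_right]
        intro p hp hp'
        obtain ⟨t, -, rfl⟩ := mem_map.1 hp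
        exact hi (mem_filter.1 hp').2.1
    simp only [storedDegs]
    split_ifs with h1 h2 h2
    · rw [hsplit]
    · exact absurd (mem_filter.1 h1).2.1 h2
    -- A variable of hash value zero outside `S` does not occur in the current constraint, so
    -- leaving its counter unchanged is correct.
    · rw [hsplit, left_eq_add, card_eq_zero, filter_eq_empty_iff]
      intro t _ ht
      exact h1 (mem_filter.2 ⟨mem_univ _, h2, i, by simp, t, ht⟩)
    · rfl
  have happ : copyList P (L ++ [i]) =
      copyList P L ++ (List.finRange P.B).map fun l => (i, l) := by
    simp [copyList]
  rw [happ, ← sketchLaw_bind_foldlM_copyStep I H _ _ i]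
  · unfold sketchLaw
    simp only [PMF.bind_bind, PMF.pure_bind]
    refine congrArg _ (funext fun Gt => congrArg _ (funext fun G => congrArg _ (funext fun R =>
      ?_)))
    unfold constraintStep
    simp only [sketchOf, hS, hd]
  · intro t
    simp only [storedVars, mem_filter, mem_univ, true_and, and_iff_left_iff_imp]
    exact fun _ => ⟨i, by simp, t, rfl⟩
  · rw [← happ]
    exact nodup_copyList hL

theorem foldlM_constraintStep (I : CSPInstance 𝓕 n m) (H : Fin n → Fin P.N)
    (L : List (Fin m)) (hL : L.Nodup) :
    (L.foldlM (constraintStep I H)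
      { S := ∅, degs := fun _ => 0, F := ∅, G := ∅, Gt := ∅, res := [], count := 1 } :
        PMF (Sketch k n m P)) =
      sketchLaw I H (storedVars I H L) (storedDegs I H L) (copyList P L) := by
  induction L using List.reverseRecOn with
  | nil =>
    have h1 : storedVars I H [] = ∅ := by simp [storedVars]
    have h2 : storedDegs I H [] = fun _ => 0 := by funext v; simp [storedDegs]
    rw [h1, h2]
    simp [sketchLaw, copyList, randomSubset_empty, reservoirLaw_nil, PMF.pure_bind, sketchOf,
      pmf_do_pure]
  | append_singleton L i ih =>
    rw [List.foldlM_append, ih (List.nodup_append.1 hL).1, ← sketchLaw_bind_constraintStep I H L i hL]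
    simp only [List.foldlM_cons, List.foldlM_nil, bind_pure]
    rfl

/-- The sketch after the whole stream, in terms of the random choices of the algorithm. -/
def finalSketch (I : CSPInstance 𝓕 n m) (H : Fin n → Fin P.N) (Gt G : Finset (Copy m P × Fin k))
    (R : List (Copy m P) × ℕ) : Sketch k n m P where
  S := {v | (H v : ℕ) = 0 ∧ ∃ i t, I.scope i t = v}
  degs v := if (H v : ℕ) = 0 then I.deg v else 0
  F := {e | ∃ t, (H (I.scope e.1 t) : ℕ) = 0 ∨ (e, t) ∈ G}
  G := G
  Gt := Gt
  res := R.1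
  count := R.2

/-- A variable of hash value zero enters `S` at its first occurrence, before its counter is updated,
so no incidence is lost and the counter ends at the true degree. -/
theorem sketch_eq (I : CSPInstance 𝓕 n m) (H : Fin n → Fin P.N) :
    sketch I H = (randomSubset (univ : Finset (Copy m P × Fin k)) (1 / P.N)).bind fun Gt =>
      (randomSubset (univ : Finset (Copy m P × Fin k)) (2 / P.N)).bind fun G =>
        (reservoirLaw P.size (copyList P (List.finRange m))).bind fun R =>
          PMF.pure (finalSketch I H Gt G R) := by
  have huniv : (copyList P (List.finRange m)).toFinset = univ := by
    ext e; simp [mem_copyList]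
  have hsk : ∀ Gt G R, sketchOf I H (storedVars I H (List.finRange m))
      (storedDegs I H (List.finRange m)) (copyList P (List.finRange m)) Gt G R =
      finalSketch I H Gt G R := by
    intro Gt G R
    simp only [sketchOf, finalSketch, huniv]
    congr 1
    · ext v; simp [storedVars]
    · funext v; simp [storedDegs, CSPInstance.deg]
  rw [sketch, foldlM_constraintStep I H _ (List.nodup_finRange m), sketchLaw, huniv,
    univ_product_univ]
  simp only [hsk]

end Sketch

/-! ### The aggregation step is invariant under isomorphism -/

section Invariance

variable {k : ℕ} {A : Type*} {𝓕 : Set ((Fin k → A) → Bool)} {n m : ℕ} {P : Params}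

section Map

variable {X Y : Type} {σ σ' : Y → Option (Fin k → X)} {f : X → X} {D : Set X}

theorem ball_subset (hD : ∀ e x, σ e = some x → ∀ t, x t ∈ D) (e : Y) (r : ℕ) :
    ball σ e r ⊆ D := by
  induction r with
  | zero => rintro _ ⟨s, t, hs, rfl⟩; exact hD e s hs t
  | succ r ih =>
    rintro x (hx | ⟨e', s, t, t', hs, -, rfl⟩)
    · exact ih hx
    · exact hD e' s hs t'

theorem eq_some_map_iff (h : ∀ e, σ' e = (σ e).map fun x t => f (x t)) {e : Y}
    {y : Fin k → X} : σ' e = some y ↔ ∃ x, σ e = some x ∧ (fun t => f (x t)) = y := by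
  rw [h, Option.map_eq_some_iff]

/-- Injectivity is required only on a set `D` containing all scopes, because the renaming comes from
a bijection of the sampled variables and is arbitrary elsewhere. -/
theorem ball_map (hD : ∀ e x, σ e = some x → ∀ t, x t ∈ D) (hf : Set.InjOn f D)
    (h : ∀ e, σ' e = (σ e).map fun x t => f (x t)) (e : Y) (r : ℕ) :
    ball σ' e r = f '' ball σ e r := by
  induction r with
  | zero =>
    ext y
    simp only [ball, Set.mem_ofPred_eq, Set.mem_image, eq_some_map_iff h]
    constructor
    · rintro ⟨_, t, ⟨x, hx, rfl⟩, rfl⟩; exact ⟨x t, ⟨x, t, hx, rfl⟩, rfl⟩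
    · rintro ⟨_, ⟨x, t, hx, rfl⟩, rfl⟩; exact ⟨_, t, ⟨x, hx, rfl⟩, rfl⟩
  | succ r ih =>
    simp only [ball, Set.image_union, ih]
    congr 1
    ext y
    simp only [Set.mem_ofPred_eq, Set.mem_image, eq_some_map_iff h]
    constructor
    · rintro ⟨e', _, t, t', ⟨x, hx, rfl⟩, ⟨w, hw, hwx⟩, rfl⟩
      have : w = x t := hf (ball_subset hD e r hw) (hD e' x hx t) hwx
      subst this
      exact ⟨x t', ⟨e', x, t, t', hx, hw, rfl⟩, rfl⟩
    · rintro ⟨_, ⟨e', x, t, t', hx, hw, rfl⟩, rfl⟩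
      exact ⟨e', _, t, t', ⟨x, hx, rfl⟩, ⟨_, hw, rfl⟩, rfl⟩

theorem degIn_map (hD : ∀ e x, σ e = some x → ∀ t, x t ∈ D) (hf : Set.InjOn f D)
    (h : ∀ e, σ' e = (σ e).map fun x t => f (x t)) {w : X} (hw : w ∈ D) :
    degIn σ' (f w) = degIn σ w := by
  unfold degIn
  congr 1
  ext p
  simp only [Set.mem_ofPred_eq, eq_some_map_iff h]
  constructor
  · rintro ⟨_, ⟨x, hx, rfl⟩, hxw⟩
    exact ⟨x, hx, hf (hD _ _ hx _) hw hxw⟩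
  · rintro ⟨x, hx, rfl⟩
    exact ⟨_, ⟨x, hx, rfl⟩, rfl⟩

theorem nbhd_iso (hD : ∀ e x, σ e = some x → ∀ t, x t ∈ D) (hf : Set.InjOn f D)
    (h : ∀ e, σ' e = (σ e).map fun x t => f (x t)) (pred : Y → 𝓕) (r : ℕ) (e : Y)
    (he : ∃ s, σ e = some s) (he' : ∃ s, σ' e = some s) :
    (nbhd σ pred r e he).Iso (nbhd σ' pred r e he') := by
  have hball := ball_map hD hf h e r
  have hinj : Set.InjOn f (ball σ e r) := hf.mono (ball_subset hD e r)
  have hbij : Set.BijOn f (ball σ e r) (ball σ' e r) := by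
    rw [hball]; exact hinj.bijOn_image
  have hcon : ∀ e', (∃ s, σ e' = some s ∧ ∀ t, s t ∈ ball σ e r) ↔
      ∃ s, σ' e' = some s ∧ ∀ t, s t ∈ ball σ' e r := by
    intro e'
    simp only [eq_some_map_iff h]
    constructor
    · rintro ⟨x, hx, hxt⟩
      exact ⟨_, ⟨x, hx, rfl⟩, fun t => hbij.mapsTo (hxt t)⟩
    · rintro ⟨_, ⟨x, hx, rfl⟩, hxt⟩
      refine ⟨x, hx, fun t => ?_⟩
      have := hxt t
      rw [hball] at this
      obtain ⟨w, hw, hwx⟩ := this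
      rwa [← hf (ball_subset hD e r hw) (hD _ _ hx t) hwx]
  refine ⟨hbij.equiv f, Equiv.subtypeEquivRight hcon, ?_, fun _ => rfl, rfl⟩
  intro e' t
  apply Subtype.ext
  -- Both scopes are chosen from existence statements, but an optional value has at most one
  -- content, so the choices correspond.
  change ((hcon e'.1).1 e'.2).choose t = f (e'.2.choose t)
  have h1 := e'.2.choose_spec.1
  have h2 := ((hcon e'.1).1 e'.2).choose_spec.1
  have h3 := (h e'.1).symm.trans h2
  have h4 := (congrArg (Option.map fun x t => f (x t)) h1).symm.trans h3
  exact (congrFun (Option.some.inj h4) t).symm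

end Map

/-- Every ingredient of a contribution is transported by the renaming: the degree cut, the balls,
the degree tests, the isomorphism class of the neighbourhood, and the dependency count. The count
also uses that parents are preserved. -/
theorem aggregate_eq_of_map (I : CSPInstance 𝓕 n m) (loc : NbhdClass 𝓕 → Set.Icc (0 : ℝ) 1)
    {s s' : Sample k n m P} (hs : s.sampled = s'.sampled) (hh : s.high = s'.high)
    {f : Fin n × ℕ → Fin n × ℕ} (hf : Set.InjOn f s.vars)
    (hD : ∀ e x, s.scope e = some x → ∀ t, x t ∈ s.vars)
    (h : ∀ e, s'.scope e = (s.scope e).map fun x t => f (x t))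
    (hf1 : ∀ w ∈ s.vars, (f w).1 = w.1) (hdeg : ∀ w ∈ s.vars, s'.degs (f w) = s.degs w) :
    aggregate I loc s = aggregate I loc s' := by
  classical
  have hb : ∀ e, s'.bddScope e = (s.bddScope e).map fun x t => f (x t) := by
    intro e
    unfold Sample.bddScope
    rw [h]
    rcases hx : s.scope e with _ | x
    · rfl
    · simp only [Option.map_some, Option.filter_some]
      have : (∀ t, (s'.degs (f (x t)) : ℝ) ≤ P.degBound) ↔
          ∀ t, (s.degs (x t) : ℝ) ≤ P.degBound :=
        forall_congr' fun t => by rw [hdeg _ (hD e x hx t)]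
      simp only [this]
      split_ifs <;> rfl
  have hsub : ∀ e x, s.bddScope e = some x → s.scope e = some x := by
    intro e x hx
    unfold Sample.bddScope at hx
    exact (Option.filter_eq_some_iff.1 hx).1
  have hbD : ∀ e x, s.bddScope e = some x → ∀ t, x t ∈ (s.vars : Set (Fin n × ℕ)) :=
    fun e x hx => hD e x (hsub e x hx)
  have hbd : ∀ w ∈ s.vars, s'.bddDegs (f w) = s.bddDegs w := by
    intro w hw
    unfold Sample.bddDegs
    rw [hdeg w hw]
    congr 2
    ext p
    simp only [Set.mem_ofPred_eq, eq_some_map_iff h, hb, Option.map_eq_none_iff]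
    constructor
    · rintro ⟨_, ⟨x, hx, rfl⟩, h1, h2⟩
      exact ⟨x, hx, h1, hf (hD _ _ hx _) hw h2⟩
    · rintro ⟨x, hx, h1, rfl⟩
      exact ⟨_, ⟨x, hx, rfl⟩, h1, rfl⟩
  have hdeps : ∀ e, s'.deps e = s.deps e := by
    intro e
    unfold Sample.deps
    rw [ball_map hbD hf hb, ← hh]
    have hsubD := ball_subset hbD e P.radius
    congr 1
    · rw [← Set.InjOn.ncard_image (hf.mono fun w (hw : w ∈ {w | w ∈ ball s.bddScope e P.radius ∧
        w.1 ∈ s.high}) => hsubD hw.1)]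
      congr 1
      ext w
      constructor
      · rintro ⟨⟨u, hu, rfl⟩, hw⟩
        rw [hf1 u (hsubD hu)] at hw
        exact ⟨u, ⟨hu, hw⟩, rfl⟩
      · rintro ⟨u, ⟨hu, hw⟩, rfl⟩
        exact ⟨⟨u, hu, rfl⟩, by rwa [hf1 u (hsubD hu)]⟩
    · congr 1
      ext v
      refine and_congr_right fun _ => ?_
      constructor
      · rintro ⟨j, u, hu, huv⟩
        have := hf1 u (hsubD hu)
        rw [huv] at this
        exact ⟨u.2, by rwa [show v = u.1 from this]⟩
      · rintro ⟨j, hj⟩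
        exact ⟨(f (v, j)).2, (v, j), hj, Prod.ext (hf1 _ (hsubD hj)) rfl⟩
  have hcontr : ∀ e, contribution I loc s e = contribution I loc s' e := by
    intro e
    have hex : (∃ x, s.bddScope e = some x) ↔ ∃ x, s'.bddScope e = some x := by
      simp only [eq_some_map_iff hb]
      exact ⟨fun ⟨x, hx⟩ => ⟨_, x, hx, rfl⟩, fun ⟨_, x, hx, _⟩ => ⟨x, hx⟩⟩
    have hall : (∀ w ∈ ball s.bddScope e (P.radius - 1), degIn s.bddScope w = s.bddDegs w) ↔
        ∀ w ∈ ball s'.bddScope e (P.radius - 1), degIn s'.bddScope w = s'.bddDegs w := by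
      rw [ball_map hbD hf hb, Set.forall_mem_image]
      refine forall₂_congr fun w hw => ?_
      have hw' := ball_subset hbD e _ hw
      rw [degIn_map hbD hf hb hw', hbd w hw']
    unfold contribution
    by_cases he : ∃ x, s.bddScope e = some x
    · have he' := hex.1 he
      rw [dif_pos he, dif_pos he']
      by_cases hc : ∀ w ∈ ball s.bddScope e (P.radius - 1), degIn s.bddScope w = s.bddDegs w
      · rw [if_pos hc, if_pos (hall.1 hc), hdeps,
          Quotient.sound (nbhd_iso hbD hf hb (fun e' => I.pred e'.1) P.radius e he he')]
      · rw [if_neg hc, if_neg (hall.not.1 hc)]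
    · rw [dif_neg he, dif_neg (hex.not.1 he)]
  unfold aggregate
  rw [← hs]
  simp only [hcontr]

theorem Agree.aggregate_eq (I : CSPInstance 𝓕 n m) (loc : NbhdClass 𝓕 → Set.Icc (0 : ℝ) 1)
    {s s' : Sample k n m P} (h : Agree s s') : aggregate I loc s = aggregate I loc s' := by
  obtain ⟨hs, hh, φ, h1, -, h3, h4⟩ := h
  let f : Fin n × ℕ → Fin n × ℕ := fun w => if hw : w ∈ s.vars then (φ ⟨w, hw⟩).1 else w
  have hfφ : ∀ w (hw : w ∈ s.vars), f w = (φ ⟨w, hw⟩).1 := fun w hw => dif_pos hw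
  refine aggregate_eq_of_map I loc hs hh (f := f) ?_ ?_ ?_ ?_ ?_
  · intro w hw w' hw' hww'
    rw [hfφ w hw, hfφ w' hw'] at hww'
    exact congrArg Subtype.val (φ.injective (Subtype.ext hww'))
  · intro e x hx t
    have := h4 e
    rw [hx] at this
    rcases hy : s'.scope e with _ | y
    · rw [hy] at this; cases this
    · rw [hy] at this
      cases this with
      | some h => exact (h t).1
  · intro e
    have := h4 e
    rcases hx : s.scope e with _ | x <;> rcases hy : s'.scope e with _ | y <;> rw [hx, hy] at this
    · rfl
    · cases this
    · cases this
    · cases this with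
      | some h =>
        rw [Option.map_some]
        congr 1
        funext t
        obtain ⟨hxt, hφ⟩ := h t
        rw [hfφ _ hxt, hφ]
  · intro w hw
    rw [hfφ w hw]; exact h1 _
  · intro w hw
    rw [hfφ w hw]; exact h3 _

end Invariance

/-! ### The two estimators as functions of their random choices -/

section NormalForms

variable {k : ℕ} {A : Type*} {𝓕 : Set ((Fin k → A) → Bool)} {n m : ℕ} {P : Params}

open Classical in
/-- The high-degree variables of the streaming estimator. -/
def tier (I : CSPInstance 𝓕 n m) (Gt : Finset (Copy m P × Fin k)) : Finset (Fin n) :=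
  {v | P.thr < degG I Gt v}

/-- The degree estimate of the streaming estimator. -/
def estDeg (I : CSPInstance 𝓕 n m) (Gt : Finset (Copy m P × Fin k)) (v : Fin n) : ℕ :=
  ⌈(degG I Gt v : ℝ) * P.N / P.B⌉₊

open Classical in
/-- The high-degree variables that occur in `G`. -/
def tierG (I : CSPInstance 𝓕 n m) (Gt G : Finset (Copy m P × Fin k)) : Finset (Fin n) :=
  {v | v ∈ tier I Gt ∧ 0 < degG I G v}

/-- The number of created copies, if the high-degree variable `v` has the set `K v` of sampled
copies. -/
def copyCount (I : CSPInstance 𝓕 n m) (Gt G : Finset (Copy m P × Fin k)) (K : Fin n → Finset ℕ)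
    (v : Fin n) : ℕ :=
  if v ∈ tierG I Gt G then #(K v) else 0

/-- The law of the copy assigned to the position `p` by the streaming estimator; `g` says whether
`p` belongs to `G`. -/
def assignLaw (I : CSPInstance 𝓕 n m) (H : Fin n → Fin P.N) (Gt : Finset (Copy m P × Fin k))
    (K : Fin n → Finset ℕ) (p : Copy m P × Fin k) (g : Bool) : PMF (Option ℕ) :=
  if I.scope p.1.1 p.2 ∈ tier I Gt then
    if g then (coin ((#(K (I.scope p.1.1 p.2)) : ℝ) /
        (estDeg I Gt (I.scope p.1.1 p.2) * (2 / P.N)))).bind fun b =>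
      if b then (uniformBelow #(K (I.scope p.1.1 p.2))).map some else PMF.pure none
    else PMF.pure none
  else if (H (I.scope p.1.1 p.2) : ℕ) = 0 then
    (uniformBelow (I.deg (I.scope p.1.1 p.2))).map some
  else PMF.pure none

open Classical in
/-- The sampled instance of the streaming estimator. -/
def streamSample (I : CSPInstance 𝓕 n m) (H : Fin n → Fin P.N)
    (Gt : Finset (Copy m P × Fin k)) (C : Finset (Copy m P)) (K : Fin n → Finset ℕ)
    (G : Finset (Copy m P × Fin k)) (a : Copy m P × Fin k → Option ℕ) : Sample k n m P where
  vars := copies {v | v ∈ ({v | (H v : ℕ) = 0 ∧ ∃ i t, I.scope i t = v} : Finset (Fin n)) ∧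
      v ∉ tier I Gt} (fun v => if (H v : ℕ) = 0 then I.deg v else 0) ∪
    copies (tierG I Gt G) (copyCount I Gt G K)
  scope := fun e =>
    if e ∈ ({e | ∃ t, (H (I.scope e.1 t) : ℕ) = 0 ∨ (e, t) ∈ G} : Finset (Copy m P)) ∧
        ∀ t, (a (e, t)).isSome then
      some fun t => (I.scope e.1 t, (a (e, t)).getD 0)
    else none
  degs := fun w => #{p : Copy m P × Fin k | I.scope p.1.1 p.2 = w.1 ∧ a p = some w.2}
  high := tier I Gt
  sampled := C

/-- The number of items stored by the streaming estimator. -/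
def streamSpace (I : CSPInstance 𝓕 n m) (H : Fin n → Fin P.N)
    (Gt : Finset (Copy m P × Fin k)) (C : Finset (Copy m P)) (K : Fin n → Finset ℕ)
    (G : Finset (Copy m P × Fin k)) (a : Copy m P × Fin k → Option ℕ) : ℕ :=
  #({v | (H v : ℕ) = 0 ∧ ∃ i t, I.scope i t = v} : Finset (Fin n)) +
    #({e | ∃ t, (H (I.scope e.1 t) : ℕ) = 0 ∨ (e, t) ∈ G} : Finset (Copy m P)) + #G + #Gt + #C +
    #(streamSample I H Gt C K G a).vars

open Classical in
/-- The result of the streaming estimator. -/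
def streamResult (I : CSPInstance 𝓕 n m) (loc : NbhdClass 𝓕 → Set.Icc (0 : ℝ) 1)
    (H : Fin n → Fin P.N) (Gt : Finset (Copy m P × Fin k)) (C : Finset (Copy m P))
    (K : Fin n → Finset ℕ) (z : Finset (Copy m P × Fin k) × (Copy m P × Fin k → Option ℕ)) :
    Option (Sample k n m P × ℝ) :=
  if ∃ v ∈ tierG I Gt z.1, 1 < (copyCount I Gt z.1 K v : ℝ) / (estDeg I Gt v * (2 / P.N)) then none
  else if P.cap < streamSpace I H Gt C K z.1 z.2 then none
  else some (streamSample I H Gt C K z.1 z.2,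
    aggregate I loc (streamSample I H Gt C K z.1 z.2))

/-- The law of the set `G` and of the assignment of copies to positions. -/
def pairLaw (I : CSPInstance 𝓕 n m) (H : Fin n → Fin P.N) (Gt : Finset (Copy m P × Fin k))
    (K : Fin n → Finset ℕ) :
    PMF (Finset (Copy m P × Fin k) × (Copy m P × Fin k → Option ℕ)) :=
  open Classical in
  (randomSubset univ (2 / P.N)).bind fun G =>
    (indep fun p => assignLaw I H Gt K p (decide (p ∈ G))).map fun a => (G, a)

/-- Subsets may be drawn for all high-degree variables, including those that `G` misses; their sizes
are forgotten. This makes the law of `K` independent of `G`, so `G` can be drawn later. -/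
theorem copyCount_law (I : CSPInstance 𝓕 n m) (Gt G : Finset (Copy m P × Fin k)) (p : ℝ) :
    (indep fun v : Fin n => if v ∈ tierG I Gt G then
      (randomSubset (range (estDeg I Gt v)) p).map card else PMF.pure 0) =
      (sliceLaw (tier I Gt) (estDeg I Gt) p).map (copyCount I Gt G) := by
  have h := indep_map (fun v => if v ∈ tier I Gt then randomSubset (range (estDeg I Gt v)) p
    else PMF.pure ∅) (fun v K => if v ∈ tierG I Gt G then #K else 0)
  refine Eq.trans ?_ h
  congr 1
  funext v
  by_cases hv : v ∈ tierG I Gt G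
  · have hv' : v ∈ tier I Gt := by
      unfold tierG at hv
      exact (mem_filter.1 hv).2.1
    simp only [if_pos hv, if_pos hv']
  · simp only [if_neg hv]
    exact (PMF.map_const _ _).symm

theorem scope_mem_tierG {I : CSPInstance 𝓕 n m} {Gt G : Finset (Copy m P × Fin k)}
    {p : Copy m P × Fin k} (h : I.scope p.1.1 p.2 ∈ tier I Gt) (hp : p ∈ G) :
    I.scope p.1.1 p.2 ∈ tierG I Gt G := by
  unfold tierG
  refine mem_filter.2 ⟨mem_univ _, h, card_pos.2 ⟨p, mem_filter.2 ⟨hp, rfl⟩⟩⟩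

theorem streamingReduction_eq (I : CSPInstance 𝓕 n m) (H : Fin n → Fin P.N)
    (Gt G : Finset (Copy m P × Fin k)) (R : List (Copy m P) × ℕ) :
    open Classical in
    streamingReduction I (finalSketch I H Gt G R) =
      (sliceLaw (tier I Gt) (estDeg I Gt) (1 / P.N)).bind fun K =>
        (indep fun p => assignLaw I H Gt K p (decide (p ∈ G))).bind fun a =>
          PMF.pure (if ∃ v ∈ tierG I Gt G,
              1 < (copyCount I Gt G K v : ℝ) / (estDeg I Gt v * (2 / P.N)) then none
            else some (streamSample I H Gt R.1.toFinset K G a)) := by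
  classical
  unfold streamingReduction
  simp only [pmf_do_bind, pmf_do_pure]
  have h := copyCount_law I Gt G (1 / P.N)
  refine (congrArg (fun q => PMF.bind q _) h).trans ?_
  rw [PMF.bind_map]
  refine congrArg _ (funext fun K => ?_)
  simp only [Function.comp_apply]
  by_cases hbad : ∃ v ∈ tierG I Gt G,
      1 < (copyCount I Gt G K v : ℝ) / (estDeg I Gt v * (2 / P.N))
  -- A terminated run draws no assignment; drawing one and discarding it leaves the law unchanged.
  · simp only [if_pos hbad, PMF.bind_const]
    exact if_pos hbad
  · simp only [if_neg hbad]
    refine (if_neg hbad).trans ?_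
    have hlaw : ∀ p : Copy m P × Fin k, (assignLaw I H Gt K p (decide (p ∈ G))) =
        if I.scope p.1.1 p.2 ∈ tier I Gt then
          if p ∈ G then (coin ((copyCount I Gt G K (I.scope p.1.1 p.2) : ℝ) /
              (estDeg I Gt (I.scope p.1.1 p.2) * (2 / P.N)))).bind fun b =>
            if b then (uniformBelow (copyCount I Gt G K (I.scope p.1.1 p.2))).map some
            else PMF.pure none
          else PMF.pure none
        else if I.scope p.1.1 p.2 ∈ (finalSketch I H Gt G R).S ∧ p.1 ∈ (finalSketch I H Gt G R).F
          then (uniformBelow ((finalSketch I H Gt G R).degs (I.scope p.1.1 p.2))).map some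
        else PMF.pure none := by
      intro p
      unfold assignLaw
      by_cases h1 : I.scope p.1.1 p.2 ∈ tier I Gt
      · rw [if_pos h1, if_pos h1]
        by_cases h2 : p ∈ G
        · rw [if_pos h2, copyCount, if_pos (scope_mem_tierG h1 h2)]
          simp only [h2, decide_true, if_true]
        · rw [if_neg h2]
          simp only [h2, decide_false, Bool.false_eq_true, if_false]
      · rw [if_neg h1, if_neg h1]
        by_cases h2 : (H (I.scope p.1.1 p.2) : ℕ) = 0
        · have h3 : I.scope p.1.1 p.2 ∈ (finalSketch I H Gt G R).S ∧
              p.1 ∈ (finalSketch I H Gt G R).F := by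
            simp only [finalSketch, mem_filter, mem_univ, true_and]
            exact ⟨⟨h2, p.1.1, p.2, rfl⟩, p.2, Or.inl h2⟩
          rw [if_pos h2, if_pos h3]
          simp only [finalSketch, if_pos h2]
        · have h3 : ¬ (I.scope p.1.1 p.2 ∈ (finalSketch I H Gt G R).S ∧
              p.1 ∈ (finalSketch I H Gt G R).F) := by
            simp only [finalSketch, mem_filter, mem_univ, true_and]
            exact fun h => h2 h.1.1
          rw [if_neg h2, if_neg h3]
    simp only [hlaw]
    rfl

/-- The streaming estimator in terms of its independent random choices. -/
theorem streamingEstimator_eq (I : CSPInstance 𝓕 n m)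
    (loc : NbhdClass 𝓕 → Set.Icc (0 : ℝ) 1) (hash : PMF (Fin n → Fin P.N)) :
    streamingEstimator I P loc hash =
      (randomSubset (univ : Finset (Copy m P × Fin k)) (1 / P.N)).bind fun Gt =>
        hash.bind fun H => (uniformSample (Copy m P) P.size).bind fun C =>
          (sliceLaw (tier I Gt) (estDeg I Gt) (1 / P.N)).bind fun K =>
            (pairLaw I H Gt K).map (streamResult I loc H Gt C K) := by
  classical
  unfold streamingEstimator
  simp only [pmf_do_bind, pmf_do_pure, sketch_eq, PMF.bind_bind, PMF.pure_bind,
    streamingReduction_eq]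
  rw [PMF.bind_comm]
  refine congrArg _ (funext fun Gt => congrArg _ (funext fun H => ?_))
  -- For fixed `G` the reservoir is replaced by the uniform sample; its length enters through the
  -- space test only.
  have hR : ∀ G, ((reservoirLaw P.size (copyList P (List.finRange m))).bind fun R =>
      (sliceLaw (tier I Gt) (estDeg I Gt) (1 / P.N)).bind fun K =>
        (indep fun p => assignLaw I H Gt K p (decide (p ∈ G))).bind fun a =>
          PMF.pure (if ∃ v ∈ tierG I Gt G,
              1 < (copyCount I Gt G K v : ℝ) / (estDeg I Gt v * (2 / P.N)) then none
            else if P.cap < (#({v | (H v : ℕ) = 0 ∧ ∃ i t, I.scope i t = v} : Finset (Fin n)) +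
                #({e | ∃ t, (H (I.scope e.1 t) : ℕ) = 0 ∨ (e, t) ∈ G} : Finset (Copy m P)) +
                #G + #Gt + R.1.length + #(streamSample I H Gt R.1.toFinset K G a).vars : ℕ)
              then none
            else some (streamSample I H Gt R.1.toFinset K G a,
              aggregate I loc (streamSample I H Gt R.1.toFinset K G a)))) =
      (uniformSample (Copy m P) P.size).bind fun C =>
        (sliceLaw (tier I Gt) (estDeg I Gt) (1 / P.N)).bind fun K =>
          (indep fun p => assignLaw I H Gt K p (decide (p ∈ G))).bind fun a =>
            PMF.pure (streamResult I loc H Gt C K (G, a)) := by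
    intro G
    have := reservoirLaw_bind_eq P.size (copyList P (List.finRange m))
      (nodup_copyList (List.nodup_finRange m)) (by ext e; simp [mem_copyList])
      (fun C c => (sliceLaw (tier I Gt) (estDeg I Gt) (1 / P.N)).bind fun K =>
        (indep fun p => assignLaw I H Gt K p (decide (p ∈ G))).bind fun a =>
          PMF.pure (if ∃ v ∈ tierG I Gt G,
              1 < (copyCount I Gt G K v : ℝ) / (estDeg I Gt v * (2 / P.N)) then none
            else if P.cap < (#({v | (H v : ℕ) = 0 ∧ ∃ i t, I.scope i t = v} : Finset (Fin n)) +
                #({e | ∃ t, (H (I.scope e.1 t) : ℕ) = 0 ∨ (e, t) ∈ G} : Finset (Copy m P)) +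
                #G + #Gt + c + #(streamSample I H Gt C K G a).vars : ℕ) then none
            else some (streamSample I H Gt C K G a,
              aggregate I loc (streamSample I H Gt C K G a))))
    exact this
  calc _ = (randomSubset (univ : Finset (Copy m P × Fin k)) (2 / P.N)).bind fun G => _ := by
        refine congrArg _ (funext fun G => Eq.trans ?_ (hR G))
        refine congrArg _ (funext fun R => congrArg _ (funext fun K => congrArg _ (funext fun a =>
          ?_)))
        by_cases h1 : ∃ v ∈ tierG I Gt G,
            1 < (copyCount I Gt G K v : ℝ) / (estDeg I Gt v * (2 / P.N))
        · simp only [if_pos h1]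
        · simp only [if_neg h1, space, finalSketch]
          split_ifs with h2
          · exact if_pos h2
          · exact if_neg h2
    _ = _ := by
        rw [PMF.bind_comm]
        refine congrArg _ (funext fun C => ?_)
        rw [PMF.bind_comm]
        refine congrArg _ (funext fun K => ?_)
        rw [pairLaw, PMF.map_bind]
        refine congrArg _ (funext fun G => ?_)
        rw [PMF.map_comp]
        rfl

open Classical in
/-- The high-degree variables of the offline estimator. -/
def offTier (P : Params) (d₀ : Fin n → ℕ) : Finset (Fin n) :=
  {v | ¬ ((d₀ v : ℝ) ≤ P.thr * P.N / P.B)}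

/-- The degree estimates of the offline estimator. -/
def offDeg (I : CSPInstance 𝓕 n m) (P : Params) (d₀ : Fin n → ℕ) (v : Fin n) : ℕ :=
  if v ∈ offTier P d₀ then d₀ v else I.deg v

open Classical in
/-- The sampled variables of the offline estimator. -/
def offKept (I : CSPInstance 𝓕 n m) (H : Fin n → Fin P.N) (d₀ : Fin n → ℕ)
    (K : Fin n → Finset ℕ) : Finset (Fin n × ℕ) :=
  copies {v | v ∉ offTier P d₀ ∧ (H v : ℕ) = 0} (offDeg I P d₀) ∪ glue (offTier P d₀) K

open Classical in
/-- The sampled instance of the offline estimator. -/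
def offSample (I : CSPInstance 𝓕 n m) (H : Fin n → Fin P.N) (d₀ : Fin n → ℕ)
    (C : Finset (Copy m P)) (K : Fin n → Finset ℕ) (x : Copy m P × Fin k → ℕ) :
    Sample k n m P where
  vars := offKept I H d₀ K
  scope := fun e => if ∀ t, (I.scope e.1 t, x (e, t)) ∈ offKept I H d₀ K then
    some fun t => (I.scope e.1 t, x (e, t)) else none
  degs := fun w => #{p : Copy m P × Fin k | (I.scope p.1.1 p.2, x (p.1, p.2)) = w}
  high := offTier P d₀
  sampled := C

/-- The offline estimator in terms of its independent random choices. -/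
theorem offlineEstimator_eq (I : CSPInstance 𝓕 n m) (loc : NbhdClass 𝓕 → Set.Icc (0 : ℝ) 1)
    (hash : PMF (Fin n → Fin P.N)) {Ω : Type} (μ : PMF Ω) (d₀ : Ω → Fin n → ℕ) :
    offlineEstimator I P loc hash (μ.map d₀) =
      μ.bind fun ω => hash.bind fun H => (uniformSample (Copy m P) P.size).bind fun C =>
        (sliceLaw (offTier P (d₀ ω)) (offDeg I P (d₀ ω)) (1 / P.N)).bind fun K =>
          (indep fun p : Copy m P × Fin k =>
            uniformBelow (offDeg I P (d₀ ω) (I.scope p.1.1 p.2))).map fun x =>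
              (offSample I H (d₀ ω) C K x, aggregate I loc (offSample I H (d₀ ω) C K x)) := by
  classical
  unfold offlineEstimator
  simp only [pmf_do_bind, pmf_do_pure]
  rw [PMF.bind_map]
  refine congrArg _ (funext fun ω => ?_)
  simp only [Function.comp_apply]
  rw [PMF.bind_comm]
  refine congrArg _ (funext fun H => ?_)
  have h := sliceLaw_map_glue (offTier P (d₀ ω)) (offDeg I P (d₀ ω)) (1 / P.N)
  calc _ = (indep fun p : Copy m P × Fin k =>
            uniformBelow (offDeg I P (d₀ ω) (I.scope p.1.1 p.2))).bind fun x =>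
          (randomSubset (copies (offTier P (d₀ ω)) (offDeg I P (d₀ ω))) (1 / P.N)).bind _ := rfl
    _ = (indep fun p : Copy m P × Fin k =>
            uniformBelow (offDeg I P (d₀ ω) (I.scope p.1.1 p.2))).bind fun x =>
          (sliceLaw (offTier P (d₀ ω)) (offDeg I P (d₀ ω)) (1 / P.N)).bind fun K =>
            (uniformSample (Copy m P) P.size).bind fun C =>
              PMF.pure (offSample I H (d₀ ω) C K x,
                aggregate I loc (offSample I H (d₀ ω) C K x)) := by
        refine congrArg _ (funext fun x => ?_)
        rw [← h, PMF.bind_map]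
        rfl
    _ = (indep fun p : Copy m P × Fin k =>
            uniformBelow (offDeg I P (d₀ ω) (I.scope p.1.1 p.2))).bind fun x =>
          (uniformSample (Copy m P) P.size).bind fun C =>
            (sliceLaw (offTier P (d₀ ω)) (offDeg I P (d₀ ω)) (1 / P.N)).bind fun K =>
              PMF.pure (offSample I H (d₀ ω) C K x,
                aggregate I loc (offSample I H (d₀ ω) C K x)) := by
        refine congrArg _ (funext fun x => ?_)
        rw [PMF.bind_comm]
    _ = _ := by
        rw [PMF.bind_comm]
        refine congrArg _ (funext fun C => ?_)
        rw [PMF.bind_comm]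
        rfl

end NormalForms

/-! ### Matching the positions of the two estimators -/

/-- The mass of `none` is the complement of the rest, so only created copies have to be compared. -/
theorem pmf_option_ext {α : Type} {p q : PMF (Option α)} (h : ∀ a, p (some a) = q (some a)) :
    p = q := by
  classical
  have key : ∀ r : PMF (Option α), r none = 1 - ∑' o, (if o = none then 0 else r o) := by
    intro r
    have h1 := r.tsum_coe
    have h2 : ∑' o, r o = r none + ∑' o, (if o = none then 0 else r o) := by
      rw [ENNReal.tsum_eq_add_tsum_ite none]
      congr 1
      exact tsum_congr fun o => by split_ifs <;> rfl
    rw [h2] at h1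
    refine ENNReal.eq_sub_of_add_eq ?_ h1
    refine ne_top_of_le_ne_top ENNReal.one_ne_top ?_
    rw [← h1]
    exact le_add_self
  have h' : ∀ o : Option α, (if o = none then 0 else p o) = if o = none then 0 else q o := by
    intro o
    cases o with
    | none => simp
    | some a => simp [h a]
  ext o
  cases o with
  | none => rw [key p, key q]; simp only [h']
  | some a => exact h a

/-- Independent thinning multiplies the survival probabilities. -/
theorem coin_bind_coin {α : Type} {p q : ℝ} (hp : 0 ≤ p) (hp1 : p ≤ 1) (hq : 0 ≤ q) (hq1 : q ≤ 1)
    (f : Bool → PMF α) :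
    ((coin p).bind fun b => if b then (coin q).bind f else f false) = (coin (p * q)).bind f := by
  have hc : ((coin p).bind fun b => if b then coin q else PMF.pure false) = coin (p * q) := by
    refine coin_ext ?_
    rw [coin_bind_apply, coin_true_of_le_one hp1,
      coin_true_of_le_one (mul_le_one₀ hp1 hq hq1), ENNReal.ofReal_mul hp]
    simp [coin_true_of_le_one hq1, PMF.pure_apply]
  rw [← hc, PMF.bind_bind]
  refine congrArg _ (funext fun b => ?_)
  cases b
  · simp [PMF.pure_bind]
  · simp

theorem nth_mem_finset {K : Finset ℕ} {j : ℕ} (hj : j < #K) :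
    Nat.nth (· ∈ K) j ∈ K ∧ Nat.count (· ∈ K) (Nat.nth (· ∈ K) j) = j := by
  have h : ∀ hf : (Set.ofPred (· ∈ K)).Finite, j < #hf.toFinset := by
    intro hf
    have : hf.toFinset = K := by ext y; rw [Set.Finite.mem_toFinset, Set.mem_ofPred_eq]
    rwa [this]
  exact ⟨Nat.nth_mem j h, Nat.count_nth h⟩

theorem count_lt_card {K : Finset ℕ} {x : ℕ} (hx : x ∈ K) : Nat.count (· ∈ K) x < #K := by
  rw [Nat.count_eq_card_filter_range]
  refine card_lt_card ⟨fun y hy => (mem_filter.1 hy).2, fun h => ?_⟩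
  simpa using h hx

/-- A uniform point of `[d]` hits `K` with probability `#K / d`, and its rank is then uniform.
`Nat.count` computes the rank and `Nat.nth` inverts it. -/
theorem coin_bind_uniformBelow {d : ℕ} (hd : 0 < d) {K : Finset ℕ} (hK : K ⊆ range d) :
    ((coin ((#K : ℝ) / d)).bind fun b =>
      if b then (uniformBelow #K).map some else PMF.pure none) =
      (uniformBelow d).map fun x => if x ∈ K then some (Nat.count (· ∈ K) x) else none := by
  classical
  refine pmf_option_ext fun j => ?_
  have hcd : #K ≤ d := by simpa using card_le_card hK
  have hle : (#K : ℝ) / d ≤ 1 := by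
    rw [div_le_one (by exact_mod_cast hd)]; exact_mod_cast hcd
  rw [coin_bind_apply, coin_true_of_le_one hle]
  simp only [if_true, Bool.false_eq_true, if_false]
  have hsome : ((uniformBelow #K).map some) (some j) = uniformBelow #K j := by
    rw [PMF.map_apply, tsum_eq_single j]
    · simp
    · intro j' hj'; simp [hj'.symm]
  rw [hsome, PMF.pure_apply, if_neg (by simp), mul_zero, add_zero, PMF.map_apply]
  by_cases hj : j < #K
  · obtain ⟨h1, h2⟩ := nth_mem_finset hj
    have hK0 : 0 < #K := by omega
    rw [tsum_eq_single (Nat.nth (· ∈ K) j), if_pos (by rw [if_pos h1, h2]), uniformBelow_apply hd,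
      if_pos (mem_range.1 (hK h1)), uniformBelow_apply hK0, if_pos hj,
      ← ENNReal.ofReal_natCast #K, ← ENNReal.ofReal_natCast d,
      ← ENNReal.ofReal_inv_of_pos (by exact_mod_cast hK0),
      ← ENNReal.ofReal_inv_of_pos (by exact_mod_cast hd), ← ENNReal.ofReal_mul (by positivity)]
    · congr 1
      have : (#K : ℝ) ≠ 0 := by exact_mod_cast hK0.ne'
      field_simp
    · intro x hx
      refine if_neg fun h => hx ?_
      split_ifs at h with hxK
      rw [Option.some.injEq] at h
      rw [h, Nat.nth_count hxK]
  · have hr : ∀ x, ¬ (some j = if x ∈ K then some (Nat.count (· ∈ K) x) else none) := by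
      intro x h
      split_ifs at h with hxK
      rw [Option.some.injEq] at h
      exact hj (h ▸ count_lt_card hxK)
    simp only [hr, if_false, tsum_zero]
    rcases Nat.eq_zero_or_pos #K with h0 | h0
    · simp [h0]
    · rw [uniformBelow_apply h0, if_neg hj, mul_zero]

section Matching

variable {k : ℕ} {A : Type*} {𝓕 : Set ((Fin k → A) → Bool)} {n m : ℕ} {P : Params}

/-- The copy that the streaming estimator assigns to the position `p` if the offline estimator
picks the copy with index `x`. -/
def matchCopy (I : CSPInstance 𝓕 n m) (H : Fin n → Fin P.N) (Gt : Finset (Copy m P × Fin k))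
    (K : Fin n → Finset ℕ) (p : Copy m P × Fin k) (x : ℕ) : Option ℕ :=
  if I.scope p.1.1 p.2 ∈ tier I Gt then
    if x ∈ K (I.scope p.1.1 p.2) then some (Nat.count (· ∈ K (I.scope p.1.1 p.2)) x) else none
  else if (H (I.scope p.1.1 p.2) : ℕ) = 0 then some x else none

/-- The number of copies of `v` in the reduced instance. -/
def trueDeg (I : CSPInstance 𝓕 n m) (Gt : Finset (Copy m P × Fin k)) (v : Fin n) : ℕ :=
  if v ∈ tier I Gt then estDeg I Gt v else I.deg v

/-- The sets of sampled copies for which no resampling probability exceeds `1`. -/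
def GoodSlices (I : CSPInstance 𝓕 n m) (Gt : Finset (Copy m P × Fin k)) (K : Fin n → Finset ℕ) :
    Prop :=
  ∀ v ∈ tier I Gt, K v ⊆ range (estDeg I Gt v) ∧ (#(K v) : ℝ) ≤ estDeg I Gt v * (2 / P.N)

/-- For a high-degree variable the factor `2/N` cancels against the acceptance probability, which
`GoodSlices` keeps at most one so that the coin is not truncated. For a low-degree variable the
membership in `G` is irrelevant and both sides draw uniformly from the true degree. -/
theorem assignLaw_eq (I : CSPInstance 𝓕 n m) (H : Fin n → Fin P.N)
    (Gt : Finset (Copy m P × Fin k)) (K : Fin n → Finset ℕ) (hN : 2 ≤ P.N)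
    (hest : ∀ v ∈ tier I Gt, 0 < estDeg I Gt v) (hK : GoodSlices I Gt K)
    (p : Copy m P × Fin k) :
    (coin (2 / P.N)).bind (assignLaw I H Gt K p) =
      (uniformBelow (trueDeg I Gt (I.scope p.1.1 p.2))).map (matchCopy I H Gt K p) := by
  set v := I.scope p.1.1 p.2 with hv
  have hN' : (2 : ℝ) ≤ P.N := by exact_mod_cast hN
  by_cases h1 : v ∈ tier I Gt
  · have hd := hest v h1
    have hd' : (0 : ℝ) < estDeg I Gt v := by exact_mod_cast hd
    obtain ⟨hsub, hle⟩ := hK v h1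
    have hlaw : assignLaw I H Gt K p = fun g => if g then (coin ((#(K v) : ℝ) /
        (estDeg I Gt v * (2 / P.N)))).bind fun b =>
          if b then (uniformBelow #(K v)).map some else PMF.pure none
        else PMF.pure none := by
      funext g
      rw [assignLaw, ← hv, if_pos h1]
    have hmatch : matchCopy I H Gt K p =
        fun x => if x ∈ K v then some (Nat.count (· ∈ K v) x) else none := by
      funext x
      rw [matchCopy, ← hv, if_pos h1]
    have hcc := coin_bind_coin (p := 2 / P.N) (q := (#(K v) : ℝ) / (estDeg I Gt v * (2 / P.N)))
      (by positivity) (by rw [div_le_one (by linarith)]; exact hN') (by positivity)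
      (by rw [div_le_one (by positivity)]; exact hle)
      (fun b => if b then (uniformBelow #(K v)).map some else PMF.pure none)
    simp only [Bool.false_eq_true, if_false] at hcc
    rw [hlaw, hmatch, hcc, trueDeg, if_pos h1, ← coin_bind_uniformBelow hd hsub]
    congr 2
    field_simp
  · have hlaw : assignLaw I H Gt K p = fun _ => if (H v : ℕ) = 0 then
        (uniformBelow (I.deg v)).map some else PMF.pure none := by
      funext g
      rw [assignLaw, ← hv, if_neg h1]
    have hmatch : matchCopy I H Gt K p = fun x => if (H v : ℕ) = 0 then some x else none := by
      funext x
      rw [matchCopy, ← hv, if_neg h1]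
    rw [hlaw, hmatch, PMF.bind_const, trueDeg, if_neg h1]
    split_ifs
    · rfl
    · exact (PMF.map_const _ _).symm

theorem pairLaw_map_snd (I : CSPInstance 𝓕 n m) (H : Fin n → Fin P.N)
    (Gt : Finset (Copy m P × Fin k)) (K : Fin n → Finset ℕ) (hN : 2 ≤ P.N)
    (hest : ∀ v ∈ tier I Gt, 0 < estDeg I Gt v) (hK : GoodSlices I Gt K) :
    (pairLaw I H Gt K).map Prod.snd =
      (indep fun p : Copy m P × Fin k =>
        uniformBelow (trueDeg I Gt (I.scope p.1.1 p.2))).map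
          fun x p => matchCopy I H Gt K p (x p) := by
  rw [← indep_map]
  simp only [← assignLaw_eq I H Gt K hN hest hK]
  rw [indep_bind, pairLaw, PMF.map_bind, randomSubset_univ, PMF.bind_map]
  refine congrArg _ (funext fun b => ?_)
  simp only [Function.comp_apply, PMF.map_comp, mem_filter, mem_univ, true_and, Bool.decide_eq_true]
  exact PMF.map_id _

theorem pairLaw_map_fst (I : CSPInstance 𝓕 n m) (H : Fin n → Fin P.N)
    (Gt : Finset (Copy m P × Fin k)) (K : Fin n → Finset ℕ) :
    (pairLaw I H Gt K).map Prod.fst = randomSubset univ (2 / P.N) := by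
  rw [pairLaw, PMF.map_bind]
  refine Eq.trans (congrArg _ (funext fun G => ?_)) (PMF.bind_pure _)
  rw [PMF.map_comp]
  exact PMF.map_const _ _

/-- With a nonzero hash value, an assigned position must belong to a high-degree variable, and such
positions are assigned only through `G`. -/
theorem mem_of_mem_support_pairLaw {I : CSPInstance 𝓕 n m} {H : Fin n → Fin P.N}
    {Gt : Finset (Copy m P × Fin k)} {K : Fin n → Finset ℕ}
    {z : Finset (Copy m P × Fin k) × (Copy m P × Fin k → Option ℕ)}
    (hz : z ∈ (pairLaw I H Gt K).support) (p : Copy m P × Fin k) (hp : (z.2 p).isSome)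
    (hH : (H (I.scope p.1.1 p.2) : ℕ) ≠ 0) : p ∈ z.1 := by
  classical
  rw [pairLaw, PMF.mem_support_bind_iff] at hz
  obtain ⟨G, -, hz⟩ := hz
  obtain ⟨a, ha, rfl⟩ := (PMF.mem_support_map_iff _ _ _).1 hz
  have h := mem_support_indep.1 ha p
  by_contra hpG
  simp only at hpG hp
  rw [assignLaw] at h
  simp only [hpG, decide_false, Bool.false_eq_true, if_false, hH, ite_self,
    PMF.mem_support_pure_iff] at h
  simp [h] at hp

end Matching

/-! ### Agreement of the two estimators -/

section Agreement

variable {k : ℕ} {A : Type*} {𝓕 : Set ((Fin k → A) → Bool)} {n m : ℕ} {P : Params}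

theorem CSPInstance.deg_pos (I : CSPInstance 𝓕 n m) (i : Fin m) (t : Fin k) :
    0 < I.deg (I.scope i t) :=
  card_pos.2 ⟨(i, t), mem_filter.2 ⟨mem_univ _, rfl⟩⟩

theorem CSPInstance.exists_of_deg_pos (I : CSPInstance 𝓕 n m) {v : Fin n} (h : 0 < I.deg v) :
    ∃ i t, I.scope i t = v := by
  obtain ⟨p, hp⟩ := card_pos.1 h
  exact ⟨p.1, p.2, (mem_filter.1 hp).2⟩

theorem mem_streamSample_vars {I : CSPInstance 𝓕 n m} {H : Fin n → Fin P.N}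
    {Gt : Finset (Copy m P × Fin k)} {C : Finset (Copy m P)} {K : Fin n → Finset ℕ}
    {G : Finset (Copy m P × Fin k)} {a : Copy m P × Fin k → Option ℕ} {w : Fin n × ℕ} :
    w ∈ (streamSample I H Gt C K G a).vars ↔
      (w.1 ∉ tier I Gt ∧ (H w.1 : ℕ) = 0 ∧ w.2 < I.deg w.1) ∨
        (w.1 ∈ tierG I Gt G ∧ w.2 < #(K w.1)) := by
  simp only [streamSample, mem_union, mem_copies, mem_filter, mem_univ, true_and]
  refine or_congr ⟨?_, ?_⟩ (and_congr_right fun h => by rw [copyCount, if_pos h])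
  · rintro ⟨⟨⟨h1, -⟩, h2⟩, h3⟩
    rw [if_pos h1] at h3
    exact ⟨h2, h1, h3⟩
  · rintro ⟨h1, h2, h3⟩
    rw [if_pos h2]
    exact ⟨⟨⟨h2, I.exists_of_deg_pos (by omega)⟩, h1⟩, h3⟩

theorem mem_offKept {I : CSPInstance 𝓕 n m} {H : Fin n → Fin P.N} {d₀ : Fin n → ℕ}
    {K : Fin n → Finset ℕ} {w : Fin n × ℕ} :
    w ∈ offKept I H d₀ K ↔
      (w.1 ∉ offTier P d₀ ∧ (H w.1 : ℕ) = 0 ∧ w.2 < I.deg w.1) ∨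
        (w.1 ∈ offTier P d₀ ∧ w.2 ∈ K w.1) := by
  simp only [offKept, mem_union, mem_copies, mem_glue, mem_filter, mem_univ, true_and, and_assoc]
  refine or_congr (and_congr_right fun h => ?_) Iff.rfl
  rw [offDeg, if_neg h]

/-- The isomorphism sends the copy of rank `j` to the `j`-th element of `K v` and fixes low-degree
copies. Since `G` meets every high-degree variable, every sampled offline copy has a streaming
partner, even if no constraint uses it. -/
theorem agree_of_match (hk : 0 < k) {I : CSPInstance 𝓕 n m} {H : Fin n → Fin P.N}
    {Gt : Finset (Copy m P × Fin k)} (C : Finset (Copy m P)) {K : Fin n → Finset ℕ}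
    {G : Finset (Copy m P × Fin k)} {a : Copy m P × Fin k → Option ℕ} {d₀ : Fin n → ℕ}
    {x : Copy m P × Fin k → ℕ} (hT : offTier P d₀ = tier I Gt) (hG : tierG I Gt G = tier I Gt)
    (ha : ∀ p, a p = matchCopy I H Gt K p (x p))
    (hx : ∀ p : Copy m P × Fin k, I.scope p.1.1 p.2 ∉ tier I Gt →
      x p < I.deg (I.scope p.1.1 p.2))
    (hF : ∀ p : Copy m P × Fin k, (a p).isSome → (H (I.scope p.1.1 p.2) : ℕ) ≠ 0 → p ∈ G) :
    Agree (streamSample I H Gt C K G a) (offSample I H d₀ C K x) := by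
  classical
  set s := streamSample I H Gt C K G a with hs
  set s' := offSample I H d₀ C K x with hs'
  have hvars : ∀ w, w ∈ s.vars ↔ (w.1 ∉ tier I Gt ∧ (H w.1 : ℕ) = 0 ∧ w.2 < I.deg w.1) ∨
      (w.1 ∈ tier I Gt ∧ w.2 < #(K w.1)) := fun w => by
    rw [hs, mem_streamSample_vars, hG]
  have hvars' : ∀ w, w ∈ s'.vars ↔ (w.1 ∉ tier I Gt ∧ (H w.1 : ℕ) = 0 ∧ w.2 < I.deg w.1) ∨
      (w.1 ∈ tier I Gt ∧ w.2 ∈ K w.1) := fun w => by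
    rw [← hT]; exact mem_offKept
  let f : Fin n × ℕ → Fin n × ℕ := fun w =>
    (w.1, if w.1 ∈ tier I Gt then Nat.nth (· ∈ K w.1) w.2 else w.2)
  let g : Fin n × ℕ → Fin n × ℕ := fun w =>
    (w.1, if w.1 ∈ tier I Gt then Nat.count (· ∈ K w.1) w.2 else w.2)
  have hf : ∀ w ∈ s.vars, f w ∈ s'.vars := by
    intro w hw
    rw [hvars']
    rcases (hvars w).1 hw with ⟨h1, h2, h3⟩ | ⟨h1, h2⟩
    · exact Or.inl ⟨h1, h2, by simpa only [f, if_neg h1] using h3⟩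
    · exact Or.inr ⟨h1, by simpa only [f, if_pos h1] using (nth_mem_finset h2).1⟩
  have hg : ∀ w ∈ s'.vars, g w ∈ s.vars := by
    intro w hw
    rw [hvars]
    rcases (hvars' w).1 hw with ⟨h1, h2, h3⟩ | ⟨h1, h2⟩
    · exact Or.inl ⟨h1, h2, by simpa only [g, if_neg h1] using h3⟩
    · exact Or.inr ⟨h1, by simpa only [g, if_pos h1] using count_lt_card h2⟩
  have hgf : ∀ w ∈ s.vars, g (f w) = w := by
    intro w hw
    refine Prod.ext rfl ?_
    rcases (hvars w).1 hw with ⟨h1, h2, h3⟩ | ⟨h1, h2⟩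
    · simp only [f, g, if_neg h1]
    · simp only [f, g, if_pos h1]
      exact (nth_mem_finset h2).2
  have hfg : ∀ w ∈ s'.vars, f (g w) = w := by
    intro w hw
    refine Prod.ext rfl ?_
    rcases (hvars' w).1 hw with ⟨h1, h2, h3⟩ | ⟨h1, h2⟩
    · simp only [f, g, if_neg h1]
    · simp only [f, g, if_pos h1]
      exact Nat.nth_count h2
  let φ : s.vars ≃ s'.vars :=
    { toFun := fun w => ⟨f w.1, hf w.1 w.2⟩
      invFun := fun w => ⟨g w.1, hg w.1 w.2⟩
      left_inv := fun w => Subtype.ext (hgf w.1 w.2)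
      right_inv := fun w => Subtype.ext (hfg w.1 w.2) }
  have hsome : ∀ e t, (a (e, t)).isSome ↔ (I.scope e.1 t, x (e, t)) ∈ s'.vars := by
    intro e t
    rw [hvars', ha, matchCopy]
    by_cases h1 : I.scope e.1 t ∈ tier I Gt
    · simp only [h1, not_true_eq_false, false_and, false_or, true_and]
      by_cases h2 : x (e, t) ∈ K (I.scope e.1 t) <;> simp [h2]
    · simp only [h1, not_false_eq_true, false_and, or_false, true_and]
      have := hx (e, t) h1
      by_cases h2 : (H (I.scope e.1 t) : ℕ) = 0 <;> simp [h2, this]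
  have hval : ∀ e t, (a (e, t)).isSome →
      (I.scope e.1 t, (a (e, t)).getD 0) = g (I.scope e.1 t, x (e, t)) := by
    intro e t h
    refine Prod.ext rfl ?_
    rw [ha, matchCopy] at h ⊢
    simp only [g]
    by_cases h1 : I.scope e.1 t ∈ tier I Gt
    · simp only [if_pos h1] at h ⊢
      split_ifs at h ⊢ with h2
      · rfl
      · simp at h
    · simp only [if_neg h1] at h ⊢
      split_ifs at h ⊢ with h2
      · rfl
      · simp at h
  refine ⟨rfl, hT.symm, φ, fun w => rfl, ?_, ?_, ?_⟩
  · intro w hw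
    have hw' : w.1.1 ∉ tier I Gt := hw
    refine Prod.ext rfl ?_
    simp only [φ, f, Equiv.coe_fn_mk, if_neg hw']
  · intro w
    obtain ⟨w, hw⟩ := w
    change #{p : Copy m P × Fin k | (I.scope p.1.1 p.2, x (p.1, p.2)) = f w} =
      #{p : Copy m P × Fin k | I.scope p.1.1 p.2 = w.1 ∧ a p = some w.2}
    congr 1
    ext p
    simp only [mem_filter, mem_univ, true_and]
    constructor
    · intro h
      have h1 : I.scope p.1.1 p.2 = w.1 := congrArg Prod.fst h
      have hmem : (I.scope p.1.1 p.2, x (p.1, p.2)) ∈ s'.vars := by rw [h]; exact hf w hw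
      have hs1 := (hsome p.1 p.2).2 hmem
      have hv := hval p.1 p.2 hs1
      rw [h, hgf w hw] at hv
      refine ⟨h1, ?_⟩
      obtain ⟨y, hy⟩ := Option.isSome_iff_exists.1 hs1
      rw [hy, Option.getD_some] at hv
      rw [show p = (p.1, p.2) from rfl, hy, ← congrArg Prod.snd hv]
    · rintro ⟨h1, h2⟩
      have hs1 : (a (p.1, p.2)).isSome := by
        rw [show (p.1, p.2) = p from rfl, h2]; rfl
      have hv := hval p.1 p.2 hs1
      rw [show (p.1, p.2) = p from rfl, h2, Option.getD_some, h1] at hv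
      have hmem := (hsome p.1 p.2).1 hs1
      rw [show (p.1, p.2) = p from rfl, h1] at hmem
      rw [show (p.1, p.2) = p from rfl, h1, show w = (w.1, w.2) from rfl, hv, hfg _ hmem]
  · intro e
    have hF' : (∀ t, (a (e, t)).isSome) →
        e ∈ ({e | ∃ t, (H (I.scope e.1 t) : ℕ) = 0 ∨ (e, t) ∈ G} : Finset (Copy m P)) := by
      intro h
      -- One assigned position is enough to place the constraint copy in `F`; position zero exists
      -- because `k` is positive.
      refine mem_filter.2 ⟨mem_univ _, ⟨0, hk⟩, ?_⟩
      by_cases h0 : (H (I.scope e.1 ⟨0, hk⟩) : ℕ) = 0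
      · exact Or.inl h0
      · exact Or.inr (hF _ (h _) h0)
    by_cases h : ∀ t, (a (e, t)).isSome
    · have h1 : s.scope e = some fun t => (I.scope e.1 t, (a (e, t)).getD 0) := if_pos ⟨hF' h, h⟩
      have h2 : s'.scope e = some fun t => (I.scope e.1 t, x (e, t)) :=
        if_pos fun t => (hsome e t).1 (h t)
      rw [h1, h2]
      refine Option.Rel.some fun t => ?_
      have hmem := (hsome e t).1 (h t)
      have hv := hval e t (h t)
      simp only [hv]
      exact ⟨hg _ hmem, hfg _ hmem⟩
    · have h1 : s.scope e = none := if_neg fun h' => h h'.2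
      have h2 : s'.scope e = none := if_neg fun h' => h fun t => (hsome e t).2 (h' t)
      rw [h1, h2]
      exact Option.Rel.none

/-- A coupling of the two estimators, with an error given by the probabilities of bad events. -/
theorem coup_estimators (hk : 0 < k) (I : CSPInstance 𝓕 n m)
    (loc : NbhdClass 𝓕 → Set.Icc (0 : ℝ) 1) (hash : PMF (Fin n → Fin P.N)) (hN : 2 ≤ P.N)
    (d₀ : Finset (Copy m P × Fin k) → Fin n → ℕ)
    (badGt badG : Set (Finset (Copy m P × Fin k))) (badH : Set (Fin n → Fin P.N)) (eK : ℝ≥0∞)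
    (hT : ∀ Gt ∉ badGt, offTier P (d₀ Gt) = tier I Gt)
    (hd : ∀ Gt ∉ badGt, ∀ v ∈ tier I Gt, d₀ Gt v = estDeg I Gt v ∧ 0 < estDeg I Gt v)
    (hK : ∀ Gt ∉ badGt, (sliceLaw (tier I Gt) (estDeg I Gt) (1 / P.N)).toOuterMeasure
      {K | ¬ GoodSlices I Gt K} ≤ eK)
    (hG : ∀ Gt ∉ badGt, ∀ G ∉ badG, tierG I Gt G = tier I Gt)
    (hspace : ∀ Gt ∉ badGt, ∀ H ∉ badH, ∀ C : Finset (Copy m P), #C ≤ P.size →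
      ∀ K, GoodSlices I Gt K → ∀ G ∉ badG, ∀ a, (streamSpace I H Gt C K G a : ℝ) ≤ P.cap) :
    Coup (streamingEstimator I P loc hash)
      (offlineEstimator I P loc hash
        ((randomSubset (univ : Finset (Copy m P × Fin k)) (1 / P.N)).map d₀))
      (fun o z => ∃ s out, o = some (s, out) ∧ Agree s z.1 ∧ out = z.2)
      ((randomSubset (univ : Finset (Copy m P × Fin k)) (1 / P.N)).toOuterMeasure badGt +
        (hash.toOuterMeasure badH + (eK +
          (randomSubset (univ : Finset (Copy m P × Fin k)) (2 / P.N)).toOuterMeasure badG))) := by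
  classical
  rw [streamingEstimator_eq, offlineEstimator_eq]
  refine Coup.bind _ badGt fun Gt hGt => Coup.bind _ badH fun H hH => ?_
  have hdeg : offDeg I P (d₀ Gt) = trueDeg I Gt := by
    funext v
    rw [offDeg, trueDeg, hT Gt hGt]
    split_ifs with hv
    · exact (hd Gt hGt v hv).1
    · rfl
  have hslice : sliceLaw (offTier P (d₀ Gt)) (offDeg I P (d₀ Gt)) (1 / P.N) =
      sliceLaw (tier I Gt) (estDeg I Gt) (1 / P.N) := by
    rw [hT Gt hGt, hdeg, sliceLaw, sliceLaw]
    congr 1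
    funext v
    split_ifs with hv
    · rw [trueDeg, if_pos hv]
    · rfl
  -- The size constraint on `C` holds surely, so it is treated as a bad event of probability zero.
  have hC0 : (uniformSample (Copy m P) P.size).toOuterMeasure {C | P.size < #C} = 0 := by
    rw [PMF.toOuterMeasure_apply_eq_zero_iff, Set.disjoint_left]
    intro C hC hC'
    rw [uniformSample, PMF.mem_support_uniformOfFinset_iff, mem_powersetCard] at hC
    have h2 : P.size < #C := hC'
    have := hC.2
    omega
  rw [← zero_add (eK + _), ← hC0]
  refine Coup.bind _ _ fun C hC => ?_
  rw [hslice]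
  refine Coup.mono (Coup.bind _ {K | ¬ GoodSlices I Gt K} fun K hKg => ?_)
    (add_le_add (hK Gt hGt) le_rfl)
  have hKg' : GoodSlices I Gt K := not_not.1 hKg
  -- `G` is correlated with the assignment, but its bad event involves only `G`, whose marginal is
  -- still a plain random subset.
  rw [← pairLaw_map_fst I H Gt K, PMF.toOuterMeasure_map_apply, hdeg]
  refine Coup.glue _ _ Prod.snd (fun x p => matchCopy I H Gt K p (x p))
    (pairLaw_map_snd I H Gt K hN (fun v hv => (hd Gt hGt v hv).2) hKg') _ _ _ ?_
  rintro ⟨G, a⟩ hz x hx hGbad hax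
  have hGbad' : G ∉ badG := hGbad
  have htier := hG Gt hGt G hGbad'
  have hagree : Agree (streamSample I H Gt C K G a) (offSample I H (d₀ Gt) C K x) := by
    refine agree_of_match hk C (hT Gt hGt) htier (fun p => congrFun hax p) ?_
      (fun p hp hH0 => mem_of_mem_support_pairLaw hz p hp hH0)
    intro p hp
    have h1 := mem_support_indep.1 hx p
    rw [trueDeg, if_neg hp] at h1
    exact lt_of_mem_support_uniformBelow (I.deg_pos _ _) h1
  refine ⟨_, _, ?_, hagree, rfl⟩
  rw [streamResult, if_neg, if_neg, hagree.aggregate_eq I loc]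
  · exact not_lt.2 (hspace Gt hGt H hH C (not_lt.1 hC) K hKg' G hGbad' a)
  · rintro ⟨v, hv, h⟩
    refine absurd h (not_lt.2 (div_le_one_of_le₀ ?_ (by positivity)))
    rw [copyCount, if_pos hv]
    rw [htier] at hv
    exact (hKg' v hv).2

end Agreement

/-! ### Probabilities of the bad events -/

theorem indep_toOuterMeasure_eval_le {ι α : Type} [Fintype ι] [DecidableEq ι] (f : ι → PMF α)
    (i : ι) (E : Set α) :
    (indep f).toOuterMeasure {x | x i ∈ E} ≤ (f i).toOuterMeasure E := by
  classical
  refine (toOuterMeasure_le_tsum _ _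
    (fun x => ∏ j, if j = i then E.indicator 1 (x j) else 1) fun x hx => ?_).trans ?_
  · rw [Fintype.prod_ite_eq' (M := ℝ≥0∞)]
    exact le_of_eq (Set.indicator_of_mem (show x i ∈ E from hx) 1).symm
  · rw [tsum_indep_mul_prod f (fun j a => if j = i then E.indicator 1 a else 1),
      Finset.prod_eq_single i]
    · rw [PMF.toOuterMeasure_apply]
      refine le_of_eq (tsum_congr fun a => ?_)
      by_cases ha : a ∈ E <;> simp [ha]
    · intro j _ hj
      simp [hj, PMF.tsum_coe]
    · intro h; exact absurd (mem_univ i) h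

theorem union_bound {α ι : Type} [Fintype ι] (p : PMF α) (E : ι → Set α) (e : ℝ≥0∞)
    (h : ∀ i, p.toOuterMeasure (E i) ≤ e) :
    p.toOuterMeasure {x | ∃ i, x ∈ E i} ≤ Fintype.card ι * e := by
  have : {x | ∃ i, x ∈ E i} = ⋃ i, E i := by ext; simp
  rw [this]
  refine (MeasureTheory.measure_iUnion_fintype_le _ _).trans ?_
  refine (Finset.sum_le_sum fun i _ => h i).trans ?_
  simp

theorem toOuterMeasure_or_le {α : Type} (p : PMF α) (E F : α → Prop) :
    p.toOuterMeasure {x | E x ∨ F x} ≤ p.toOuterMeasure {x | E x} + p.toOuterMeasure {x | F x} :=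
  MeasureTheory.measure_union_le {x | E x} {x | F x}

section Events

variable {k : ℕ} {A : Type*} {𝓕 : Set ((Fin k → A) → Bool)} {n m : ℕ} {P : Params}

theorem card_copy_positions (I : CSPInstance 𝓕 n m) (P : Params) (v : Fin n) :
    #{p : Copy m P × Fin k | I.scope p.1.1 p.2 = v} = P.B * I.deg v := by
  have h : #(({p | I.scope p.1 p.2 = v} : Finset (Fin m × Fin k)) ×ˢ
      (univ : Finset (Fin P.B))) = P.B * I.deg v := by
    rw [card_product, card_univ, Fintype.card_fin, mul_comm, CSPInstance.deg]
  rw [← h]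
  refine card_nbij' (fun p => ((p.1.1, p.2), p.1.2)) (fun q => ((q.1.1, q.2), q.1.2)) ?_ ?_
    (fun _ _ => rfl) (fun _ _ => rfl)
  · intro p hp
    simpa using hp
  · intro q hq
    simpa using hq

theorem sum_deg (I : CSPInstance 𝓕 n m) : ∑ v, I.deg v = m * k := by
  have := card_eq_sum_card_fiberwise (s := (univ : Finset (Fin m × Fin k))) (t := univ)
    (f := fun p => I.scope p.1 p.2) (fun _ _ => mem_coe.2 (mem_univ _))
  rw [card_univ, Fintype.card_prod, Fintype.card_fin, Fintype.card_fin] at this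
  rw [this]
  rfl

theorem sum_degG (I : CSPInstance 𝓕 n m) (G : Finset (Copy m P × Fin k)) :
    ∑ v, degG I G v = #G :=
  (card_eq_sum_card_fiberwise (s := G) (t := univ) (f := fun p : Copy m P × Fin k => I.scope p.1.1 p.2)
    (fun _ _ => mem_coe.2 (mem_univ _))).symm

/-- The contribution of the variables with hash value `0` to the space bound. -/
def hashWeight (I : CSPInstance 𝓕 n m) (H : Fin n → Fin P.N) : ℕ :=
  ∑ v, if (H v : ℕ) = 0 then 1 + (P.B + 1) * I.deg v else 0

theorem card_copies_le (U : Finset (Fin n)) (d : Fin n → ℕ) : #(copies U d) ≤ ∑ v ∈ U, d v := by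
  refine card_biUnion_le.trans (Finset.sum_le_sum fun v _ => ?_)
  exact card_image_le.trans (card_range _).le

/-- A copy in `F` is charged to a pair of `G` or to one of `B` copies of an incidence of hash value
zero. Low-degree copies are charged to such incidences as well, and the created high-degree copies
of `v` to `4 * degG I Gt v`. -/
theorem streamSpace_le (I : CSPInstance 𝓕 n m) (H : Fin n → Fin P.N)
    (Gt : Finset (Copy m P × Fin k)) (C : Finset (Copy m P)) (K : Fin n → Finset ℕ)
    (G : Finset (Copy m P × Fin k)) (a : Copy m P × Fin k → Option ℕ)
    (hthr : 0 ≤ P.thr) (hN : 1 ≤ P.N) (hB : 1 ≤ P.B) (hK : GoodSlices I Gt K) :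
    streamSpace I H Gt C K G a ≤ hashWeight I H + 2 * #G + 5 * #Gt + #C := by
  classical
  have hS : #({v | (H v : ℕ) = 0 ∧ ∃ i t, I.scope i t = v} : Finset (Fin n)) ≤
      ∑ v : Fin n, if (H v : ℕ) = 0 then 1 else 0 := by
    rw [← card_filter]
    exact card_le_card fun v hv => by
      simp only [mem_filter, mem_univ, true_and] at hv ⊢; exact hv.1
  set Q := ∑ v : Fin n, if (H v : ℕ) = 0 then I.deg v else 0 with hQ
  have hQ' : #{p : Fin m × Fin k | (H (I.scope p.1 p.2) : ℕ) = 0} = Q := by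
    rw [card_eq_sum_card_fiberwise (t := univ) (f := fun p : Fin m × Fin k => I.scope p.1 p.2)
      (fun _ _ => mem_coe.2 (mem_univ _)), hQ]
    refine Finset.sum_congr rfl fun v _ => ?_
    rw [filter_filter]
    split_ifs with hv
    · rw [CSPInstance.deg]
      congr 1
      ext p
      simp only [mem_filter, mem_univ, true_and]
      exact ⟨fun h => h.2, fun h => ⟨by rw [h]; exact hv, h⟩⟩
    · rw [card_eq_zero, filter_eq_empty_iff]
      rintro p - ⟨h1, h2⟩
      rw [h2] at h1
      exact hv h1
  have hF : #({e | ∃ t, (H (I.scope e.1 t) : ℕ) = 0 ∨ (e, t) ∈ G} : Finset (Copy m P)) ≤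
      #G + Q * P.B := by
    have hsub : ({e | ∃ t, (H (I.scope e.1 t) : ℕ) = 0 ∨ (e, t) ∈ G} : Finset (Copy m P)) ⊆
        G.image Prod.fst ∪ ((({p | (H (I.scope p.1 p.2) : ℕ) = 0} : Finset (Fin m × Fin k)) ×ˢ
          (univ : Finset (Fin P.B))).image fun q => (q.1.1, q.2)) := by
      intro e he
      obtain ⟨t, h | h⟩ := (mem_filter.1 he).2
      · refine mem_union_right _ (mem_image.2 ⟨((e.1, t), e.2), ?_, rfl⟩)
        simpa using h
      · exact mem_union_left _ (mem_image.2 ⟨(e, t), h, rfl⟩)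
    refine (card_le_card hsub).trans ((card_union_le _ _).trans (add_le_add card_image_le ?_))
    refine card_image_le.trans ?_
    rw [card_product, hQ', card_univ, Fintype.card_fin]
  have hcopy : ∀ v ∈ tierG I Gt G, copyCount I Gt G K v ≤ 4 * degG I Gt v := by
    intro v hv
    have hv' : v ∈ tier I Gt := by
      unfold tierG at hv
      exact (mem_filter.1 hv).2.1
    have h1 := (hK v hv').2
    have hthr' : P.thr < degG I Gt v := by
      unfold tier at hv'
      exact (mem_filter.1 hv').2
    have hN' : (1 : ℝ) ≤ P.N := by exact_mod_cast hN
    have hB' : (1 : ℝ) ≤ P.B := by exact_mod_cast hB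
    have hX : (1 : ℝ) ≤ degG I Gt v := by
      have : 0 < degG I Gt v := by exact_mod_cast hthr.trans_lt hthr'
      exact_mod_cast this
    have h2 : (estDeg I Gt v : ℝ) ≤ degG I Gt v * P.N / P.B + 1 :=
      (Nat.ceil_lt_add_one (by positivity)).le
    have h3 : (degG I Gt v : ℝ) * P.N / P.B ≤ degG I Gt v * P.N :=
      div_le_self (by positivity) hB'
    have h4 : (estDeg I Gt v : ℝ) ≤ 2 * (degG I Gt v * P.N) := by nlinarith
    rw [copyCount, if_pos hv]
    have h5 : (#(K v) : ℝ) ≤ 4 * degG I Gt v := by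
      refine h1.trans ?_
      calc (estDeg I Gt v : ℝ) * (2 / P.N) ≤ 2 * (degG I Gt v * P.N) * (2 / P.N) := by gcongr
        _ = 4 * degG I Gt v := by field_simp; norm_num
    exact_mod_cast h5
  have hV : #(streamSample I H Gt C K G a).vars ≤ Q + 4 * #Gt := by
    refine (card_union_le _ _).trans (add_le_add ?_ ?_)
    · refine (card_copies_le _ _).trans ?_
      exact Finset.sum_le_sum_of_subset (subset_univ _)
    · refine (card_copies_le _ _).trans ((Finset.sum_le_sum hcopy).trans ?_)
      rw [← Finset.mul_sum, ← sum_degG I Gt]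
      exact Nat.mul_le_mul_left _ (Finset.sum_le_sum_of_subset (subset_univ _))
  have hW : hashWeight I H = (∑ v : Fin n, if (H v : ℕ) = 0 then 1 else 0) + (P.B + 1) * Q := by
    rw [hashWeight, hQ, Finset.mul_sum, ← Finset.sum_add_distrib]
    refine Finset.sum_congr rfl fun v _ => ?_
    split_ifs <;> simp
  unfold streamSpace
  rw [hW]
  have : (P.B + 1) * Q = Q * P.B + Q := by ring
  omega

/-- Markov's inequality with the one-variable marginals of the hash law; the degrees sum to `m * k`.
-/
theorem hashWeight_tail (I : CSPInstance 𝓕 n m) (hash : PMF (Fin n → Fin P.N)) {t : ℕ}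
    (hash_indep : KWiseIndep hash t) (ht : 1 ≤ t) (hN : 1 ≤ P.N) {θ : ℝ} (hθ : 0 < θ) :
    hash.toOuterMeasure {H | θ < hashWeight I H} ≤
      ENNReal.ofReal ((n + (P.B + 1) * (m * k)) / P.N / θ) := by
  classical
  have hN' : (0 : ℝ) < P.N := by exact_mod_cast hN
  have hprob : ∀ v, hash.toOuterMeasure {H | (H v : ℕ) = 0} = (P.N : ℝ≥0∞)⁻¹ := by
    intro v
    have := hash_indep {v} (by simpa using ht) fun _ => ⟨0, hN⟩
    rw [card_singleton, pow_one] at this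
    rw [← this]
    congr 1
    ext H
    rw [Set.mem_ofPred_eq, Set.mem_ofPred_eq]
    constructor
    · intro h v' hv'
      rw [mem_singleton.1 hv']
      exact Fin.ext h
    · intro h
      rw [h v (mem_singleton_self v)]
  have h := markov_weighted_count hash (univ : Finset (Fin n))
    (fun v => ((1 + (P.B + 1) * I.deg v : ℕ) : ℝ≥0∞)) (fun v => {H | (H v : ℕ) = 0})
    (ENNReal.ofReal θ) (by simpa using hθ) ENNReal.ofReal_ne_top
  refine le_trans (le_trans (le_of_eq ?_) h) (le_of_eq ?_)
  · congr 1
    ext H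
    have hw : (∑ v, {H : Fin n → Fin P.N | (H v : ℕ) = 0}.indicator
        (fun _ => ((1 + (P.B + 1) * I.deg v : ℕ) : ℝ≥0∞)) H) = (hashWeight I H : ℝ≥0∞) := by
      rw [hashWeight, Nat.cast_sum]
      refine Finset.sum_congr rfl fun v _ => ?_
      by_cases hv : (H v : ℕ) = 0 <;> simp [hv]
    rw [Set.mem_ofPred_eq, Set.mem_ofPred_eq, hw, ← ENNReal.ofReal_natCast,
      ENNReal.ofReal_lt_ofReal_iff_of_nonneg hθ.le]
  · simp only [hprob]
    rw [← Finset.sum_mul, ← Nat.cast_sum, Finset.sum_add_distrib, ← Finset.mul_sum, sum_deg,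
      ENNReal.ofReal_div_of_pos hθ, ENNReal.ofReal_div_of_pos hN', ENNReal.ofReal_natCast]
    simp only [sum_const, card_univ, Fintype.card_fin, smul_eq_mul, mul_one]
    rw [← div_eq_mul_inv, ← ENNReal.ofReal_natCast (n + (P.B + 1) * (m * k))]
    push_cast
    rfl

/-- An acceptance probability exceeds one exactly when `#(K v)` exceeds twice its mean, so the upper
tail with `y = 1` applies. -/
theorem goodSlices_tail (I : CSPInstance 𝓕 n m) (Gt : Finset (Copy m P × Fin k)) (hN : 1 ≤ P.N)
    {b : ℝ} (hb : ∀ v ∈ tier I Gt, b ≤ estDeg I Gt v / P.N) :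
    (sliceLaw (tier I Gt) (estDeg I Gt) (1 / P.N)).toOuterMeasure {K | ¬ GoodSlices I Gt K} ≤
      n * ENNReal.ofReal (Real.exp (-(1 / 6 * b))) := by
  classical
  have hN' : (1 : ℝ) ≤ P.N := by exact_mod_cast hN
  let E : Fin n → Set (Finset ℕ) := fun v =>
    {K | v ∈ tier I Gt ∧ ¬ (K ⊆ range (estDeg I Gt v) ∧ (#K : ℝ) ≤ estDeg I Gt v * (2 / P.N))}
  have hE : {K | ¬ GoodSlices I Gt K} = {K | ∃ v, K ∈ {K : Fin n → Finset ℕ | K v ∈ E v}} := by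
    ext K
    simp only [GoodSlices, Set.mem_ofPred_eq, not_forall, E, exists_prop]
  rw [hE]
  refine (union_bound _ _ (ENNReal.ofReal (Real.exp (-(1 / 6 * b)))) fun v => ?_).trans
    (by rw [Fintype.card_fin])
  refine (indep_toOuterMeasure_eval_le _ v (E v)).trans ?_
  by_cases hv : v ∈ tier I Gt
  · rw [if_pos hv]
    have htail := randomSubset_upper_tail (range (estDeg I Gt v)) (fun _ => True)
      (p := 1 / P.N) (y := 1) (a := estDeg I Gt v / P.N) (by positivity)
      (by rw [div_le_one (by linarith)]; exact hN') one_pos le_rfl (by positivity)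
      (le_of_eq (by simp [div_eq_mul_inv, mul_comm]))
    refine le_trans (PMF.toOuterMeasure_mono _ ?_) (htail.trans ?_)
    · rintro K ⟨⟨-, hK⟩, hs⟩
      have hsub : K ⊆ range (estDeg I Gt v) := by
        by_contra hsub
        rw [PMF.mem_support_iff, randomSubset_apply, if_neg hsub] at hs
        exact hs rfl
      have hlt := not_le.1 fun hle => hK ⟨hsub, hle⟩
      rw [Set.mem_ofPred_eq, filter_true]
      have h2 : (1 + 1) * ((estDeg I Gt v : ℝ) / P.N) = estDeg I Gt v * (2 / P.N) := by ring
      rw [h2]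
      exact hlt
    · refine ENNReal.ofReal_le_ofReal (Real.exp_le_exp.2 ?_)
      have := hb v hv
      linarith
  · have : E v = ∅ := by
      ext K
      simp [E, hv]
    rw [this]
    simp

/-- The expected number of pairs that refer to `v` in a sample of rate `1 / N`. -/
def meanDeg (I : CSPInstance 𝓕 n m) (P : Params) (v : Fin n) : ℝ := P.B * I.deg v / P.N

theorem rate_mul_card (I : CSPInstance 𝓕 n m) (P : Params) (c : ℝ) (v : Fin n) :
    (c / P.N : ℝ) * #{p ∈ (univ : Finset (Copy m P × Fin k)) | I.scope p.1.1 p.2 = v} =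
      c * meanDeg I P v := by
  rw [card_copy_positions I P v, meanDeg]
  push_cast
  ring

theorem degG_upper_tail (I : CSPInstance 𝓕 n m) {c y a : ℝ} (hc : 0 ≤ c) (hc1 : c / P.N ≤ 1)
    (hy : 0 < y) (hy1 : y ≤ 1) (ha : 0 ≤ a) (v : Fin n) (h : c * meanDeg I P v ≤ a) :
    (randomSubset (univ : Finset (Copy m P × Fin k)) (c / P.N)).toOuterMeasure
      {G | (1 + y) * a < degG I G v} ≤ ENNReal.ofReal (Real.exp (-(y ^ 2 / 6 * a))) :=
  randomSubset_upper_tail univ (fun p : Copy m P × Fin k => I.scope p.1.1 p.2 = v)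
    (by positivity) hc1 hy hy1 ha (by rw [rate_mul_card]; exact h)

theorem degG_lower_tail (I : CSPInstance 𝓕 n m) {c y a : ℝ} (hc : 0 ≤ c) (hc1 : c / P.N ≤ 1)
    (hy : 0 < y) (hy1 : y ≤ 1) (v : Fin n) (h : a ≤ c * meanDeg I P v) :
    (randomSubset (univ : Finset (Copy m P × Fin k)) (c / P.N)).toOuterMeasure
      {G | degG I G v < (1 - y) * (c * meanDeg I P v)} ≤
        ENNReal.ofReal (Real.exp (-(y ^ 2 / 6 * a))) := by
  rw [← rate_mul_card]
  exact randomSubset_lower_tail univ (fun p : Copy m P × Fin k => I.scope p.1.1 p.2 = v)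
    (by positivity) hc1 hy hy1 (by rw [rate_mul_card]; exact h)

theorem card_upper_tail {c a : ℝ} (hc : 0 ≤ c) (hc1 : c / P.N ≤ 1) (ha : 0 ≤ a)
    (h : c * (P.B * (m * k) / P.N) ≤ a) :
    (randomSubset (univ : Finset (Copy m P × Fin k)) (c / P.N)).toOuterMeasure
      {G | 2 * a < #G} ≤ ENNReal.ofReal (Real.exp (-(1 / 6 * a))) := by
  have := randomSubset_upper_tail (univ : Finset (Copy m P × Fin k)) (fun _ => True)
    (p := c / P.N) (by positivity) hc1 one_pos le_rfl ha (by
      rw [filter_true, card_univ]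
      simp only [Fintype.card_prod, Fintype.card_fin]
      push_cast
      refine le_trans (le_of_eq ?_) h
      ring)
  simp only [filter_true, one_pow, one_add_one_eq_two] at this
  exact this

/-- The event that the set `G̃` misjudges the degree of `v`. -/
def Misjudged (I : CSPInstance 𝓕 n m) (η : ℝ) (Gt : Finset (Copy m P × Fin k)) (v : Fin n) :
    Prop :=
  (meanDeg I P v ≤ P.thr / 2 ∧ P.thr < degG I Gt v) ∨
    (P.thr / 2 ≤ meanDeg I P v ∧ (degG I Gt v : ℝ) < (1 - η / 4) * meanDeg I P v) ∨
    (P.thr / 2 ≤ meanDeg I P v ∧ (1 + η / 4) * meanDeg I P v < degG I Gt v)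

/-- The event that the set `G̃` misjudges a degree or is too large. -/
def BadTier (I : CSPInstance 𝓕 n m) (η a : ℝ) (Gt : Finset (Copy m P × Fin k)) : Prop :=
  (∃ v, Misjudged I η Gt v) ∨ 2 * a < #Gt

/-- The weakest of the three exponents comes from relative error `η/4` at mean `thr/2`: it is
`(η/4)² / 6 · thr/2 = η²/192 · thr`. -/
theorem misjudged_tail (I : CSPInstance 𝓕 n m) {η κ : ℝ} (hη : 0 < η) (hη1 : η < 1)
    (hN : 1 ≤ P.N) (hthr : 0 ≤ P.thr) (hκ : κ ≤ η ^ 2 / 192) (v : Fin n) :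
    (randomSubset (univ : Finset (Copy m P × Fin k)) (1 / P.N)).toOuterMeasure
      {Gt | Misjudged I η Gt v} ≤ 3 * ENNReal.ofReal (Real.exp (-(κ * P.thr))) := by
  have hN' : (1 : ℝ) ≤ P.N := by exact_mod_cast hN
  have hp1 : (1 : ℝ) / P.N ≤ 1 := by rw [div_le_one (by linarith)]; exact hN'
  have hexp : ∀ {c : ℝ}, κ * P.thr ≤ c → ENNReal.ofReal (Real.exp (-c)) ≤
      ENNReal.ofReal (Real.exp (-(κ * P.thr))) := fun h =>
    ENNReal.ofReal_le_ofReal (Real.exp_le_exp.2 (by linarith))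
  have hκ1 : κ * P.thr ≤ η ^ 2 / 192 * P.thr := mul_le_mul_of_nonneg_right hκ hthr
  have hη2 : η ^ 2 ≤ 1 := by nlinarith
  have hη3 : η ^ 2 / 192 * P.thr ≤ 1 / 192 * P.thr := by gcongr
  have e1 : (randomSubset (univ : Finset (Copy m P × Fin k)) (1 / P.N)).toOuterMeasure
      {Gt | meanDeg I P v ≤ P.thr / 2 ∧ P.thr < degG I Gt v} ≤
      ENNReal.ofReal (Real.exp (-(κ * P.thr))) := by
    by_cases h : meanDeg I P v ≤ P.thr / 2
    · have ht := degG_upper_tail I zero_le_one hp1 one_pos le_rfl (a := P.thr / 2)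
        (by positivity) v (by linarith)
      refine le_trans (MeasureTheory.measure_mono ?_) (ht.trans (hexp ?_))
      · rintro Gt ⟨-, hGt⟩
        rw [Set.mem_ofPred_eq]
        linarith
      · linarith
    · simp [h]
  have e2 : (randomSubset (univ : Finset (Copy m P × Fin k)) (1 / P.N)).toOuterMeasure
      {Gt | P.thr / 2 ≤ meanDeg I P v ∧ (degG I Gt v : ℝ) < (1 - η / 4) * meanDeg I P v} ≤
      ENNReal.ofReal (Real.exp (-(κ * P.thr))) := by
    by_cases h : P.thr / 2 ≤ meanDeg I P v
    · have ht := degG_lower_tail I zero_le_one hp1 (y := η / 4) (by positivity) (by linarith)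
        (a := P.thr / 2) v (by linarith)
      refine le_trans (MeasureTheory.measure_mono ?_) (ht.trans (hexp ?_))
      · rintro Gt ⟨-, hGt⟩
        rw [Set.mem_ofPred_eq, one_mul]
        exact hGt
      · linarith
    · simp [h]
  have e3 : (randomSubset (univ : Finset (Copy m P × Fin k)) (1 / P.N)).toOuterMeasure
      {Gt | P.thr / 2 ≤ meanDeg I P v ∧ (1 + η / 4) * meanDeg I P v < degG I Gt v} ≤
      ENNReal.ofReal (Real.exp (-(κ * P.thr))) := by
    by_cases h : P.thr / 2 ≤ meanDeg I P v
    · have ht := degG_upper_tail I zero_le_one hp1 (y := η / 4) (by positivity) (by linarith)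
        (a := meanDeg I P v) (by linarith) v (by linarith)
      refine le_trans (MeasureTheory.measure_mono ?_) (ht.trans (hexp ?_))
      · rintro Gt ⟨-, hGt⟩
        exact hGt
      · have h0 : 0 ≤ (η / 4) ^ 2 / 6 := by positivity
        have := mul_le_mul_of_nonneg_left h h0
        linarith
    · simp [h]
  refine (toOuterMeasure_or_le _ _ _).trans ((add_le_add e1
    ((toOuterMeasure_or_le _ _ _).trans (add_le_add e2 e3))).trans (le_of_eq ?_))
  ring

theorem badTier_tail (I : CSPInstance 𝓕 n m) {η a κ : ℝ} (hη : 0 < η) (hη1 : η < 1) (ha : 0 ≤ a)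
    (hN : 1 ≤ P.N) (hthr : 0 ≤ P.thr) (hκ : κ ≤ η ^ 2 / 192)
    (hsize : (P.B * (m * k) : ℝ) / P.N ≤ a) :
    (randomSubset (univ : Finset (Copy m P × Fin k)) (1 / P.N)).toOuterMeasure
      {Gt | BadTier I η a Gt} ≤
      n * (3 * ENNReal.ofReal (Real.exp (-(κ * P.thr)))) +
        ENNReal.ofReal (Real.exp (-(1 / 6 * a))) := by
  have hN' : (1 : ℝ) ≤ P.N := by exact_mod_cast hN
  have hp1 : (1 : ℝ) / P.N ≤ 1 := by rw [div_le_one (by linarith)]; exact hN'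
  refine (toOuterMeasure_or_le _ _ _).trans (add_le_add ?_ ?_)
  · refine (union_bound _ (fun v => {Gt | Misjudged I η Gt v}) _ fun v =>
      misjudged_tail I hη hη1 hN hthr hκ v).trans_eq (by rw [Fintype.card_fin])
  · exact card_upper_tail zero_le_one hp1 ha (by linarith)

/-- The event that the set `G` misses a high-degree variable or is too large. -/
def BadPairs (I : CSPInstance 𝓕 n m) (a : ℝ) (G : Finset (Copy m P × Fin k)) : Prop :=
  (∃ v, P.thr / 2 ≤ meanDeg I P v ∧ degG I G v = 0) ∨ 4 * a < #G

theorem badPairs_tail (I : CSPInstance 𝓕 n m) {a κ : ℝ} (ha : 0 ≤ a) (hN : 2 ≤ P.N)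
    (hthr : 0 < P.thr) (hκ : κ ≤ 1 / 192) (hsize : (P.B * (m * k) : ℝ) / P.N ≤ a) :
    (randomSubset (univ : Finset (Copy m P × Fin k)) (2 / P.N)).toOuterMeasure
      {G | BadPairs I a G} ≤
      n * ENNReal.ofReal (Real.exp (-(κ * P.thr))) +
        ENNReal.ofReal (Real.exp (-(1 / 6 * a))) := by
  have hN' : (2 : ℝ) ≤ P.N := by exact_mod_cast hN
  have hp1 : (2 : ℝ) / P.N ≤ 1 := by rw [div_le_one (by linarith)]; exact hN'
  have hκ1 : κ * P.thr ≤ 1 / 192 * P.thr := mul_le_mul_of_nonneg_right hκ hthr.le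
  refine (toOuterMeasure_or_le _ _ _).trans (add_le_add ?_ ?_)
  · refine (union_bound _ (fun v => {G | P.thr / 2 ≤ meanDeg I P v ∧ degG I G v = 0}) _
      fun v => ?_).trans_eq (by rw [Fintype.card_fin])
    by_cases h : P.thr / 2 ≤ meanDeg I P v
    -- At rate `2/N` the mean is `2 * meanDeg`, hence at least `thr`. An empty count lies below half
    -- of it.
    · have ht := degG_lower_tail I zero_le_two hp1 (y := 1 / 2) (by norm_num) (by norm_num)
        (a := P.thr) v (by linarith)
      refine le_trans (MeasureTheory.measure_mono ?_) (ht.trans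
        (ENNReal.ofReal_le_ofReal (Real.exp_le_exp.2 ?_)))
      · rintro G ⟨-, hG⟩
        rw [Set.mem_ofPred_eq, hG, Nat.cast_zero]
        linarith
      · linarith
    · simp [h]
  · have ht := card_upper_tail (m := m) (k := k) zero_le_two hp1 (a := 2 * a) (by positivity)
      (by linarith)
    refine le_trans (MeasureTheory.measure_mono ?_) (ht.trans
      (ENNReal.ofReal_le_ofReal (Real.exp_le_exp.2 (by linarith))))
    intro G hG
    have : 4 * a < #G := hG
    rw [Set.mem_ofPred_eq]
    linarith

end Events

/-! ### The adversary and the coupling -/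

section Adversary

variable {k : ℕ} {A : Type*} {𝓕 : Set ((Fin k → A) → Bool)} {n m : ℕ} {P : Params}

open Classical in
/-- The values `d̃` picked by the adversary that simulates the set `G̃`. -/
def advDeg (I : CSPInstance 𝓕 n m) (η a : ℝ) (Gt : Finset (Copy m P × Fin k)) (v : Fin n) : ℕ :=
  if BadTier I η a Gt then I.deg v
  else if v ∈ tier I Gt then estDeg I Gt v
  else min (I.deg v) ⌊P.thr * P.N / P.B⌋₊

theorem mem_tier {I : CSPInstance 𝓕 n m} {Gt : Finset (Copy m P × Fin k)} {v : Fin n} :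
    v ∈ tier I Gt ↔ P.thr < degG I Gt v := by
  simp [tier]

theorem lt_estDeg (hN : 1 ≤ P.N) (hB : 1 ≤ P.B) {I : CSPInstance 𝓕 n m}
    {Gt : Finset (Copy m P × Fin k)} {v : Fin n} (hv : v ∈ tier I Gt) :
    P.thr * P.N / P.B < estDeg I Gt v := by
  have hN' : (0 : ℝ) < P.N := by exact_mod_cast hN
  have hB' : (0 : ℝ) < P.B := by exact_mod_cast hB
  have h := mem_tier.1 hv
  refine lt_of_lt_of_le ?_ (Nat.le_ceil _)
  gcongr

/-- High estimates exceed `thr * N / B` strictly because rounding goes up; all other answers are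
capped by the floor of that threshold. -/
theorem offTier_advDeg (hN : 1 ≤ P.N) (hB : 1 ≤ P.B) (hthr : 0 ≤ P.thr) (I : CSPInstance 𝓕 n m)
    {η a : ℝ} {Gt : Finset (Copy m P × Fin k)} (hGt : ¬ BadTier I η a Gt) :
    offTier P (advDeg I η a Gt) = tier I Gt := by
  ext v
  simp only [offTier, mem_filter, mem_univ, true_and, advDeg, if_neg hGt, not_le]
  split_ifs with hv
  · exact iff_of_true (lt_estDeg hN hB hv) hv
  · refine iff_of_false (not_lt.2 ?_) hv
    have h : ((min (I.deg v) ⌊P.thr * P.N / P.B⌋₊ : ℕ) : ℝ) ≤ (⌊P.thr * P.N / P.B⌋₊ : ℕ) := by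
      exact_mod_cast min_le_right _ _
    exact h.trans (Nat.floor_le (by positivity))

/-- Only a variable with `deg` above the threshold `D` but declared low needs its answer pushed
down. Its true mean is then at least `thr` while its count is at most `thr`, so the lower deviation
bound gives `(1 - η/4) deg ≤ D`. The cap at the floor of `D` is therefore admissible. -/
theorem validAdversary_advDeg (hN : 1 ≤ P.N) (hB : 1 ≤ P.B) (hthr : 0 ≤ P.thr)
    (I : CSPInstance 𝓕 n m) {η : ℝ} (a : ℝ) (hη : 0 < η) (hη1 : η < 1)
    (hlarge : 4 ≤ η * (P.thr * P.N / P.B)) (p : PMF (Finset (Copy m P × Fin k))) :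
    ValidAdversary I η (p.map (advDeg I η a)) := by
  intro d hd v
  obtain ⟨Gt, -, rfl⟩ := (PMF.mem_support_map_iff _ _ _).1 hd
  have hN' : (0 : ℝ) < P.N := by exact_mod_cast hN
  have hB' : (0 : ℝ) < P.B := by exact_mod_cast hB
  have hdeg0 : (0 : ℝ) ≤ I.deg v := Nat.cast_nonneg _
  have hηdeg : 0 ≤ η * I.deg v := by positivity
  set D := P.thr * P.N / P.B with hD
  have hD0 : 0 ≤ D := by positivity
  have hmean : ∀ c : ℝ, c * meanDeg I P v * P.N / P.B = c * I.deg v := by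
    intro c; rw [meanDeg]; field_simp
  have hdegD : P.thr / 2 ≤ meanDeg I P v → D / 2 ≤ I.deg v := by
    intro h
    have : P.thr / 2 * P.N / P.B ≤ 1 * meanDeg I P v * P.N / P.B := by rw [one_mul]; gcongr
    rw [hmean, one_mul] at this
    refine le_trans (le_of_eq ?_) this
    rw [hD]; ring
  unfold advDeg
  by_cases hGt : BadTier I η a Gt
  · rw [if_pos hGt]
    constructor <;> nlinarith
  rw [if_neg hGt]
  have hgood : ¬ Misjudged I η Gt v := fun h => hGt (Or.inl ⟨v, h⟩)
  unfold Misjudged at hgood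
  push Not at hgood
  obtain ⟨h1, h2, h3⟩ := hgood
  by_cases hv : v ∈ tier I Gt
  · rw [if_pos hv]
    have hX := mem_tier.1 hv
    have hmu : P.thr / 2 ≤ meanDeg I P v := by
      by_contra h
      exact absurd (h1 (le_of_lt (not_le.1 h))) (not_le.2 hX)
    have hdeg := hdegD hmu
    -- From `η D ≥ 4` and `deg ≥ D/2`; this slack absorbs the `+1` of the ceiling.
    have hη2 : 2 ≤ η * I.deg v := by nlinarith
    have hlow : (1 - η / 4) * I.deg v ≤ (degG I Gt v : ℝ) * P.N / P.B := by
      rw [← hmean]; gcongr; exact h2 hmu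
    have hup : (degG I Gt v : ℝ) * P.N / P.B ≤ (1 + η / 4) * I.deg v := by
      rw [← hmean]; gcongr; exact h3 hmu
    have hc1 : (degG I Gt v : ℝ) * P.N / P.B ≤ estDeg I Gt v := Nat.le_ceil _
    have hc2 : (estDeg I Gt v : ℝ) ≤ degG I Gt v * P.N / P.B + 1 :=
      (Nat.ceil_lt_add_one (by positivity)).le
    constructor <;> nlinarith
  · rw [if_neg hv]
    have hX : (degG I Gt v : ℝ) ≤ P.thr := not_lt.1 fun h => hv (mem_tier.2 h)
    rcases le_or_gt (I.deg v) ⌊D⌋₊ with hle | hlt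
    · rw [min_eq_left hle]
      constructor <;> nlinarith
    · rw [min_eq_right hlt.le]
      have hDlt : D < I.deg v := (Nat.floor_lt hD0).1 hlt
      have hmu : P.thr / 2 ≤ meanDeg I P v := by
        have h4 : P.thr ≤ meanDeg I P v := by
          have h5 : D * P.B / P.N ≤ I.deg v * P.B / P.N := by gcongr
          have h6 : D * P.B / P.N = P.thr := by rw [hD]; field_simp
          rw [h6] at h5
          refine h5.trans (le_of_eq ?_)
          rw [meanDeg]; ring
        linarith
      have hlow : (1 - η / 4) * I.deg v ≤ D := by
        rw [← hmean, hD]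
        gcongr
        exact (h2 hmu).trans hX
      have hfl : D < (⌊D⌋₊ : ℝ) + 1 := Nat.lt_floor_add_one _
      have hltR : ((⌊D⌋₊ : ℕ) : ℝ) ≤ I.deg v := by exact_mod_cast hlt.le
      -- Here `deg > D`, so the unit lost to the floor costs at most a further `η/4` of the degree.
      have hη4 : 4 ≤ η * I.deg v := hlarge.trans (by gcongr)
      constructor <;> nlinarith

/-- The coefficient `5` collects three tails for `G̃`, one for the slices and one for pairs missing
from `G`; the `2` collects the sizes of `G̃` and `G`. In the space condition, `18 = 5 · 2 + 2 · 4`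
from `#Gt ≤ 2a` and `#G ≤ 4a`. -/
theorem exists_coupling_estimators (hk : 1 ≤ k) (I : CSPInstance 𝓕 n m)
    (loc : NbhdClass 𝓕 → Set.Icc (0 : ℝ) 1) (hash : PMF (Fin n → Fin P.N)) {t : ℕ}
    (hash_indep : KWiseIndep hash t) (ht : 1 ≤ t) (hN : 2 ≤ P.N) (hB : 1 ≤ P.B)
    (hthr : 0 < P.thr) {η a θ κ : ℝ} (hη : 0 < η) (hη1 : η < 1) (ha : 0 ≤ a) (hθ : 0 < θ)
    (hlarge : 4 ≤ η * (P.thr * P.N / P.B)) (hκ : κ ≤ η ^ 2 / 192 / P.B)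
    (hsize : (P.B * (m * k) : ℝ) / P.N ≤ a) (hcap : θ + 18 * a + P.size ≤ P.cap) :
    ∃ adv : PMF (Fin n → ℕ), ValidAdversary I η adv ∧
      Coup (streamingEstimator I P loc hash) (offlineEstimator I P loc hash adv)
        (fun o z => ∃ s out, o = some (s, out) ∧ Agree s z.1 ∧ out = z.2)
        (ENNReal.ofReal (5 * (n * Real.exp (-(κ * P.thr))) + 2 * Real.exp (-(1 / 6 * a)) +
          (n + (P.B + 1) * (m * k)) / P.N / θ)) := by
  have hB' : (1 : ℝ) ≤ P.B := by exact_mod_cast hB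
  have hN1 : 1 ≤ P.N := by omega
  have hN' : (0 : ℝ) < P.N := by exact_mod_cast hN1
  have hη2 : η ^ 2 ≤ 1 := by nlinarith
  have hκ1 : κ ≤ η ^ 2 / 192 := hκ.trans (div_le_self (by positivity) hB')
  refine ⟨_, validAdversary_advDeg hN1 hB hthr.le I a hη hη1 hlarge
    (randomSubset (univ : Finset (Copy m P × Fin k)) (1 / P.N)), ?_⟩
  have hcoup := coup_estimators hk I loc hash hN (advDeg I η a) {Gt | BadTier I η a Gt}
    {G | BadPairs I a G} {H | θ < hashWeight I H}
    (n * ENNReal.ofReal (Real.exp (-(κ * P.thr))))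
    (fun Gt hGt => offTier_advDeg hN1 hB hthr.le I hGt)
    (fun Gt hGt v hv => ⟨by
      rw [advDeg, if_neg (show ¬ BadTier I η a Gt from hGt), if_pos hv], by
      have h1 := lt_estDeg hN1 hB hv
      have h2 : (0 : ℝ) < estDeg I Gt v := lt_of_le_of_lt (by positivity) h1
      exact_mod_cast h2⟩)
    (fun Gt hGt => by
      -- The mean size of a slice exceeds `thr / B`; this is the reason for dividing by `B` in the
      -- bound on `κ`.
      refine (goodSlices_tail I Gt hN1 (b := P.thr / P.B) fun v hv => ?_).trans ?_
      · rw [le_div_iff₀ hN', div_mul_eq_mul_div]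
        exact (lt_estDeg hN1 hB hv).le
      · refine mul_le_mul_right (ENNReal.ofReal_le_ofReal (Real.exp_le_exp.2 ?_)) _
        have h1 : κ * P.thr ≤ η ^ 2 / 192 / P.B * P.thr := by gcongr
        have h2 : η ^ 2 / 192 / P.B * P.thr ≤ 1 / 192 / P.B * P.thr := by gcongr
        have h3 : 0 ≤ P.thr / P.B := by positivity
        have h4 : 1 / 192 / (P.B : ℝ) * P.thr = 1 / 192 * (P.thr / P.B) := by ring
        linarith)
    (fun Gt hGt G hG => by
      ext v
      simp only [tierG, mem_filter, mem_univ, true_and, and_iff_left_iff_imp]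
      intro hv
      refine Nat.pos_of_ne_zero fun h0 => hG (Or.inl ⟨v, ?_, h0⟩)
      by_contra h
      exact hGt (Or.inl ⟨v, Or.inl ⟨(not_le.1 h).le, mem_tier.1 hv⟩⟩))
    (fun Gt hGt H hH C hC K hK G hG b => by
      have h1 : (#Gt : ℝ) ≤ 2 * a := not_lt.1 fun h => hGt (Or.inr h)
      have h2 : (#G : ℝ) ≤ 4 * a := not_lt.1 fun h => hG (Or.inr h)
      have h3 : (hashWeight I H : ℝ) ≤ θ := not_lt.1 hH
      have h4 : (#C : ℝ) ≤ P.size := by exact_mod_cast hC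
      have h5 : (streamSpace I H Gt C K G b : ℝ) ≤
          hashWeight I H + 2 * #G + 5 * #Gt + #C := by
        exact_mod_cast streamSpace_le I H Gt C K G b hthr.le hN1 hB hK
      linarith)
  refine hcoup.mono ?_
  have b1 := badTier_tail I hη hη1 ha hN1 hthr.le hκ1 hsize
  have b2 := badPairs_tail I ha hN hthr (hκ1.trans (by linarith)) hsize
  have b3 := hashWeight_tail I hash hash_indep ht hN1 hθ
  refine (add_le_add b1 (add_le_add b3 (add_le_add le_rfl b2))).trans (le_of_eq ?_)
  rw [ENNReal.ofReal_add (by positivity) (by positivity),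
    ENNReal.ofReal_add (by positivity) (by positivity), ENNReal.ofReal_mul (by norm_num),
    ENNReal.ofReal_mul (by norm_num), ENNReal.ofReal_mul (by positivity), ENNReal.ofReal_natCast,
    ENNReal.ofReal_ofNat, ENNReal.ofReal_ofNat]
  ring

theorem Coup.lt_toReal {α β : Type} {p : PMF α} {q : PMF β} {R : α → β → Prop} {x y : ℝ}
    (h : Coup p q R (ENNReal.ofReal x)) (hx : 0 ≤ x) (hxy : x < y) :
    ∃ μ : PMF (α × β), IsCoupling μ p q ∧
      1 - y < (μ.toOuterMeasure {z | R z.1 z.2}).toReal := by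
  obtain ⟨μ, hμ, hR⟩ := h
  refine ⟨μ, hμ, ?_⟩
  have h1 : (μ.toOuterMeasure {z | R z.1 z.2}ᶜ).toReal ≤ x :=
    ENNReal.toReal_le_of_le_ofReal hx hR
  rw [toOuterMeasure_compl, ENNReal.toReal_sub_of_le (toOuterMeasure_le_one _ _)
    ENNReal.one_ne_top, ENNReal.toReal_one]
  linarith

end Adversary

/-! ### Asymptotics -/

open Filter Topology in
-- In terms of `y = n^ε` the expression is `y^(1/ε) exp(-κ y)`.
theorem eventually_mul_exp_rpow_le {ε κ δ : ℝ} (hε : 0 < ε) (hκ : 0 < κ) (hδ : 0 < δ) :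
    ∀ᶠ n : ℕ in atTop, (n : ℝ) * Real.exp (-(κ * (n : ℝ) ^ ε)) ≤ δ := by
  have h1 : Tendsto (fun n : ℕ => (n : ℝ) ^ ε) atTop atTop :=
    (tendsto_rpow_atTop hε).comp tendsto_natCast_atTop_atTop
  have h2 := (tendsto_rpow_mul_exp_neg_mul_atTop_nhds_zero (1 / ε) κ hκ).comp h1
  filter_upwards [h2.eventually_le_const hδ] with n hn
  refine le_trans (le_of_eq ?_) hn
  simp only [Function.comp_apply]
  rw [← Real.rpow_mul (Nat.cast_nonneg n), mul_one_div_cancel hε.ne', Real.rpow_one, neg_mul]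

open Filter Topology in
theorem eventually_exp_rpow_le {c κ δ : ℝ} (hc : 0 < c) (hκ : 0 < κ) (hδ : 0 < δ) :
    ∀ᶠ n : ℕ in atTop, Real.exp (-(κ * (n : ℝ) ^ c)) ≤ δ := by
  filter_upwards [eventually_mul_exp_rpow_le hc hκ hδ, eventually_ge_atTop 1] with n hn h1
  refine le_trans ?_ hn
  exact le_mul_of_one_le_left (Real.exp_nonneg _) (by exact_mod_cast h1)

open Filter in
theorem eventually_le_rpow {c : ℝ} (hc : 0 < c) (b : ℝ) : ∀ᶠ n : ℕ in atTop, b ≤ (n : ℝ) ^ c :=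
  ((tendsto_rpow_atTop hc).comp tendsto_natCast_atTop_atTop).eventually_ge_atTop b

end TwoTier

/-! ### Choice of the constants and the main theorem -/

open Filter in
theorem mainTheorem2 (k : ℕ) (hk : 1 ≤ k) (A : Type*) [Fintype A] [Nonempty A]
    (ε η δ M : ℝ) (hε : 0 < ε) (hε1 : ε < 1) (hη : 0 < η) (hη1 : η < 1) (hδ : 0 < δ)
    (r T : ℕ) (hr : 1 ≤ r) (hT : 1 ≤ T) :
    ∃ (K : ℝ) (n₀ : ℕ), ∀ (𝓕 : Set ((Fin k → A) → Bool))
      (loc : TwoTier.NbhdClass 𝓕 → Set.Icc (0 : ℝ) 1)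
      (n m N : ℕ), n₀ ≤ n → (m : ℝ) ≤ M * n → (n : ℝ) ^ (ε / T) = N →
      ∀ (I : TwoTier.CSPInstance 𝓕 n m)
        (hash : PMF (Fin n → Fin N)), TwoTier.KWiseIndep hash (10 * T) →
        ∃ adv : PMF (Fin n → ℕ), TwoTier.ValidAdversary I η adv ∧
          ∃ μ : PMF (Option (TwoTier.Sample k n m
                (TwoTier.mkParams (Fintype.card A) k n ε T r N K) × ℝ) ×
              (TwoTier.Sample k n m
                (TwoTier.mkParams (Fintype.card A) k n ε T r N K) × ℝ)),
            TwoTier.IsCoupling μ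
              (TwoTier.streamingEstimator I
                (TwoTier.mkParams (Fintype.card A) k n ε T r N K) loc hash)
              (TwoTier.offlineEstimator I
                (TwoTier.mkParams (Fintype.card A) k n ε T r N K) loc hash adv) ∧
            1 - 3 * δ < (μ.toOuterMeasure {z | ∃ s out, z.1 = some (s, out) ∧
              TwoTier.Agree s z.2.1 ∧ out = z.2.2}).toReal := by
  set B : ℕ := ⌈(Fintype.card A : ℝ) ^ (2 * k) / ε⌉₊ with hBdef
  have hB : 1 ≤ B := by
    have hA : (0 : ℝ) < Fintype.card A := by exact_mod_cast Fintype.card_pos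
    exact Nat.one_le_ceil_iff.2 (by positivity)
  have hB' : (1 : ℝ) ≤ B := by exact_mod_cast hB
  have hk' : (1 : ℝ) ≤ k := by exact_mod_cast hk
  have hT' : (1 : ℝ) ≤ T := by exact_mod_cast hT
  -- `M` may be small or negative; enlarging it gives `s ≤ a` and keeps the denominators positive.
  set M' : ℝ := max M 1 with hM'
  have hM1 : 1 ≤ M' := le_max_right _ _
  have hMM : M ≤ M' := le_max_left _ _
  set c : ℝ := ε / T with hc
  have hc0 : 0 < c := by positivity
  have hc1 : c < 1 := lt_of_le_of_lt (div_le_self hε.le hT') hε1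
  set κ : ℝ := η ^ 2 / 192 / B with hκ
  have hκ0 : 0 < κ := by positivity
  set W : ℝ := 1 + (B + 1) * (M' * k) with hW
  have hW0 : 0 < W := by positivity
  obtain ⟨n₀, hn₀⟩ := eventually_atTop.1
    ((TwoTier.eventually_mul_exp_rpow_le hε hκ0 (δ := δ / 5) (by positivity)).and
    ((TwoTier.eventually_exp_rpow_le (c := 1 - c) (κ := 1 / 6) (by linarith) (by norm_num)
      (δ := δ / 8) (by positivity)).and ((TwoTier.eventually_le_rpow hc0 2).and
    ((TwoTier.eventually_le_rpow hε (4 * B / η)).and (eventually_ge_atTop 1)))))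
  -- The three terms pay for `θ`, for `18 a` and for the reservoir, all in units of `n^(1-c)`, which
  -- is below the permitted power `n^(1-c/3)`.
  refine ⟨4 * W / δ + 18 * (M' * B * k) + 1, n₀, ?_⟩
  intro 𝓕 loc n m N hn hm hN I hash hhash
  obtain ⟨e1, e2, e3, e4, e5⟩ := hn₀ n hn
  have hn1 : (1 : ℝ) ≤ n := by exact_mod_cast e5
  have hn0 : (0 : ℝ) < n := by linarith
  rw [hN] at e3
  have hN2 : 2 ≤ N := by exact_mod_cast e3
  have hN0 : (0 : ℝ) < N := by linarith
  set K : ℝ := 4 * W / δ + 18 * (M' * B * k) + 1 with hK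
  set P := TwoTier.mkParams (Fintype.card A) k n ε T r N K with hP
  set s : ℝ := (n : ℝ) ^ (1 - c) with hs
  have hs1 : 1 ≤ s := Real.one_le_rpow hn1 (by linarith)
  have hsN : (n : ℝ) / N = s := by
    rw [hs, Real.rpow_sub hn0, Real.rpow_one, hN]
  have hmM : (m : ℝ) ≤ M' * n := hm.trans (by gcongr)
  set a : ℝ := M' * B * k * s with ha
  have hsa : s ≤ a := by
    rw [ha]
    refine le_mul_of_one_le_left (by linarith) ?_
    exact one_le_mul_of_one_le_of_one_le (one_le_mul_of_one_le_of_one_le hM1 hB') hk'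
  set θ : ℝ := 4 * W / δ * s with hθ
  have hθ0 : 0 < θ := by positivity
  have hthr : (0 : ℝ) < (n : ℝ) ^ ε := by positivity
  obtain ⟨adv, hadv, hcoup⟩ := TwoTier.exists_coupling_estimators (P := P) hk I loc hash hhash
    (by omega) hN2 hB hthr (η := η) (a := a) (θ := θ) (κ := κ) hη hη1 (by positivity) hθ0
    (by
      change 4 ≤ η * ((n : ℝ) ^ ε * N / B)
      have h1 : 4 * B ≤ (n : ℝ) ^ ε * η := (div_le_iff₀ hη).1 e4
      have h2 : (n : ℝ) ^ ε * η ≤ (n : ℝ) ^ ε * η * N :=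
        le_mul_of_one_le_right (by positivity) (by linarith)
      rw [← mul_div_assoc, le_div_iff₀ (by positivity)]
      linarith) le_rfl
    (by
      change (B * (m * k) : ℝ) / N ≤ a
      calc (B * (m * k) : ℝ) / N ≤ B * (M' * n * k) / N := by gcongr
        _ = M' * B * k * (n / N) := by ring
        _ = a := by rw [hsN])
    (by
      change θ + 18 * a + (⌊(n : ℝ) ^ (1 - ε / T)⌋₊ : ℝ) ≤ K * (n : ℝ) ^ (1 - ε / T / 3)
      have h1 : (⌊(n : ℝ) ^ (1 - ε / T)⌋₊ : ℝ) ≤ s := Nat.floor_le (by positivity)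
      have h2 : s ≤ (n : ℝ) ^ (1 - ε / T / 3) :=
        Real.rpow_le_rpow_of_exponent_le hn1 (by rw [← hc]; linarith)
      calc θ + 18 * a + (⌊(n : ℝ) ^ (1 - ε / T)⌋₊ : ℝ) ≤ θ + 18 * a + s := by gcongr
        _ = K * s := by rw [hθ, ha, hK]; ring
        _ ≤ _ := by gcongr)
  refine ⟨adv, hadv, ?_⟩
  -- The errors are at most `5 · δ/5`, `2 · δ/8` and `δ/4`, in total below `2δ`; the gap up to `3δ`
  -- yields the strict inequality.
  refine (hcoup.mono (ENNReal.ofReal_le_ofReal (q := 2 * δ) ?_)).lt_toReal (by positivity)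
    (by linarith)
  change 5 * (n * Real.exp (-(κ * (n : ℝ) ^ ε))) + 2 * Real.exp (-(1 / 6 * a)) +
    (n + (B + 1) * (m * k)) / N / θ ≤ 2 * δ
  have f1 : Real.exp (-(1 / 6 * a)) ≤ δ / 8 :=
    (Real.exp_le_exp.2 (by linarith)).trans e2
  have f2 : ((n : ℝ) + (B + 1) * (m * k)) / N / θ ≤ δ / 4 := by
    calc ((n : ℝ) + (B + 1) * (m * k)) / N / θ ≤ (n + (B + 1) * (M' * n * k)) / N / θ := by gcongr
      _ = W * (n / N) / θ := by rw [hW]; ring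
      _ = δ / 4 := by rw [hsN, hθ]; field_simp
  linarith

end
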